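/- Notation: $\|\cdot\|_d$, $\langle\cdot,\cdot\rangle_d$ are the norm and inner product of $L^2[0,1]^d$. Let $(X_i,Y_i)_{i\in\mathbb Z}$ be (jointly measurable) real-valued processes on $[0,1]$ with sample paths in $L^2[0,1]$ such that: (a) $(X_i,Y_i)=g(\epsilon_i,\epsilon_{i-1},\dots)$ for iid innovations $(\epsilon_i)_{i\in\mathbb Z}$ with values in a measurable space $S$ and a measurable $g:S^{\infty}\to L^2[0,1]\times L^2[0,1]$; (b) for some $r>4$ and $\alpha,\beta>1$: $E\|X_0\|_1^r<\infty$, $E\|Y_0\|_1^r<\infty$, and, for $m\ge1$, the variables $(X_{i,m},Y_{i,m})=g(\epsilon_i,\dots,\epsilon_{i-m+1},\epsilon^*_{i-m,m},\epsilon^*_{i-m-1,m},\dots)$ satisfy $(E\|X_i-X_{i,m}\|_1^r)^{1/r}=O(m^{-\alpha})$ and $(E\|Y_i-Y_{i,m}\|_1^r)^{1/r}=O(m^{-\beta})$, where for each $m$ the $\epsilon^*_{i,m}$, $i\in\mathbb Z$, are iid with the law of $\epsilon_0$ and the sequence $(\epsilon^*_{i,m})_i$ is independent of $(\epsilon_i)_i$.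 Put $\mu_X=EX_0$, $\mu_Y=EY_0$ and $$D(t,s,u,v)=\sum_{\ell=-\infty}^{\infty}\operatorname{cov}\big((X_0(t)-\mu_X(t))(Y_0(s)-\mu_Y(s)),\,(X_\ell(u)-\mu_X(u))(Y_\ell(v)-\mu_Y(v))\big),$$ let $d$ be the integral operator on $L^2[0,1]^2$ with kernel $D$, let $\lambda_1\ge\lambda_2\ge\dots\ge0$ be its eigenvalues in decreasing order, counted with multiplicity, and let $\varphi_1,\varphi_2,\dots$ be corresponding orthonormal eigenfunctions. For $T\ge1$ let $\bar X=\frac1T\sum_{i=1}^TX_i$, $\bar Y=\frac1T\sum_{i=1}^TY_i$, $\bar X_j=X_j-\bar X$, $\bar Y_j=Y_j-\bar Y$, $\hat C(t,s)=\frac1T\sum_{j=1}^T\bar X_j(t)\bar Y_j(s)$, $$\hat\gamma_\ell(t,s,u,v)=\frac1T\sum_{j}\big(\bar X_j(t)\bar Y_j(s)-\hat C(t,s)\big)\big(\bar X_{j+\ell}(u)\bar Y_{j+\ell}(v)-\hat C(u,v)\big),$$ where $j$ runs over $1\le j\le T-\ell$ if $\ell\ge0$ and over $1-\ell\le j\le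 T$ if $\ell<0$, and $$\hat D_T=\sum_{\ell=-\infty}^{\infty}W\Big(\frac{\ell}{h(T)}\Big)\hat\gamma_\ell .$$ Here $W:\mathbb R\to\mathbb R$ is symmetric and continuous with bounded support, and of order $b>0$, i.e. $\lim_{x\to0}(1-W(x))/|x|^b$ exists and is finite and nonzero; and $h(T)\to\infty$, $h(T)/T^{1/2}\to0$ as $T\to\infty$. Let $\hat d_T$ be the integral operator with kernel $\hat D_T$, let $\hat\lambda_1\ge\hat\lambda_2\ge\dots$ be its largest eigenvalues in decreasing order, counted with multiplicity, and $\hat\varphi_1,\hat\varphi_2,\dots$ corresponding orthonormal eigenfunctions (any choice of them). Suppose that $p\ge1$ and $\lambda_1>\dots>\lambda_p>\lambda_{p+1}$. Then, as $T\to\infty$, $$\max_{1\le i\le p}\|\hat\varphi_i-\hat c_i\varphi_i\|_2=o_P(1)\quad\text{and}\quad\max_{1\le i\le p}|\hat\lambda_i-\lambda_i|=o_P(1),\qquad \hat c_i=\operatorname{sign}\langle\varphi_i,\hat\varphi_i\rangle_2 .$$ -/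

import Mathlib

open MeasureTheory ProbabilityTheory Filter Topology
open scoped unitInterval

noncomputable section

namespace CrossCov

/-- The real Hilbert space `L²(α)` for the standard measure on `α`. It is used for
`α = I`, that is `L²[0,1]`, and for `α = I × I`, that is `L²[0,1]²`. -/
abbrev L2 (α : Type*) [MeasureSpace α] : Type _ := Lp ℝ 2 (volume : Measure α)

variable {Ω S : Type*}

/-- The innovations `(ε_i, ε_{i-1}, ε_{i-2}, …)` up to time `i`. -/
def past (ε : ℤ → Ω → S) (i : ℤ) (ω : Ω) : ℕ → S :=
  fun k => ε (i - k) ω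

/-- The coupled innovations `(ε_i, …, ε_{i-m+1}, ε*_{i-m}, ε*_{i-m-1}, …)`. -/
def coupledPast (ε εs : ℤ → Ω → S) (m : ℕ) (i : ℤ) (ω : Ω) : ℕ → S :=
  fun k => if k < m then ε (i - k) ω else εs (i - k) ω

/-- The standing assumption on the pair of functional time series `(X_i, Y_i)`, `i ∈ ℤ`: jointly
measurable processes on `[0,1]` with sample paths in `L²[0,1]`, which form a Bernoulli shift
`(X_i, Y_i) = g(ε_i, ε_{i-1}, …)` of iid innovations with values in `S`, have finite moments of
some order `r > 4`, and are approximated at polynomial rates by the sequences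
`(X_{i,m}, Y_{i,m}) = g(ε_i, …, ε_{i-m+1}, ε*_{i-m,m}, ε*_{i-m-1,m}, …)`.

`L²[0,1]` is separable, so strong measurability of `g` is Borel measurability. -/
structure IsApproximableShift [MeasurableSpace Ω] [MeasurableSpace S] (P : Measure Ω)
    (X Y : ℤ → Ω → I → ℝ) (g : (ℕ → S) → L2 I × L2 I)
    (ε : ℤ → Ω → S) (εs : ℕ → ℤ → Ω → S) (r α β : ℝ) : Prop where
  measurable_X : ∀ i, Measurable (fun z : Ω × I => X i z.1 z.2)
  measurable_Y : ∀ i, Measurable (fun z : Ω × I => Y i z.1 z.2)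
  paths_X : ∀ i ω, MemLp (X i ω) 2 volume
  paths_Y : ∀ i ω, MemLp (Y i ω) 2 volume
  measurable_g : StronglyMeasurable g
  measurable_innov : ∀ i, Measurable (ε i)
  indep_innov : iIndepFun ε P
  ident_innov : ∀ i, IdentDistrib (ε i) (ε 0) P P
  shift_X : ∀ i, ∀ᵐ ω ∂P, X i ω =ᵐ[volume] (g (past ε i ω)).1
  shift_Y : ∀ i, ∀ᵐ ω ∂P, Y i ω =ᵐ[volume] (g (past ε i ω)).2
  measurable_copy : ∀ m, 1 ≤ m → ∀ i, Measurable (εs m i)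
  indep_copy : ∀ m, 1 ≤ m → iIndepFun (εs m) P
  ident_copy : ∀ m, 1 ≤ m → ∀ i, IdentDistrib (εs m i) (ε 0) P P
  indep_innov_copy : ∀ m, 1 ≤ m → IndepFun (fun ω i => ε i ω) (fun ω i => εs m i ω) P
  four_lt : 4 < r
  one_lt_α : 1 < α
  one_lt_β : 1 < β
  moment_X : MemLp (fun ω => (g (past ε 0 ω)).1) (ENNReal.ofReal r) P
  moment_Y : MemLp (fun ω => (g (past ε 0 ω)).2) (ENNReal.ofReal r) P
  rate_X : ∀ i, ∃ C : ℝ, ∀ m : ℕ, 1 ≤ m →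
    eLpNorm (fun ω => (g (past ε i ω)).1 - (g (coupledPast ε (εs m) m i ω)).1)
      (ENNReal.ofReal r) P ≤ ENNReal.ofReal (C * (m : ℝ) ^ (-α))
  rate_Y : ∀ i, ∃ C : ℝ, ∀ m : ℕ, 1 ≤ m →
    eLpNorm (fun ω => (g (past ε i ω)).2 - (g (coupledPast ε (εs m) m i ω)).2)
      (ENNReal.ofReal r) P ≤ ENNReal.ofReal (C * (m : ℝ) ^ (-β))

/-- The product `(X_i(t) - μ_X(t)) (Y_i(s) - μ_Y(s))` at `z = (t, s)`, where `μ_X = E X_0` and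
`μ_Y = E Y_0`. -/
def centeredProd [MeasurableSpace Ω] (P : Measure Ω) (X Y : ℤ → Ω → I → ℝ) (i : ℤ) (ω : Ω)
    (z : I × I) : ℝ :=
  (X i ω z.1 - ∫ ω', X 0 ω' z.1 ∂P) * (Y i ω z.2 - ∫ ω', Y 0 ω' z.2 ∂P)

/-- The long run covariance function `D(t,s,u,v)` at `z = (t, s)`, `w = (u, v)`. -/
def longRunCov [MeasurableSpace Ω] (P : Measure Ω) (X Y : ℤ → Ω → I → ℝ) (z w : I × I) : ℝ :=
  ∑' ℓ : ℤ, covariance (fun ω => centeredProd P X Y 0 ω z) (fun ω => centeredProd P X Y ℓ ω w) P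

/-- The sample mean `X̄(t)` of `X_1, …, X_T`. -/
def sampleMean (X : ℤ → Ω → I → ℝ) (T : ℕ) (ω : Ω) (t : I) : ℝ :=
  (1 / (T : ℝ)) * ∑ i ∈ Finset.Icc (1 : ℤ) T, X i ω t

/-- The product `(X_j(t) - X̄(t)) (Y_j(s) - Ȳ(s))` at `z = (t, s)`. -/
def sampleCenteredProd (X Y : ℤ → Ω → I → ℝ) (T : ℕ) (j : ℤ) (ω : Ω) (z : I × I) : ℝ :=
  (X j ω z.1 - sampleMean X T ω z.1) * (Y j ω z.2 - sampleMean Y T ω z.2)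

/-- The full sample estimator `Ĉ_XY(t, s, 1)` of the cross-covariance function. -/
def sampleCrossCov (X Y : ℤ → Ω → I → ℝ) (T : ℕ) (ω : Ω) (z : I × I) : ℝ :=
  (1 / (T : ℝ)) * ∑ j ∈ Finset.Icc (1 : ℤ) T, sampleCenteredProd X Y T j ω z

/-- The lag `ℓ` sample autocovariance function `γ̂_ℓ(t,s,u,v)` at `z = (t, s)`, `w = (u, v)`. -/
def sampleAutocov (X Y : ℤ → Ω → I → ℝ) (T : ℕ) (ℓ : ℤ) (ω : Ω) (z w : I × I) : ℝ :=
  (1 / (T : ℝ)) *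
    ∑ j ∈ (if 0 ≤ ℓ then Finset.Icc (1 : ℤ) (T - ℓ) else Finset.Icc (1 - ℓ) (T : ℤ)),
      (sampleCenteredProd X Y T j ω z - sampleCrossCov X Y T ω z) *
        (sampleCenteredProd X Y T (j + ℓ) ω w - sampleCrossCov X Y T ω w)

/-- The estimator `D̂_T(t,s,u,v)` with weight function `W` and bandwidth `h`. Only finitely many
terms of the sum are nonzero, because `γ̂_ℓ = 0` for `|ℓ| ≥ T`. -/
def longRunCovEst (X Y : ℤ → Ω → I → ℝ) (W : ℝ → ℝ) (h : ℝ) (T : ℕ) (ω : Ω) (z w : I × I) : ℝ :=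
  ∑' ℓ : ℤ, W ((ℓ : ℝ) / h) * sampleAutocov X Y T ℓ ω z w

/-- A symmetric and continuous weight function with bounded support, of order `b`, meaning that
`(1 - W(x)) / |x|^b` has a finite nonzero limit as `x → 0` (in particular `W(0) = 1`). -/
structure IsWeightFunction (W : ℝ → ℝ) (b : ℝ) : Prop where
  even : ∀ x, W (-x) = W x
  continuous : Continuous W
  bounded_support : HasCompactSupport W
  order_pos : 0 < b
  order : ∃ k : ℝ, k ≠ 0 ∧ Tendsto (fun x => (1 - W x) / |x| ^ b) (𝓝[≠] 0) (𝓝 k)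

/-- The integral operator with kernel `K`: `(K f)(t,s) = ∫∫ K(t,s,u,v) f(u,v) du dv`. -/
def kernelOp (K : I × I → I × I → ℝ) (f : I × I → ℝ) (z : I × I) : ℝ :=
  ∫ w, K z w * f w

/-- `f ∈ L²[0,1]²` satisfies the equation `K f = μ f` for the integral operator with kernel `K`. -/
def EigenEq (K : I × I → I × I → ℝ) (μ : ℝ) (f : L2 (I × I)) : Prop :=
  kernelOp K f =ᵐ[volume] fun z => μ * f z

/-- `lam 0 ≥ lam 1 ≥ …` are the largest eigenvalues, counted with multiplicity, of the integral
operator with kernel `K`, and `φ 0, φ 1, …` are corresponding orthonormal eigenfunctions: no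
eigenfunction that is orthogonal to `φ 0, …, φ i` has an eigenvalue above `lam i`. -/
structure IsOrderedEigensystem (K : I × I → I × I → ℝ) (lam : ℕ → ℝ) (φ : ℕ → L2 (I × I)) :
    Prop where
  orthonormal : Orthonormal ℝ φ
  eigen : ∀ i, EigenEq K (lam i) (φ i)
  antitone : Antitone lam
  largest : ∀ (i : ℕ) (μ : ℝ) (f : L2 (I × I)), f ≠ 0 → EigenEq K μ f →
    (∀ j ≤ i, inner ℝ (φ j) f = 0) → μ ≤ lam i

end CrossCov

end

set_option linter.unusedSectionVars false

/-! The theorem combines a deterministic perturbation bound for compact symmetric operators with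
convergence in probability of the estimated kernel in `L2`.

For ordered eigensystems of `K` and `K'`, the min-max principle moves each eigenvalue by at most `‖K
- K'‖`, and spectral gaps move the eigenvectors, up to sign, by at most a constant times `‖K - K'‖`
(`IsOrderedEigenseq.abs_eigenvalue_sub_le`, `IsOrderedEigenseq.norm_eigenvector_sub_le`). The
operator norm is at most the `L2` norm of the kernel, so everything reduces to `‖D̂_T - D‖ → 0` in
probability (`IsApproximableShift.tendsto_measure_kerHat`).

Let `Z_i` be the centered version of `(X_i - μ_X) ⊗ (Y_i - μ_Y)`, so that `D` is the sum over `ℓ` of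
`E[Z_0 ⊗ Z_ℓ]`. Fourth moments of `X` and `Y` and the coupling make `Z` approximable in `L²(P)`, at
a summable rate, by bounded centered functions of the last `m` innovations (`isApprox_of_coupling`,
`IsCoupled.tensor`). At lag `ℓ` take `m = ℓ / 2`: the two factors of a local lag product are then
independent and centered, and because inner products of tensors factorize, a sum of `n` such
products has `L²(P)` norm `O(√n)` uniformly in `ℓ`. Hence a lag average has mean norm at most `b_ℓ +
C/√T` with `b` summable (`IsApprox.integral_norm_lagSum_le`), using second moments of `Z` only.

Since `O(h)` lags carry weight, the terms `C/√T` add up to `O(h/√T)`, which vanishes. The part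
dominated by `b_ℓ` follows from the law of large numbers at each fixed lag and dominated convergence
(`IsApprox.tendsto_integral_norm_weighted`). Centering by sample means changes each `Z_j` by a
relative amount `O_P(T^{-1/2})`, which over `O(h)` lags is again `O_P(h/√T)`
(`norm_sampleTensor_sub_le`, `tendsto_measure_estTot`).

The pointwise kernels of the statement represent these abstract elements of `L2` almost everywhere.
Compactness and symmetry of the limit operator are inherited from the finite rank estimators
(`IsApproximableShift.longRunKer_mem`). -/

namespace CrossCov

/-! ### Perturbation of eigenvalues and eigenvectors of compact symmetric operators. -/

section Perturbation

variable {H : Type*} [NormedAddCommGroup H] [InnerProductSpace ℝ H]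

/-- Operator version of `IsOrderedEigensystem`. -/
structure IsOrderedEigenseq (K : H →L[ℝ] H) (lam : ℕ → ℝ) (φ : ℕ → H) : Prop where
  orthonormal : Orthonormal ℝ φ
  eigen : ∀ i, K (φ i) = lam i • φ i
  antitone : Antitone lam
  largest : ∀ (i : ℕ) (μ : ℝ) (f : H), f ≠ 0 → K f = μ • f →
    (∀ j ≤ i, inner ℝ (φ j) f = 0) → μ ≤ lam i

/-- A quadratic form of a compact symmetric operator is bounded by any bound of its eigenvalues. -/
theorem inner_apply_le_of_eigenvalue_le [CompleteSpace H] {T : H →ₗ[ℝ] H}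
    (hT : IsCompactOperator T) (hs : T.IsSymmetric) {c : ℝ}
    (hc : ∀ (μ : ℝ) (f : H), f ≠ 0 → T f = μ • f → μ ≤ c) (f : H) :
    inner ℝ (T f) f ≤ c * inner ℝ f f := by
  have hcont : Continuous T := hT.continuous
  have hclosed : IsClosed {f : H | inner ℝ (T f) f ≤ c * inner ℝ f f} :=
    isClosed_le (hcont.inner continuous_id)
      (continuous_const.mul (continuous_id.inner continuous_id))
  have hdense : (⨆ μ, Module.End.eigenspace T μ).topologicalClosure = ⊤ :=
    Submodule.topologicalClosure_eq_top_iff.2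
      (ContinuousLinearMap.orthogonalComplement_iSup_eigenspaces_eq_bot
        (T := ⟨T, hcont⟩) hT hs)
  have hf : f ∈ closure ((⨆ μ, Module.End.eigenspace T μ : Submodule ℝ H) : Set H) := by
    rw [← Submodule.topologicalClosure_coe, hdense]; trivial
  -- Finite sums of eigenvectors are dense, and on them the form is diagonal. The eigenvalue 0 is
  -- among those bounded by `c`, so no sign condition on `c` is needed.
  refine closure_minimal (fun v hv => ?_) hclosed hf
  obtain ⟨v', hv', rfl⟩ := (Submodule.mem_iSup_iff_exists_finsupp _ _).1 hv
  have horth : ∀ μ ν, μ ≠ ν → inner ℝ (v' μ) (v' ν) = 0 := fun μ ν h =>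
    hs.orthogonalFamily_eigenspaces h ⟨v' μ, hv' μ⟩ ⟨v' ν, hv' ν⟩
  have hT' : ∀ μ, T (v' μ) = μ • v' μ := fun μ => Module.End.mem_eigenspace_iff.1 (hv' μ)
  simp only [Set.mem_ofPred_eq, Finsupp.sum, map_sum, hT', sum_inner, inner_sum, inner_smul_left,
    Finset.mul_sum]
  refine Finset.sum_le_sum fun μ hμ => Finset.sum_le_sum fun ν hν => ?_
  by_cases h : ν = μ
  · subst h
    have hne : v' ν ≠ 0 := Finsupp.mem_support_iff.1 hν
    exact mul_le_mul_of_nonneg_right (hc ν _ hne (hT' ν)) real_inner_self_nonneg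
  · rw [horth _ _ h]; simp

/-- Upper half of the min-max principle. The orthogonal complement of `φ 0, …, φ (i-1)` is invariant
because `K` is symmetric, so the spectral bound applies to the restriction of `K` to it. -/
theorem IsOrderedEigenseq.inner_apply_le [CompleteSpace H] {K : H →L[ℝ] H} {lam : ℕ → ℝ}
    {φ : ℕ → H} (h : IsOrderedEigenseq K lam φ) (hK : IsCompactOperator K)
    (hs : (K : H →ₗ[ℝ] H).IsSymmetric) (i : ℕ) (f : H)
    (hf : ∀ j < i, inner ℝ (φ j) f = 0) : inner ℝ (K f) f ≤ lam i * inner ℝ f f := by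
  let V : Submodule ℝ H := (Submodule.span ℝ (φ '' Set.Iio i))ᗮ
  have hmem : ∀ g : H, g ∈ V ↔ ∀ j < i, inner ℝ (φ j) g = 0 := by
    intro g
    rw [Submodule.mem_orthogonal]
    constructor
    · intro hg j hj
      exact hg _ (Submodule.subset_span ⟨j, hj, rfl⟩)
    · intro hg u hu
      induction hu using Submodule.span_induction with
      | mem x hx => obtain ⟨j, hj, rfl⟩ := hx; exact hg j hj
      | zero => simp
      | add x y _ _ hx hy => rw [inner_add_left, hx, hy, add_zero]
      | smul a x _ hx => rw [inner_smul_left, hx, mul_zero]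
  have hinv : ∀ v ∈ V, (K : H →ₗ[ℝ] H) v ∈ V := by
    intro v hv
    rw [hmem] at hv ⊢
    intro j hj
    have := hs (φ j) v
    simp only [ContinuousLinearMap.coe_coe] at this ⊢
    rw [← this, h.eigen, inner_smul_left, hv j hj, mul_zero]
  have hVc : IsCompactOperator ((K : H →ₗ[ℝ] H).restrict hinv) :=
    IsCompactOperator.restrict' (f := (K : H →ₗ[ℝ] H)) hK hinv
  have key := inner_apply_le_of_eigenvalue_le (c := lam i) hVc (hs.restrict_invariant hinv)
    (fun μ g hg hgμ => ?_) ⟨f, (hmem f).2 hf⟩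
  · exact key
  · have hgμ' : K (g : H) = μ • (g : H) := congrArg Subtype.val hgμ
    have hg0 : (g : H) ≠ 0 := fun h0 => hg (Subtype.ext h0)
    -- The field `largest` also asks for orthogonality to `φ i`. Symmetry gives it when `μ ≠ lam i`;
    -- otherwise nothing is left to prove.
    by_cases hμ : μ = lam i
    · exact hμ.le
    · refine h.largest i μ g hg0 hgμ' fun j hj => ?_
      rcases hj.lt_or_eq with hj | rfl
      · exact (hmem g).1 g.2 j hj
      · have := hs (φ j) g
        simp only [ContinuousLinearMap.coe_coe] at this
        rw [h.eigen, hgμ', inner_smul_left, inner_smul_right] at this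
        have h2 : (lam j - μ) * inner ℝ (φ j) (g : H) = 0 := by
          rw [sub_mul]; exact sub_eq_zero.2 this
        exact (mul_eq_zero.1 h2).resolve_left (sub_ne_zero.2 (Ne.symm hμ))

/-- Lower half of the min-max principle: on the span of `φ 0, …, φ i` the form is diagonal with
entries at least `lam i`. -/
theorem IsOrderedEigenseq.le_inner_apply {K : H →L[ℝ] H} {lam : ℕ → ℝ} {φ : ℕ → H}
    (h : IsOrderedEigenseq K lam φ) (i : ℕ) (c : Fin (i + 1) → ℝ) :
    lam i * inner ℝ (∑ j, c j • φ j) (∑ j, c j • φ j) ≤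
      inner ℝ (K (∑ j, c j • φ j)) (∑ j, c j • φ j) := by
  have ho : Orthonormal ℝ (fun j : Fin (i + 1) => φ j) :=
    h.orthonormal.comp _ Fin.val_injective
  have hK : K (∑ j, c j • φ j) = ∑ j, (c j * lam j) • φ j := by
    rw [map_sum]
    refine Finset.sum_congr rfl fun j _ => ?_
    rw [map_smul, h.eigen, smul_smul]
  rw [hK, ho.inner_sum, ho.inner_sum, Finset.mul_sum]
  refine Finset.sum_le_sum fun j _ => ?_
  have : lam i ≤ lam j := h.antitone (Nat.lt_succ_iff.1 j.2)
  simp only [conj_trivial]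
  nlinarith [mul_self_nonneg (c j)]

/-- A nonzero vector in the span of `i + 1` vectors orthogonal to `i` given vectors. -/
theorem exists_coeff_orthogonal {ψ : ℕ → H} (φ : ℕ → H) (i : ℕ) :
    ∃ c : Fin (i + 1) → ℝ, c ≠ 0 ∧ ∀ j < i, inner ℝ (φ j) (∑ k, c k • ψ k) = 0 := by
  let L : (Fin (i + 1) → ℝ) →ₗ[ℝ] (Fin i → ℝ) :=
    LinearMap.pi fun j => (innerₛₗ ℝ (φ j)).comp
      (Fintype.linearCombination ℝ (fun k : Fin (i + 1) => ψ k))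
  have hker : LinearMap.ker L ≠ ⊥ := by
    apply LinearMap.ker_ne_bot_of_finrank_lt
    simp
  obtain ⟨c, hc, hc0⟩ := Submodule.exists_mem_ne_zero_of_ne_bot hker
  refine ⟨c, hc0, fun j hj => ?_⟩
  have := congrFun (LinearMap.mem_ker.1 hc) ⟨j, hj⟩
  simpa [L, Fintype.linearCombination_apply] using this

/-- Weyl's inequality. By counting dimensions, some nonzero `f` lies in the span of the first `i +
1` eigenvectors of `K'` and is orthogonal to the first `i` of `K`; comparing both forms at `f` gives
the bound. -/
theorem IsOrderedEigenseq.eigenvalue_le [CompleteSpace H] {K K' : H →L[ℝ] H}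
    {lam lam' : ℕ → ℝ} {φ φ' : ℕ → H} (h : IsOrderedEigenseq K lam φ)
    (h' : IsOrderedEigenseq K' lam' φ') (hK : IsCompactOperator K)
    (hs : (K : H →ₗ[ℝ] H).IsSymmetric) (i : ℕ) : lam' i ≤ lam i + ‖K - K'‖ := by
  obtain ⟨c, hc0, hc⟩ := exists_coeff_orthogonal (ψ := φ') φ i
  set f := ∑ k, c k • φ' k with hf
  have hli : LinearIndependent ℝ (fun j : Fin (i + 1) => φ' j) :=
    (h'.orthonormal.comp _ Fin.val_injective).linearIndependent
  have hfne : f ≠ 0 := fun h0 => hc0 (funext fun k =>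
    Fintype.linearIndependent_iff.1 hli c h0 k)
  have h1 := h.inner_apply_le hK hs i f hc
  have h2 := h'.le_inner_apply i c
  rw [← hf] at h2
  have h3 : inner ℝ (K' f) f - inner ℝ (K f) f ≤ ‖K - K'‖ * inner ℝ f f := by
    rw [← inner_sub_left, ← _root_.sub_apply]
    calc inner ℝ ((K' - K) f) f ≤ ‖(K' - K) f‖ * ‖f‖ := real_inner_le_norm _ _
      _ ≤ ‖K' - K‖ * ‖f‖ * ‖f‖ := by gcongr; exact ContinuousLinearMap.le_opNorm _ _
      _ = ‖K - K'‖ * inner ℝ f f := by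
        rw [real_inner_self_eq_norm_sq, norm_sub_rev]; ring
  have hpos : 0 < inner ℝ f f := real_inner_self_pos.2 hfne
  have : lam' i * inner ℝ f f ≤ (lam i + ‖K - K'‖) * inner ℝ f f := by linarith
  exact le_of_mul_le_mul_right this hpos

theorem IsOrderedEigenseq.abs_eigenvalue_sub_le [CompleteSpace H] {K K' : H →L[ℝ] H}
    {lam lam' : ℕ → ℝ} {φ φ' : ℕ → H} (h : IsOrderedEigenseq K lam φ)
    (h' : IsOrderedEigenseq K' lam' φ') (hK : IsCompactOperator K)
    (hs : (K : H →ₗ[ℝ] H).IsSymmetric) (hK' : IsCompactOperator K')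
    (hs' : (K' : H →ₗ[ℝ] H).IsSymmetric) (i : ℕ) : |lam' i - lam i| ≤ ‖K - K'‖ := by
  have h1 := h.eigenvalue_le h' hK hs i
  have h2 := h'.eigenvalue_le h hK' hs' i
  rw [norm_sub_rev] at h2
  rw [abs_le]; constructor <;> linarith

/-- Eigenvectors of simple eigenvalues depend in a Lipschitz way on the operator. -/
theorem IsOrderedEigenseq.norm_eigenvector_sub_le [CompleteSpace H] {K K' : H →L[ℝ] H}
    {lam lam' : ℕ → ℝ} {φ φ' : ℕ → H} (h : IsOrderedEigenseq K lam φ)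
    (h' : IsOrderedEigenseq K' lam' φ') (hK : IsCompactOperator K)
    (hs : (K : H →ₗ[ℝ] H).IsSymmetric) (hK' : IsCompactOperator K')
    (hs' : (K' : H →ₗ[ℝ] H).IsSymmetric) {i : ℕ} {δ : ℝ} (hδ : 0 < δ)
    (hgap : ∀ j ≤ i, δ ≤ lam j - lam (j + 1)) :
    ‖φ' i - Real.sign (inner ℝ (φ i) (φ' i)) • φ i‖ ≤ 4 * (i + 1) / δ * ‖K - K'‖ := by
  set η := ‖K - K'‖ with hη
  set f := φ' i with hf
  have hη0 : 0 ≤ η := norm_nonneg _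
  have hfn : ‖f‖ = 1 := h'.orthonormal.1 i
  set e : H := K f - lam i • f with he
  -- One `η` comes from the change of the operator and one from the change of the eigenvalue.
  have hes : ‖e‖ ≤ 2 * η := by
    have : e = (K - K') f + (lam' i - lam i) • f := by
      simp only [he, _root_.sub_apply, hf, h'.eigen, sub_smul]; abel
    calc ‖e‖ ≤ ‖(K - K') f‖ + ‖(lam' i - lam i) • f‖ := this ▸ norm_add_le _ _
      _ ≤ η * ‖f‖ + |lam' i - lam i| * ‖f‖ := by
        rw [norm_smul, Real.norm_eq_abs]; gcongr; exact ContinuousLinearMap.le_opNorm _ _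
      _ ≤ 2 * η := by
        rw [hfn]; linarith [h.abs_eigenvalue_sub_le h' hK hs hK' hs' i]
  set a : ℕ → ℝ := fun j => inner ℝ (φ j) f with ha
  have hKsymm : ∀ x y, inner ℝ (K x) y = inner ℝ x (K y) := fun x y => hs x y
  have hmono : ∀ j < i, δ ≤ lam j - lam i := fun j hj =>
    (hgap j hj.le).trans (by linarith [h.antitone (Nat.succ_le_of_lt hj)])
  -- components along the larger eigenvalues
  have hcoef : ∀ j < i, |a j| ≤ 2 * η / δ := by
    intro j hj
    have h1 : inner ℝ (φ j) e = (lam j - lam i) * a j := by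
      rw [he, inner_sub_right, ← hKsymm, h.eigen, inner_smul_left, inner_smul_right]
      simp [ha]; ring
    have h2 : |inner ℝ (φ j) e| ≤ 2 * η := by
      refine (abs_real_inner_le_norm _ _).trans ?_
      rw [h.orthonormal.1 j, one_mul]; exact hes
    rw [h1, abs_mul] at h2
    rw [le_div_iff₀ hδ]
    have h3 : δ ≤ |lam j - lam i| := (hmono j hj).trans (le_abs_self _)
    nlinarith [abs_nonneg (a j)]
  set s : H := ∑ j ∈ Finset.range i, a j • φ j with hsdef
  set v : H := f - s - a i • φ i with hv
  have hinner_s : ∀ k, inner ℝ (φ k) s = if k < i then a k else 0 := by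
    intro k
    simp only [hsdef, inner_sum, inner_smul_right, orthonormal_iff_ite.1 h.orthonormal]
    simp
  have hvorth : ∀ j < i + 1, inner ℝ (φ j) v = 0 := by
    intro j hj
    rw [hv, inner_sub_right, inner_sub_right, hinner_s, inner_smul_right,
      orthonormal_iff_ite.1 h.orthonormal]
    rcases (Nat.lt_succ_iff.1 hj).lt_or_eq with hj | rfl
    · simp [hj, hj.ne, ha]
    · simp [ha]
  have hve : inner ℝ (K v) v - lam i * inner ℝ v v = inner ℝ e v := by
    have hsv : inner ℝ s v = 0 := by
      rw [hsdef, sum_inner]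
      refine Finset.sum_eq_zero fun j hj => ?_
      rw [inner_smul_left, hvorth j (by have := Finset.mem_range.1 hj; omega), mul_zero]
    have hKsv : inner ℝ (K s) v = 0 := by
      rw [hsdef, map_sum, sum_inner]
      refine Finset.sum_eq_zero fun j hj => ?_
      rw [map_smul, h.eigen, inner_smul_left, inner_smul_left,
        hvorth j (by have := Finset.mem_range.1 hj; omega), mul_zero, mul_zero]
    have hiv := hvorth i (by omega)
    have hfv : f = v + s + a i • φ i := by rw [hv]; abel
    have h1 : inner ℝ (K f) v = inner ℝ (K v) v := by
      conv_lhs => rw [hfv]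
      rw [map_add, map_add, inner_add_left, inner_add_left, hKsv, map_smul, h.eigen,
        inner_smul_left, inner_smul_left, hiv]; ring
    have h2 : inner ℝ f v = inner ℝ v v := by
      conv_lhs => rw [hfv]
      rw [inner_add_left, inner_add_left, hsv, inner_smul_left, hiv]; ring
    have h3 : inner ℝ e v = inner ℝ (K f) v - lam i * inner ℝ f v := by
      rw [he, inner_sub_left, inner_smul_left]; simp
    rw [h3, h1, h2]
  -- On the complement of `φ 0, …, φ i` the form of `K` is at most `lam (i+1)`, so the gap gives `δ
  -- ‖v‖² ≤ -⟨e, v⟩ ≤ 2 η ‖v‖`.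
  have hvn : ‖v‖ ≤ 2 * η / δ := by
    have h1 := h.inner_apply_le hK hs (i + 1) v hvorth
    have h2 : -(2 * η * ‖v‖) ≤ inner ℝ e v := by
      have := abs_le.1 (abs_real_inner_le_norm e v)
      nlinarith [norm_nonneg v]
    have h3 := hgap i le_rfl
    rw [real_inner_self_eq_norm_sq] at h1 hve
    rcases (norm_nonneg v).eq_or_lt with h0 | h0
    · rw [← h0]; positivity
    · rw [le_div_iff₀ hδ]
      have : δ * ‖v‖ ^ 2 ≤ 2 * η * ‖v‖ := by nlinarith
      have : (‖v‖ * δ) * ‖v‖ ≤ 2 * η * ‖v‖ := by nlinarith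
      exact le_of_mul_le_mul_right this h0
  have hsn : ‖s‖ ≤ i * (2 * η / δ) := by
    refine (norm_sum_le _ _).trans ?_
    calc ∑ j ∈ Finset.range i, ‖a j • φ j‖ ≤ ∑ j ∈ Finset.range i, 2 * η / δ := by
          refine Finset.sum_le_sum fun j hj => ?_
          rw [norm_smul, h.orthonormal.1 j, mul_one]
          exact hcoef j (Finset.mem_range.1 hj)
      _ = i * (2 * η / δ) := by simp
  set w : H := f - a i • φ i with hw
  have hwn : ‖w‖ ≤ (i + 1) * (2 * η / δ) := by
    have : w = s + v := by rw [hw, hv]; abel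
    calc ‖w‖ ≤ ‖s‖ + ‖v‖ := this ▸ norm_add_le _ _
      _ ≤ _ := by linarith
  have hai : ‖a i • φ i‖ = |a i| := by
    rw [norm_smul, h.orthonormal.1 i, mul_one, Real.norm_eq_abs]
  have hal : |a i| ≤ 1 := by
    refine (abs_real_inner_le_norm _ _).trans ?_
    rw [h.orthonormal.1 i, hfn, one_mul]
  have hau : 1 ≤ |a i| + ‖w‖ := by
    rw [← hai, ← hfn]
    have : f = a i • φ i + w := by rw [hw]; abel
    calc ‖f‖ = ‖a i • φ i + w‖ := by rw [← this]
      _ ≤ _ := norm_add_le _ _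
  -- As `f` and `φ i` are unit vectors, `|a i|` is within `‖w‖` of 1. This second `‖w‖` doubles the
  -- final constant. If `a i = 0`, the sign is 0 and the bound is trivial.
  have hsign : |a i - Real.sign (a i)| ≤ ‖w‖ := by
    rcases lt_trichotomy (a i) 0 with h0 | h0 | h0
    · rw [Real.sign_of_neg h0, abs_le]
      rw [abs_of_neg h0] at hal hau
      constructor <;> linarith
    · rw [h0]; simp
    · rw [Real.sign_of_pos h0, abs_le]
      rw [abs_of_pos h0] at hal hau
      constructor <;> linarith
  have hfin : f - Real.sign (a i) • φ i = w + (a i - Real.sign (a i)) • φ i := by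
    rw [hw, sub_smul]; abel
  calc ‖f - Real.sign (a i) • φ i‖ ≤ ‖w‖ + ‖(a i - Real.sign (a i)) • φ i‖ :=
        hfin ▸ norm_add_le _ _
    _ ≤ 2 * ‖w‖ := by
        rw [norm_smul, h.orthonormal.1 i, mul_one, Real.norm_eq_abs]; linarith
    _ ≤ 2 * ((i + 1) * (2 * η / δ)) := by gcongr
    _ = 4 * (i + 1) / δ * η := by ring

end Perturbation

/-! ### Tensor products of square integrable functions. -/

section Tensor

variable {α β : Type*} [MeasureSpace α] [MeasureSpace β]

theorem memLp_two_mul_prod [SFinite (volume : Measure α)] [SFinite (volume : Measure β)]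
    {f : α → ℝ} {g : β → ℝ} (hf : MemLp f 2 volume)
    (hg : MemLp g 2 volume) : MemLp (fun z : α × β => f z.1 * g z.2) 2 volume := by
  have hm : AEStronglyMeasurable (fun z : α × β => f z.1 * g z.2) volume :=
    (hf.1.comp_quasiMeasurePreserving Measure.quasiMeasurePreserving_fst).mul
      (hg.1.comp_quasiMeasurePreserving Measure.quasiMeasurePreserving_snd)
  rw [memLp_two_iff_integrable_sq hm]
  have := hf.integrable_sq.mul_prod hg.integrable_sq
  refine this.congr (Eventually.of_forall fun z => ?_)
  simp only [mul_pow]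

theorem ae_eq_mul_prod [SFinite (volume : Measure α)] [SFinite (volume : Measure β)]
    {f f' : α → ℝ} {g g' : β → ℝ} (hf : f =ᵐ[volume] f')
    (hg : g =ᵐ[volume] g') :
    (fun z : α × β => f z.1 * g z.2) =ᵐ[volume] fun z => f' z.1 * g' z.2 := by
  have h1 : (fun z : α × β => f z.1) =ᵐ[volume] fun z => f' z.1 :=
    Measure.quasiMeasurePreserving_fst.ae_eq_comp hf
  have h2 : (fun z : α × β => g z.2) =ᵐ[volume] fun z => g' z.2 :=
    Measure.quasiMeasurePreserving_snd.ae_eq_comp hg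
  exact h1.mul h2

theorem inner_L2_eq (f g : L2 α) : inner ℝ f g = ∫ x, f x * g x := by
  rw [L2.inner_def]
  refine integral_congr_ae (Eventually.of_forall fun x => ?_)
  simp [mul_comm]

variable [IsFiniteMeasure (volume : Measure α)] [IsFiniteMeasure (volume : Measure β)]

/-- The tensor product of two square integrable functions, as a plain function of them. -/
noncomputable def tenFun (f : L2 α) (g : L2 β) : L2 (α × β) :=
  (memLp_two_mul_prod (Lp.memLp f) (Lp.memLp g)).toLp _

theorem tenFun_ae (f : L2 α) (g : L2 β) :
    tenFun f g =ᵐ[volume] fun z : α × β => f z.1 * g z.2 := MemLp.coeFn_toLp _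

theorem inner_tenFun (f f' : L2 α) (g g' : L2 β) :
    inner ℝ (tenFun f g) (tenFun f' g') = inner ℝ f f' * inner ℝ g g' := by
  rw [inner_L2_eq, inner_L2_eq, inner_L2_eq]
  calc ∫ z, tenFun f g z * tenFun f' g' z
      = ∫ z : α × β, (f z.1 * f' z.1) * (g z.2 * g' z.2) := by
        refine integral_congr_ae ?_
        filter_upwards [tenFun_ae f g, tenFun_ae f' g'] with z h1 h2
        rw [h1, h2]; ring
    _ = _ := integral_prod_mul (fun x => f x * f' x) (fun y => g y * g' y)

theorem norm_tenFun (f : L2 α) (g : L2 β) : ‖tenFun f g‖ = ‖f‖ * ‖g‖ := by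
  have h := inner_tenFun f f g g
  rw [real_inner_self_eq_norm_sq, real_inner_self_eq_norm_sq, real_inner_self_eq_norm_sq,
    ← mul_pow] at h
  exact (sq_eq_sq₀ (norm_nonneg _) (by positivity)).1 h

/-- The tensor product `(f ⊗ g)(x, y) = f(x) g(y)` of square integrable functions. -/
noncomputable def ten : L2 α →L[ℝ] L2 β →L[ℝ] L2 (α × β) :=
  LinearMap.mkContinuous₂
    (LinearMap.mk₂ ℝ tenFun
      (fun f f' g => by
        refine Lp.ext ?_
        have h := ae_eq_mul_prod (Lp.coeFn_add f f') (ae_eq_refl (g : β → ℝ))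
        filter_upwards [tenFun_ae (f + f') g, tenFun_ae f g, tenFun_ae f' g, h,
          Lp.coeFn_add (tenFun f g) (tenFun f' g)] with z h1 h2 h3 h4 h5
        rw [h1, h5, h4, Pi.add_apply, Pi.add_apply, h2, h3, add_mul])
      (fun c f g => by
        refine Lp.ext ?_
        have h := ae_eq_mul_prod (Lp.coeFn_smul c f) (ae_eq_refl (g : β → ℝ))
        filter_upwards [tenFun_ae (c • f) g, tenFun_ae f g, h,
          Lp.coeFn_smul c (tenFun f g)] with z h1 h2 h4 h5
        rw [h1, h5, h4, Pi.smul_apply, Pi.smul_apply, h2, smul_eq_mul, smul_eq_mul, mul_assoc])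
      (fun f g g' => by
        refine Lp.ext ?_
        have h := ae_eq_mul_prod (ae_eq_refl (f : α → ℝ)) (Lp.coeFn_add g g')
        filter_upwards [tenFun_ae f (g + g'), tenFun_ae f g, tenFun_ae f g', h,
          Lp.coeFn_add (tenFun f g) (tenFun f g')] with z h1 h2 h3 h4 h5
        rw [h1, h5, h4, Pi.add_apply, Pi.add_apply, h2, h3, mul_add])
      (fun c f g => by
        refine Lp.ext ?_
        have h := ae_eq_mul_prod (ae_eq_refl (f : α → ℝ)) (Lp.coeFn_smul c g)
        filter_upwards [tenFun_ae f (c • g), tenFun_ae f g, h,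
          Lp.coeFn_smul c (tenFun f g)] with z h1 h2 h4 h5
        rw [h1, h5, h4, Pi.smul_apply, Pi.smul_apply, h2, smul_eq_mul, smul_eq_mul,
          mul_left_comm])) 1
    (fun f g => by simp [norm_tenFun])

theorem ten_ae (f : L2 α) (g : L2 β) :
    ten f g =ᵐ[volume] fun z : α × β => f z.1 * g z.2 := tenFun_ae f g

theorem ten_ae_of_ae {f : L2 α} {g : L2 β} {F : α → ℝ} {G : β → ℝ} (hf : F =ᵐ[volume] f)
    (hg : G =ᵐ[volume] g) : (fun z : α × β => F z.1 * G z.2) =ᵐ[volume] ten f g :=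
  (ae_eq_mul_prod hf hg).trans (ten_ae f g).symm

theorem inner_ten (f f' : L2 α) (g g' : L2 β) :
    inner ℝ (ten f g) (ten f' g') = inner ℝ f f' * inner ℝ g g' := inner_tenFun f f' g g'

theorem norm_ten (f : L2 α) (g : L2 β) : ‖ten f g‖ = ‖f‖ * ‖g‖ := norm_tenFun f g

end Tensor

/-! ### Integral operators with square integrable kernels. -/

section KernelOperator

variable {Z : Type*} [MeasureSpace Z]

theorem ae_eq_of_setIntegral_eq {f g : Z → ℝ} (hf : Integrable f) (hg : Integrable g)
    (h : ∀ s, MeasurableSet s → ∫ x in s, f x = ∫ x in s, g x) : f =ᵐ[volume] g :=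
  hf.ae_eq_of_forall_setIntegral_eq _ _ hg fun s hs _ => h s hs

variable [IsFiniteMeasure (volume : Measure Z)]

/-- The value of the integral operator with kernel `k` at `f`. -/
noncomputable def opKFun (k : L2 (Z × Z)) (f : L2 Z) : L2 Z :=
  ContinuousLinearMap.adjoint ((ten (α := Z) (β := Z)).flip f) k

/-- This weak description serves as the working definition of the operator; Fubini's theorem enters
only when pointwise kernels are compared with it in `opK_ae`. -/
theorem inner_opKFun (k : L2 (Z × Z)) (f g : L2 Z) :
    inner ℝ (opKFun k f) g = inner ℝ k (ten g f) :=
  ContinuousLinearMap.adjoint_inner_left _ _ _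

theorem norm_opKFun_le (k : L2 (Z × Z)) (f : L2 Z) : ‖opKFun k f‖ ≤ ‖k‖ * ‖f‖ := by
  rcases (norm_nonneg (opKFun k f)).eq_or_lt with h | h
  · rw [← h]; positivity
  · have h1 : ‖opKFun k f‖ * ‖opKFun k f‖ ≤ (‖k‖ * ‖f‖) * ‖opKFun k f‖ := by
      rw [← real_inner_self_eq_norm_mul_norm, inner_opKFun]
      refine (real_inner_le_norm _ _).trans ?_
      rw [norm_ten]; apply le_of_eq; ring
    exact le_of_mul_le_mul_right h1 h

/-- The integral operator with a square integrable kernel. -/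
noncomputable def opK (k : L2 (Z × Z)) : L2 Z →L[ℝ] L2 Z :=
  LinearMap.mkContinuous
    { toFun := opKFun k
      map_add' := fun f f' => ext_inner_right ℝ fun g => by
        rw [inner_add_left, inner_opKFun, inner_opKFun, inner_opKFun, map_add, inner_add_right]
      map_smul' := fun c f => ext_inner_right ℝ fun g => by
        rw [inner_smul_left, inner_opKFun, inner_opKFun, map_smul, inner_smul_right]; rfl }
    ‖k‖ (norm_opKFun_le k)

theorem inner_opK (k : L2 (Z × Z)) (f g : L2 Z) :
    inner ℝ (opK k f) g = inner ℝ k (ten g f) := inner_opKFun k f g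

theorem norm_opK_le (k : L2 (Z × Z)) : ‖opK k‖ ≤ ‖k‖ :=
  LinearMap.mkContinuous_norm_le _ (norm_nonneg _) _

theorem opK_sub (k k' : L2 (Z × Z)) : opK (k - k') = opK k - opK k' := by
  refine ContinuousLinearMap.ext fun f => ext_inner_right ℝ fun g => ?_
  rw [_root_.sub_apply, inner_sub_left, inner_opK, inner_opK, inner_opK, inner_sub_left]

theorem opK_add (k k' : L2 (Z × Z)) : opK (k + k') = opK k + opK k' := by
  refine ContinuousLinearMap.ext fun f => ext_inner_right ℝ fun g => ?_
  rw [_root_.add_apply, inner_add_left, inner_opK, inner_opK, inner_opK, inner_add_left]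

theorem opK_smul (c : ℝ) (k : L2 (Z × Z)) : opK (c • k) = c • opK k := by
  refine ContinuousLinearMap.ext fun f => ext_inner_right ℝ fun g => ?_
  rw [_root_.smul_apply, inner_smul_left, inner_opK, inner_opK, inner_smul_left]

theorem opK_ten (a b f : L2 Z) : opK (ten a b) f = inner ℝ b f • a := by
  refine ext_inner_right ℝ fun g => ?_
  rw [inner_opK, inner_ten, inner_smul_left, mul_comm]; rfl

theorem integrable_L2 (f : L2 Z) : Integrable f :=
  (Lp.memLp f).integrable (by norm_num)

theorem inner_indicator_eq (f : L2 Z) {s : Set Z} (hs : MeasurableSet s) :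
    inner ℝ f (indicatorConstLp 2 hs (measure_ne_top volume s) (1 : ℝ)) = ∫ x in s, f x := by
  rw [real_inner_comm]
  exact L2.inner_indicatorConstLp_one hs _ f

/-- Both sides are integrable and have the same integral over every measurable set: test the weak
description against an indicator and apply Fubini. -/
theorem opK_ae {K : Z → Z → ℝ} {k : L2 (Z × Z)}
    (hK : (fun z : Z × Z => K z.1 z.2) =ᵐ[volume] k) (f : L2 Z) :
    opK k f =ᵐ[volume] fun z => ∫ w, K z w * f w := by
  have hone : MemLp (fun _ : Z => (1 : ℝ)) 2 volume := memLp_const 1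
  have hKL : MemLp (fun z : Z × Z => K z.1 z.2) 2 volume := (memLp_congr_ae hK).2 (Lp.memLp k)
  have hfL : MemLp (fun z : Z × Z => 1 * f z.2) 2 volume := memLp_two_mul_prod hone (Lp.memLp f)
  have hint : Integrable (fun z : Z × Z => K z.1 z.2 * f z.2) volume := by
    have := hKL.integrable_mul hfL
    refine this.congr (Eventually.of_forall fun z => ?_)
    simp
  refine ae_eq_of_setIntegral_eq (integrable_L2 _) hint.integral_prod_left fun s hs => ?_
  rw [← inner_indicator_eq _ hs, inner_opK, inner_L2_eq]
  calc ∫ z, k z * (ten (indicatorConstLp 2 hs (measure_ne_top volume s) (1 : ℝ)) f : L2 (Z × Z)) z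
      = ∫ z : Z × Z, (s ×ˢ Set.univ).indicator (fun z : Z × Z => K z.1 z.2 * f z.2) z := by
        refine integral_congr_ae ?_
        have h1 := ten_ae_of_ae (indicatorConstLp_coeFn (p := 2) (hs := hs)
          (hμs := measure_ne_top volume s) (c := (1 : ℝ))).symm (ae_eq_refl (f : Z → ℝ))
        filter_upwards [hK, h1] with z h2 h3
        rw [← h2, ← h3]
        by_cases hz : z.1 ∈ s <;> simp [hz]
    _ = ∫ z in s ×ˢ Set.univ, K z.1 z.2 * f z.2 :=
        integral_indicator (hs.prod MeasurableSet.univ)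
    _ = ∫ x in s, ∫ w, K x w * f w := by
        rw [Measure.volume_eq_prod, setIntegral_prod _ hint.integrableOn]
        simp

/-- The kernels of compact symmetric integral operators. -/
def goodKernels (Z : Type*) [MeasureSpace Z] [IsFiniteMeasure (volume : Measure Z)] :
    Set (L2 (Z × Z)) :=
  {k | IsCompactOperator (opK k) ∧ ∀ f g : L2 Z, inner ℝ k (ten g f) = inner ℝ k (ten f g)}

theorem isSymmetric_of_mem_goodKernels {k : L2 (Z × Z)} (hk : k ∈ goodKernels Z) :
    (opK k : L2 Z →ₗ[ℝ] L2 Z).IsSymmetric := by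
  intro f g
  simp only [ContinuousLinearMap.coe_coe]
  rw [inner_opK, hk.2, real_inner_comm (opK k g) f, inner_opK]

/-- Since `opK` is 1-Lipschitz and compact operators are closed in operator norm, a limit of finite
rank symmetric kernels is again good. The long run kernel obtains its compactness in this way. -/
theorem isClosed_goodKernels : IsClosed (goodKernels Z) := by
  have hcont : Continuous (opK : L2 (Z × Z) → (L2 Z →L[ℝ] L2 Z)) := by
    refine LipschitzWith.continuous (K := 1) (LipschitzWith.of_dist_le_mul fun k k' => ?_)
    rw [dist_eq_norm, dist_eq_norm, ← opK_sub, NNReal.coe_one, one_mul]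
    exact norm_opK_le _
  have heq : goodKernels Z = opK ⁻¹' {T : L2 Z →L[ℝ] L2 Z | IsCompactOperator T} ∩
      ⋂ f : L2 Z, ⋂ g : L2 Z, {k | inner ℝ k (ten g f) = inner ℝ k (ten f g)} := by
    ext k; simp [goodKernels]
  rw [heq]
  refine IsClosed.inter ?_ ?_
  · exact isClosed_setOfPred_isCompactOperator.preimage hcont
  · refine isClosed_iInter fun f => isClosed_iInter fun g => isClosed_eq ?_ ?_ <;>
    exact continuous_id.inner continuous_const

theorem isCompactOperator_opK_ten (a b : L2 Z) : IsCompactOperator (opK (ten a b)) := by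
  have h : opK (ten a b) =
      (ContinuousLinearMap.toSpanSingleton ℝ a).comp (innerSL ℝ b) := by
    refine ContinuousLinearMap.ext fun f => ?_
    rw [opK_ten]; simp
  rw [h]
  exact (isCompactOperator_of_locallyCompactSpace_dom (innerSL ℝ b)).clm_comp
    (ContinuousLinearMap.toSpanSingleton ℝ a)

end KernelOperator

/-- The eigenvalue equation of a function that represents a square integrable kernel. -/
theorem eigenEq_iff {K : I × I → I × I → ℝ} {k : L2 ((I × I) × (I × I))}
    (hK : (fun z : (I × I) × (I × I) => K z.1 z.2) =ᵐ[volume] k) (μ : ℝ) (f : L2 (I × I)) :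
    EigenEq K μ f ↔ opK k f = μ • f := by
  have h1 := opK_ae hK f
  have h2 := Lp.coeFn_smul μ f
  unfold EigenEq
  rw [Lp.ext_iff]
  constructor
  · intro h
    exact h1.trans (h.trans h2.symm)
  · intro h
    exact h1.symm.trans (h.trans h2)

theorem IsOrderedEigensystem.toSeq {K : I × I → I × I → ℝ} {k : L2 ((I × I) × (I × I))}
    (hK : (fun z : (I × I) × (I × I) => K z.1 z.2) =ᵐ[volume] k) {lam : ℕ → ℝ}
    {φ : ℕ → L2 (I × I)} (h : IsOrderedEigensystem K lam φ) :
    IsOrderedEigenseq (opK k) lam φ where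
  orthonormal := h.orthonormal
  eigen i := (eigenEq_iff hK _ _).1 (h.eigen i)
  antitone := h.antitone
  largest i μ f hf hμ := h.largest i μ f hf ((eigenEq_iff hK _ _).2 hμ)

/-! ### Second moments of random elements of a Hilbert space. -/

section SecondMoment

variable {Ω E : Type*} [MeasurableSpace Ω] {P : Measure Ω} [NormedAddCommGroup E]

/-- The real valued `L²(P)` norm of a random element. -/
noncomputable def nrm (P : Measure Ω) (U : Ω → E) : ℝ := (eLpNorm U 2 P).toReal

theorem nrm_nonneg (U : Ω → E) : 0 ≤ nrm P U := ENNReal.toReal_nonneg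

theorem nrm_sq {U : Ω → E} (hU : MemLp U 2 P) : nrm P U ^ 2 = ∫ ω, ‖U ω‖ ^ 2 ∂P := by
  have h := hU.eLpNorm_eq_integral_rpow_norm (by norm_num) (by norm_num)
  simp only [ENNReal.toReal_ofNat, Real.rpow_ofNat] at h
  rw [nrm, h, ENNReal.toReal_ofReal (by positivity), ← Real.rpow_natCast, ← Real.rpow_mul
    (integral_nonneg fun _ => by positivity)]
  norm_num

theorem nrm_eq_sqrt {U : Ω → E} (hU : MemLp U 2 P) : nrm P U = √(∫ ω, ‖U ω‖ ^ 2 ∂P) := by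
  rw [← nrm_sq hU, Real.sqrt_sq (nrm_nonneg U)]

theorem nrm_add_le {U V : Ω → E} (hU : MemLp U 2 P) (hV : MemLp V 2 P) :
    nrm P (fun ω => U ω + V ω) ≤ nrm P U + nrm P V := by
  unfold nrm
  rw [← ENNReal.toReal_add hU.eLpNorm_ne_top hV.eLpNorm_ne_top]
  refine ENNReal.toReal_mono (by finiteness [hU.eLpNorm_ne_top, hV.eLpNorm_ne_top]) ?_
  exact eLpNorm_add_le hU.1 hV.1 (by norm_num)

theorem nrm_sub_le {U V : Ω → E} (hU : MemLp U 2 P) (hV : MemLp V 2 P) :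
    nrm P (fun ω => U ω - V ω) ≤ nrm P U + nrm P V := by
  unfold nrm
  rw [← ENNReal.toReal_add hU.eLpNorm_ne_top hV.eLpNorm_ne_top]
  refine ENNReal.toReal_mono (by finiteness [hU.eLpNorm_ne_top, hV.eLpNorm_ne_top]) ?_
  exact eLpNorm_sub_le hU.1 hV.1 (by norm_num)

theorem nrm_le_add_sub {U V : Ω → E} (hU : MemLp U 2 P) (hV : MemLp V 2 P) :
    nrm P V ≤ nrm P U + nrm P (fun ω => U ω - V ω) := by
  have h := nrm_sub_le hU (hU.sub hV)
  have h2 : (fun ω => U ω - (U - V) ω) = V := by ext ω; simp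
  rw [h2] at h
  exact h

theorem integrable_norm_mul {F : Type*} [NormedAddCommGroup F] {U : Ω → E} {V : Ω → F}
    (hU : MemLp U 2 P) (hV : MemLp V 2 P) : Integrable (fun ω => ‖U ω‖ * ‖V ω‖) P :=
  hU.norm.integrable_mul hV.norm

theorem integral_norm_mul_le {F : Type*} [NormedAddCommGroup F] {U : Ω → E} {V : Ω → F}
    (hU : MemLp U 2 P) (hV : MemLp V 2 P) :
    ∫ ω, ‖U ω‖ * ‖V ω‖ ∂P ≤ nrm P U * nrm P V := by
  have h := integral_mul_le_Lp_mul_Lq_of_nonneg (μ := P) (f := fun ω => ‖U ω‖)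
    (g := fun ω => ‖V ω‖) Real.HolderConjugate.two_two
    (Eventually.of_forall fun _ => norm_nonneg _) (Eventually.of_forall fun _ => norm_nonneg _)
    (by simpa using hU.norm) (by simpa using hV.norm)
  rw [nrm_eq_sqrt hU, nrm_eq_sqrt hV, Real.sqrt_eq_rpow, Real.sqrt_eq_rpow]
  simpa using h

theorem integral_norm_le_nrm [IsProbabilityMeasure P] {U : Ω → E} (hU : MemLp U 2 P) :
    ∫ ω, ‖U ω‖ ∂P ≤ nrm P U := by
  have h := integral_norm_mul_le hU (memLp_const (μ := P) (p := 2) (1 : ℝ))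
  have h1 : nrm P (fun _ : Ω => (1 : ℝ)) = 1 := by
    rw [nrm_eq_sqrt (memLp_const _)]; simp
  rw [h1] at h
  simpa using h

theorem norm_integral_le_nrm [IsProbabilityMeasure P] [NormedSpace ℝ E] {U : Ω → E}
    (hU : MemLp U 2 P) : ‖∫ ω, U ω ∂P‖ ≤ nrm P U :=
  (norm_integral_le_integral_norm _).trans (integral_norm_le_nrm hU)

theorem nrm_const [IsProbabilityMeasure P] (c : E) : nrm P (fun _ : Ω => c) = ‖c‖ := by
  rw [nrm_eq_sqrt (memLp_const _)]; simp

variable [InnerProductSpace ℝ E]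

theorem integrable_inner_memLp {U V : Ω → E} (hU : MemLp U 2 P) (hV : MemLp V 2 P) :
    Integrable (fun ω => (inner ℝ (U ω) (V ω) : ℝ)) P :=
  (integrable_norm_mul hU hV).mono' (hU.1.inner hV.1)
    (Eventually.of_forall fun _ => norm_inner_le_norm _ _)

theorem abs_integral_inner_le {U V : Ω → E} (hU : MemLp U 2 P) (hV : MemLp V 2 P) :
    |∫ ω, (inner ℝ (U ω) (V ω) : ℝ) ∂P| ≤ nrm P U * nrm P V := by
  rw [← Real.norm_eq_abs]
  refine (norm_integral_le_integral_norm _).trans ((integral_mono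
    (integrable_inner_memLp hU hV).norm (integrable_norm_mul hU hV) fun ω => ?_).trans
    (integral_norm_mul_le hU hV))
  exact norm_inner_le_norm _ _

/-- The second moment of a sum of weakly correlated random elements. -/
theorem integral_norm_sum_sq_le {U : ℕ → Ω → E} (hU : ∀ j, MemLp (U j) 2 P) {ρ : ℕ → ℝ}
    (hρ0 : ∀ k, 0 ≤ ρ k) (hρ : Summable ρ)
    (hcov : ∀ j k, ∫ ω, (inner ℝ (U j ω) (U (j + k) ω) : ℝ) ∂P ≤ ρ k) (n : ℕ) :
    ∫ ω, ‖∑ j ∈ Finset.range n, U j ω‖ ^ 2 ∂P ≤ n * (2 * ∑' k, ρ k) := by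
  have h1 : ∀ ω, ‖∑ j ∈ Finset.range n, U j ω‖ ^ 2 =
      ∑ j ∈ Finset.range n, ∑ k ∈ Finset.range n, (inner ℝ (U j ω) (U k ω) : ℝ) := fun ω => by
    rw [← real_inner_self_eq_norm_sq, sum_inner]
    exact Finset.sum_congr rfl fun j _ => inner_sum _ _ _
  simp_rw [h1]
  rw [integral_finsetSum _ fun j _ => integrable_finsetSum _ fun k _ =>
    integrable_inner_memLp (hU j) (hU k)]
  have h2 : ∀ j ∈ Finset.range n,
      ∫ ω, ∑ k ∈ Finset.range n, (inner ℝ (U j ω) (U k ω) : ℝ) ∂P ≤ 2 * ∑' k, ρ k := by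
    intro j hj
    rw [integral_finsetSum _ fun k _ => integrable_inner_memLp (hU j) (hU k)]
    have h3 : ∀ k ∈ Finset.range n, ∫ ω, (inner ℝ (U j ω) (U k ω) : ℝ) ∂P ≤
        ρ (k - j) * (if j ≤ k then 1 else 0) + ρ (j - k) * (if k < j then 1 else 0) := by
      intro k _
      rcases le_or_gt j k with h | h
      · have := hcov j (k - j)
        rw [Nat.add_sub_cancel' h] at this
        simpa [h, not_lt.2 h] using this
      · have := hcov k (j - k)
        rw [Nat.add_sub_cancel' h.le] at this
        simp_rw [real_inner_comm (U _ _) (U k _)] at this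
        simpa [h, not_le.2 h] using this
    -- Row `j` splits into later and earlier indices. On each half the lag is injective in `k`, so
    -- each half is at most the full sum of `ρ`.
    refine (Finset.sum_le_sum h3).trans ?_
    rw [Finset.sum_add_distrib, two_mul]
    simp only [mul_ite, mul_one, mul_zero, ← Finset.sum_filter]
    refine add_le_add ?_ ?_
    · rw [← Finset.sum_image (f := ρ) (g := fun k => k - j)]
      · exact hρ.sum_le_tsum _ fun k _ => hρ0 k
      · intro a ha b hb hab
        simp at ha hb hab; omega
    · rw [← Finset.sum_image (f := ρ) (g := fun k => j - k)]
      · exact hρ.sum_le_tsum _ fun k _ => hρ0 k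
      · intro a ha b hb hab
        simp at ha hb hab; omega
  calc _ ≤ ∑ j ∈ Finset.range n, 2 * ∑' k, ρ k := Finset.sum_le_sum h2
    _ = _ := by simp

end SecondMoment

/-! ### Stationarity and independence of functions of iid innovations. -/

section Innovations

variable {Ω S E : Type*} [MeasurableSpace Ω] [MeasurableSpace S] {P : Measure Ω}
  {ε : ℤ → Ω → S}

/-- Independent and identically distributed innovations. -/
structure IsInnovation (P : Measure Ω) (ε : ℤ → Ω → S) : Prop where
  measurable : ∀ i, Measurable (ε i)
  indep : iIndepFun ε P
  ident : ∀ i, IdentDistrib (ε i) (ε 0) P P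

/-- The information in the innovations with index in `A`. -/
abbrev innovAlg (ε : ℤ → Ω → S) (A : Set ℤ) : MeasurableSpace Ω :=
  ⨆ i ∈ A, MeasurableSpace.comap (ε i) inferInstance

theorem innovAlg_mono {A B : Set ℤ} (h : A ⊆ B) : innovAlg ε A ≤ innovAlg ε B :=
  biSup_mono h

theorem IsInnovation.innovAlg_le (hε : IsInnovation P ε) (A : Set ℤ) :
    innovAlg ε A ≤ (inferInstance : MeasurableSpace Ω) :=
  iSup₂_le fun i _ => (hε.measurable i).comap_le

theorem measurable_innovAlg {A : Set ℤ} {i : ℤ} (hi : i ∈ A) : Measurable[innovAlg ε A] (ε i) :=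
  (comap_measurable (ε i)).mono
    (le_iSup₂ (f := fun i (_ : i ∈ A) => MeasurableSpace.comap (ε i) inferInstance) i hi) le_rfl

theorem IsInnovation.indep_innovAlg (hε : IsInnovation P ε) {A B : Set ℤ} (h : Disjoint A B) :
    Indep (innovAlg ε A) (innovAlg ε B) P :=
  indep_iSup_of_disjoint (fun i => (hε.measurable i).comap_le)
    ((iIndepFun_iff_iIndep _ _ _).1 hε.indep) h

theorem IsInnovation.measurable_past (hε : IsInnovation P ε) (i : ℤ) : Measurable (past ε i) :=
  measurable_pi_iff.2 fun k => hε.measurable (i - k)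

theorem measurable_past_innovAlg (i : ℤ) : Measurable[innovAlg ε (Set.Iic i)] (past ε i) :=
  @measurable_pi_iff _ _ _ (innovAlg ε (Set.Iic i)) _ _ |>.2 fun k =>
    measurable_innovAlg (Set.mem_Iic.2 (by omega))

/-- Every past has the law of an infinite product of copies of the law of `ε 0`. All stationarity
statements rest on this. -/
theorem IsInnovation.map_past (hε : IsInnovation P ε) (i : ℤ) :
    P.map (past ε i) = P.map (past ε 0) := by
  have key : ∀ i : ℤ, P.map (past ε i) = Measure.infinitePi (fun _ : ℕ => P.map (ε 0)) := by
    intro i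
    have hinj : Function.Injective (fun k : ℕ => i - (k : ℤ)) := fun a b h => by
      simp only at h; omega
    have h := (hε.indep.precomp hinj).map_fun_eq_infinitePi_map fun k => hε.measurable _
    simp_rw [fun k : ℕ => (hε.ident (i - (k : ℤ))).map_eq] at h
    exact h
  rw [key i, key 0]

variable [NormedAddCommGroup E]

theorem IsInnovation.eLpNorm_past (hε : IsInnovation P ε) {G : (ℕ → S) → E}
    (hG : StronglyMeasurable G) (q : ENNReal) (i : ℤ) :
    eLpNorm (fun ω => G (past ε i ω)) q P = eLpNorm (fun ω => G (past ε 0 ω)) q P := by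
  rw [← Function.comp_def, ← Function.comp_def,
    ← eLpNorm_map_measure hG.aestronglyMeasurable (hε.measurable_past i).aemeasurable,
    ← eLpNorm_map_measure hG.aestronglyMeasurable (hε.measurable_past 0).aemeasurable,
    hε.map_past i]

theorem IsInnovation.stronglyMeasurable_past (hε : IsInnovation P ε) {G : (ℕ → S) → E}
    (hG : StronglyMeasurable G) (i : ℤ) : StronglyMeasurable (fun ω => G (past ε i ω)) :=
  hG.comp_measurable (hε.measurable_past i)

theorem IsInnovation.memLp_past (hε : IsInnovation P ε) {G : (ℕ → S) → E}
    (hG : StronglyMeasurable G) {q : ENNReal} (h0 : MemLp (fun ω => G (past ε 0 ω)) q P) (i : ℤ) :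
    MemLp (fun ω => G (past ε i ω)) q P :=
  ⟨(hε.stronglyMeasurable_past hG i).aestronglyMeasurable, by
    rw [hε.eLpNorm_past hG q i]; exact h0.2⟩

theorem IsInnovation.nrm_past (hε : IsInnovation P ε) {G : (ℕ → S) → E}
    (hG : StronglyMeasurable G) (i : ℤ) :
    nrm P (fun ω => G (past ε i ω)) = nrm P (fun ω => G (past ε 0 ω)) := by
  rw [nrm, hε.eLpNorm_past hG, nrm]

theorem IsInnovation.integral_past [NormedSpace ℝ E] (hε : IsInnovation P ε) {G : (ℕ → S) → E}
    (hG : StronglyMeasurable G) (i : ℤ) :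
    ∫ ω, G (past ε i ω) ∂P = ∫ ω, G (past ε 0 ω) ∂P := by
  rw [← integral_map (hε.measurable_past i).aemeasurable hG.aestronglyMeasurable,
    ← integral_map (hε.measurable_past 0).aemeasurable hG.aestronglyMeasurable, hε.map_past i]

/-- Random elements that depend on disjoint sets of innovations have multiplicative
expectations. -/
theorem IsInnovation.integral_bilin [IsProbabilityMeasure P] {F K : Type*} [NormedSpace ℝ E]
    [CompleteSpace E] [NormedAddCommGroup F] [NormedSpace ℝ F] [CompleteSpace F]
    [NormedAddCommGroup K] [NormedSpace ℝ K] [CompleteSpace K]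
    (hε : IsInnovation P ε) {A B : Set ℤ} (hAB : Disjoint A B) {U : Ω → E} {V : Ω → F}
    (hU : StronglyMeasurable[innovAlg ε A] U) (hV : StronglyMeasurable[innovAlg ε B] V)
    (hUi : Integrable U P) (hVi : Integrable V P) (L : E →L[ℝ] F →L[ℝ] K) :
    ∫ ω, L (U ω) (V ω) ∂P = L (∫ ω, U ω ∂P) (∫ ω, V ω ∂P) := by
  borelize E F
  have hind : IndepFun U V P := by
    rw [IndepFun_iff_Indep]
    exact indep_of_indep_of_le_right (indep_of_indep_of_le_left (hε.indep_innovAlg hAB)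
      hU.measurable.comap_le) hV.measurable.comap_le
  exact hind.integral_bilin hUi hVi L

theorem IsInnovation.integral_inner_eq_zero [IsProbabilityMeasure P] [InnerProductSpace ℝ E]
    [CompleteSpace E] (hε : IsInnovation P ε) {A B : Set ℤ} (hAB : Disjoint A B) {U V : Ω → E}
    (hU : StronglyMeasurable[innovAlg ε A] U) (hV : StronglyMeasurable[innovAlg ε B] V)
    (hUi : Integrable U P) (hVi : Integrable V P) (h0 : ∫ ω, V ω ∂P = 0) :
    ∫ ω, (inner ℝ (U ω) (V ω) : ℝ) ∂P = 0 := by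
  have h := hε.integral_bilin hAB hU hV hUi hVi (innerSL ℝ)
  rw [h0, map_zero] at h
  exact h

end Innovations

/-! ### Decay of autocorrelations for locally approximable sequences. -/

section LocalApproximation

variable {Ω S E : Type*} [MeasurableSpace Ω] [MeasurableSpace S] {P : Measure Ω}
  [IsProbabilityMeasure P] {ε : ℤ → Ω → S} [NormedAddCommGroup E] [InnerProductSpace ℝ E]

/-- A bounded centered function of the last `m` innovations. -/
structure IsLocalFun (P : Measure Ω) (ε : ℤ → Ω → S) (m : ℕ) (G : (ℕ → S) → E) : Prop where
  sm : StronglyMeasurable G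
  loc : ∀ i : ℤ, StronglyMeasurable[innovAlg ε (Set.Ioc (i - m) i)] (fun ω => G (past ε i ω))
  bdd : ∃ M : ℝ, ∀ s, ‖G s‖ ≤ M
  mean : ∫ ω, G (past ε 0 ω) ∂P = 0

/-- A centered square integrable function of the past that can be approximated by functions of
the last `m` innovations with error `a m`. -/
structure IsApprox (P : Measure Ω) (ε : ℤ → Ω → S) (G : (ℕ → S) → E) (a : ℕ → ℝ) : Prop where
  sm : StronglyMeasurable G
  memLp : MemLp (fun ω => G (past ε 0 ω)) 2 P
  mean : ∫ ω, G (past ε 0 ω) ∂P = 0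
  approx : ∀ m : ℕ, 1 ≤ m → ∃ G' : (ℕ → S) → E, IsLocalFun P ε m G' ∧
    nrm P (fun ω => G (past ε 0 ω) - G' (past ε 0 ω)) ≤ a m

/-- An admissible sequence of approximation rates. -/
structure IsRate (a : ℕ → ℝ) : Prop where
  pos : ∀ n, 0 < a n
  anti : Antitone a
  summable : Summable a
  summable_half : Summable fun n => a (n / 2)

theorem IsLocalFun.memLp {m : ℕ} {G : (ℕ → S) → E} (hG : IsLocalFun P ε m G)
    (hε : IsInnovation P ε) (i : ℤ) (q : ENNReal) : MemLp (fun ω => G (past ε i ω)) q P := by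
  obtain ⟨M, hM⟩ := hG.bdd
  exact MemLp.of_bound (hε.stronglyMeasurable_past hG.sm i).aestronglyMeasurable M
    (Eventually.of_forall fun _ => hM _)

theorem IsApprox.memLp_past {a : ℕ → ℝ} {G : (ℕ → S) → E} (hG : IsApprox P ε G a)
    (hε : IsInnovation P ε) (i : ℤ) : MemLp (fun ω => G (past ε i ω)) 2 P :=
  hε.memLp_past hG.sm hG.memLp i

theorem nrm_past_sub (hε : IsInnovation P ε) {G G' : (ℕ → S) → E} (hG : StronglyMeasurable G)
    (hG' : StronglyMeasurable G') (i : ℤ) :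
    nrm P (fun ω => G (past ε i ω) - G' (past ε i ω)) =
      nrm P (fun ω => G (past ε 0 ω) - G' (past ε 0 ω)) :=
  hε.nrm_past (G := fun s => G s - G' s) (hG.sub hG') i

/-- The correlation of a past element with a later element is controlled by the distance of the
later element to a function of the innovations in between. -/
theorem abs_integral_inner_le_of_local [CompleteSpace E] (hε : IsInnovation P ε) {i : ℤ} {n : ℕ}
    {U V V' : Ω → E} (hU : StronglyMeasurable[innovAlg ε (Set.Iic i)] U) (hU2 : MemLp U 2 P)
    (hV2 : MemLp V 2 P) (hV' : StronglyMeasurable[innovAlg ε (Set.Ioc i (i + n))] V')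
    (hV'2 : MemLp V' 2 P) (h0 : ∫ ω, V' ω ∂P = 0) :
    |∫ ω, (inner ℝ (U ω) (V ω) : ℝ) ∂P| ≤ nrm P U * nrm P (fun ω => V ω - V' ω) := by
  have hdisj : Disjoint (Set.Iic i) (Set.Ioc i (i + n)) := by
    rw [Set.disjoint_left]; intro x hx hx'
    exact absurd hx'.1 (not_lt.2 hx)
  have h := hε.integral_inner_eq_zero hdisj hU hV' (hU2.integrable (by norm_num))
    (hV'2.integrable (by norm_num)) h0
  have h2 : ∫ ω, (inner ℝ (U ω) (V ω) : ℝ) ∂P = ∫ ω, (inner ℝ (U ω) (V ω - V' ω) : ℝ) ∂P := by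
    simp_rw [inner_sub_right]
    rw [integral_sub (integrable_inner_memLp hU2 hV2) (integrable_inner_memLp hU2 hV'2), h,
      sub_zero]
  rw [h2]
  exact abs_integral_inner_le hU2 (hV2.sub hV'2)

theorem stronglyMeasurable_past_innovAlg {G : (ℕ → S) → E} (hG : StronglyMeasurable G) (i : ℤ) :
    StronglyMeasurable[innovAlg ε (Set.Iic i)] (fun ω => G (past ε i ω)) :=
  hG.comp_measurable (measurable_past_innovAlg i)

/-- A summable bound for the autocorrelations. -/
noncomputable def corrBound (sd : ℝ) (a : ℕ → ℝ) (n : ℕ) : ℝ :=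
  2 * sd * a n + if n = 0 then sd ^ 2 else 0

theorem corrBound_nonneg {sd : ℝ} {a : ℕ → ℝ} (hsd : 0 ≤ sd) (ha : IsRate a) (n : ℕ) :
    0 ≤ corrBound sd a n := by
  have := (ha.pos n).le
  unfold corrBound; positivity

theorem summable_corrBound {sd : ℝ} {a : ℕ → ℝ} (ha : IsRate a) : Summable (corrBound sd a) :=
  (ha.summable.mul_left (2 * sd)).add
    (summable_of_ne_finset_zero (s := {0}) fun n hn => if_neg (by simpa using hn))

/-- At lag `n ≥ 1` the later element is replaced by its approximation from the last `n` innovations,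
which is centered and independent of the earlier element, so only the error `a n` remains. Lag 0 is
the variance. -/
theorem IsApprox.abs_corr_le [CompleteSpace E] {a : ℕ → ℝ} {G : (ℕ → S) → E}
    (hG : IsApprox P ε G a) (hε : IsInnovation P ε) (ha : IsRate a) (i : ℤ) (n : ℕ) :
    |∫ ω, (inner ℝ (G (past ε i ω)) (G (past ε (i + n) ω)) : ℝ) ∂P| ≤
      corrBound (nrm P (fun ω => G (past ε 0 ω))) a n := by
  have hsd : 0 ≤ nrm P (fun ω => G (past ε 0 ω)) := nrm_nonneg _
  rcases Nat.eq_zero_or_pos n with rfl | hn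
  · refine (abs_integral_inner_le (hG.memLp_past hε i) (hG.memLp_past hε _)).trans ?_
    rw [hε.nrm_past hG.sm i, hε.nrm_past hG.sm (i + (0 : ℕ))]
    have := (ha.pos 0).le
    simp only [corrBound, if_true]
    nlinarith [mul_nonneg hsd this]
  · obtain ⟨G', hG', hle⟩ := hG.approx n hn
    have hloc := hG'.loc (i + n)
    rw [add_sub_cancel_right] at hloc
    refine (abs_integral_inner_le_of_local hε (stronglyMeasurable_past_innovAlg hG.sm i)
      (hG.memLp_past hε i) (hG.memLp_past hε _) hloc (hG'.memLp hε _ 2)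
      (by rw [hε.integral_past hG'.sm, hG'.mean])).trans ?_
    rw [hε.nrm_past hG.sm, nrm_past_sub hε hG.sm hG'.sm]
    have := (ha.pos n).le
    simp only [corrBound, hn.ne', if_false, add_zero]
    nlinarith [mul_le_mul_of_nonneg_left hle hsd, mul_nonneg hsd this]

/-- The second moment of the partial sums grows linearly. -/
theorem IsApprox.integral_norm_sum_sq_le [CompleteSpace E] {a : ℕ → ℝ} {G : (ℕ → S) → E}
    (hG : IsApprox P ε G a) (hε : IsInnovation P ε) (ha : IsRate a) (n : ℕ) :
    ∫ ω, ‖∑ j ∈ Finset.range n, G (past ε ((j : ℤ) + 1) ω)‖ ^ 2 ∂P ≤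
      n * (2 * ∑' k, corrBound (nrm P (fun ω => G (past ε 0 ω))) a k) := by
  refine CrossCov.integral_norm_sum_sq_le (fun j => hG.memLp_past hε _)
    (corrBound_nonneg (nrm_nonneg _) ha) (summable_corrBound ha) (fun j k => ?_) n
  have h := hG.abs_corr_le hε ha ((j : ℤ) + 1) k
  have hjk : ((j + k : ℕ) : ℤ) + 1 = (j : ℤ) + 1 + k := by push_cast; ring
  rw [hjk]
  exact (le_abs_self _).trans h

/-- The autocorrelations of the approximations are summable, uniformly in the approximation. -/
theorem IsApprox.abs_corr_local_le [CompleteSpace E] {a : ℕ → ℝ} {G : (ℕ → S) → E}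
    (hG : IsApprox P ε G a) (hε : IsInnovation P ε) (ha : IsRate a) {m : ℕ} {G' : (ℕ → S) → E}
    (hG' : IsLocalFun P ε m G')
    (hle : nrm P (fun ω => G (past ε 0 ω) - G' (past ε 0 ω)) ≤ a m) (i : ℤ) {n : ℕ} (hnm : n < m) :
    |∫ ω, (inner ℝ (G' (past ε i ω)) (G' (past ε (i + n) ω)) : ℝ) ∂P| ≤
      corrBound (nrm P (fun ω => G (past ε 0 ω)) + a 0) a n := by
  have hsd : 0 ≤ nrm P (fun ω => G (past ε 0 ω)) := nrm_nonneg _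
  have ha0 := (ha.pos 0).le
  have hnrm : nrm P (fun ω => G' (past ε 0 ω)) ≤ nrm P (fun ω => G (past ε 0 ω)) + a 0 :=
    (nrm_le_add_sub hG.memLp (hG'.memLp hε 0 2)).trans
      (by linarith [ha.anti (Nat.zero_le m)])
  rcases Nat.eq_zero_or_pos n with rfl | hn
  · refine (abs_integral_inner_le (hG'.memLp hε i 2) (hG'.memLp hε _ 2)).trans ?_
    rw [hε.nrm_past hG'.sm i, hε.nrm_past hG'.sm (i + (0 : ℕ))]
    simp only [corrBound, if_true]
    have := mul_self_le_mul_self (nrm_nonneg _) hnrm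
    nlinarith [mul_nonneg (add_nonneg hsd ha0) ha0]
  · obtain ⟨G'', hG'', hle'⟩ := hG.approx n hn
    have hloc := hG''.loc (i + n)
    rw [add_sub_cancel_right] at hloc
    refine (abs_integral_inner_le_of_local hε (stronglyMeasurable_past_innovAlg hG'.sm i)
      (hG'.memLp hε i 2) (hG'.memLp hε _ 2) hloc (hG''.memLp hε _ 2)
      (by rw [hε.integral_past hG''.sm, hG''.mean])).trans ?_
    rw [hε.nrm_past hG'.sm, nrm_past_sub hε hG'.sm hG''.sm]
    -- Both `G'` and `G''` approximate `G`, within `a m` and `a n`, and `a m ≤ a n` because `n < m`.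
    -- The factor 2 in `corrBound` comes from here.
    have h1 : nrm P (fun ω => G' (past ε 0 ω) - G'' (past ε 0 ω)) ≤ 2 * a n := by
      have h2 := nrm_sub_le (hG.memLp.sub (hG''.memLp hε 0 2)) (hG.memLp.sub (hG'.memLp hε 0 2))
      have h3 : (fun ω => ((fun ω => G (past ε 0 ω)) - fun ω => G'' (past ε 0 ω)) ω -
          ((fun ω => G (past ε 0 ω)) - fun ω => G' (past ε 0 ω)) ω) =
          fun ω => G' (past ε 0 ω) - G'' (past ε 0 ω) := by
        ext ω; simp
      rw [h3] at h2
      have h4 := ha.anti hnm.le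
      refine h2.trans ?_
      have h5 : nrm P ((fun ω => G (past ε 0 ω)) - fun ω => G'' (past ε 0 ω)) ≤ a n := hle'
      have h6 : nrm P ((fun ω => G (past ε 0 ω)) - fun ω => G' (past ε 0 ω)) ≤ a m := hle
      linarith
    have := (ha.pos n).le
    simp only [corrBound, hn.ne', if_false, add_zero]
    calc _ ≤ (nrm P (fun ω => G (past ε 0 ω)) + a 0) * (2 * a n) :=
          mul_le_mul hnrm h1 (nrm_nonneg _) (by positivity)
      _ = _ := by ring

end LocalApproximation

/-! ### Second moments of sums of lag products. -/

section LagProducts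

variable {Ω S E F : Type*} [MeasurableSpace Ω] [MeasurableSpace S] {P : Measure Ω}
  [IsProbabilityMeasure P] {ε : ℤ → Ω → S} [NormedAddCommGroup E] [InnerProductSpace ℝ E]
  [NormedAddCommGroup F] [InnerProductSpace ℝ F]

/-- A bilinear map that multiplies inner products, like the tensor product. -/
def IsTensor (B : E →L[ℝ] E →L[ℝ] F) : Prop :=
  ∀ f g f' g', (inner ℝ (B f g) (B f' g') : ℝ) = inner ℝ f f' * inner ℝ g g'

theorem IsTensor.norm_eq {B : E →L[ℝ] E →L[ℝ] F} (hB : IsTensor B) (f g : E) :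
    ‖B f g‖ = ‖f‖ * ‖g‖ := by
  have h := hB f g f g
  rw [real_inner_self_eq_norm_sq, real_inner_self_eq_norm_sq, real_inner_self_eq_norm_sq,
    ← mul_pow] at h
  exact (sq_eq_sq₀ (norm_nonneg _) (by positivity)).1 h

theorem stronglyMeasurable_bilin {m : MeasurableSpace Ω} {E F K : Type*} [NormedAddCommGroup E]
    [NormedSpace ℝ E] [NormedAddCommGroup F] [NormedSpace ℝ F] [NormedAddCommGroup K]
    [NormedSpace ℝ K] (B : E →L[ℝ] F →L[ℝ] K) {U : Ω → E} {V : Ω → F}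
    (hU : StronglyMeasurable U) (hV : StronglyMeasurable V) :
    StronglyMeasurable (fun ω => B (U ω) (V ω)) :=
  B.continuous₂.comp_stronglyMeasurable (hU.prodMk hV)

theorem IsTensor.integrable {B : E →L[ℝ] E →L[ℝ] F} (hB : IsTensor B) {U V : Ω → E}
    (hU : MemLp U 2 P) (hV : MemLp V 2 P) : Integrable (fun ω => B (U ω) (V ω)) P :=
  (integrable_norm_mul hU hV).mono'
    (B.continuous₂.comp_aestronglyMeasurable (hU.1.prodMk hV.1))
    (Eventually.of_forall fun _ => (hB.norm_eq _ _).le)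

theorem IsTensor.integral_norm_le {B : E →L[ℝ] E →L[ℝ] F} (hB : IsTensor B) {U V : Ω → E}
    (hU : MemLp U 2 P) (hV : MemLp V 2 P) :
    ∫ ω, ‖B (U ω) (V ω)‖ ∂P ≤ nrm P U * nrm P V := by
  simp_rw [hB.norm_eq]
  exact integral_norm_mul_le hU hV

theorem integral_norm_sum_le {ι : Type*} (s : Finset ι) {U : ι → Ω → F}
    (hU : ∀ i ∈ s, Integrable (U i) P) :
    ∫ ω, ‖∑ i ∈ s, U i ω‖ ∂P ≤ ∑ i ∈ s, ∫ ω, ‖U i ω‖ ∂P := by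
  rw [← integral_finsetSum _ fun i hi => (hU i hi).norm]
  exact integral_mono_of_nonneg (Eventually.of_forall fun _ => norm_nonneg _)
    (integrable_finsetSum _ fun i hi => (hU i hi).norm)
    (Eventually.of_forall fun ω => norm_sum_le _ _)

/-- Replacing the factors of a lag product by approximations. -/
theorem IsApprox.integral_norm_bilin_sub_le {a : ℕ → ℝ} {G : (ℕ → S) → E} (hG : IsApprox P ε G a)
    (hε : IsInnovation P ε) (ha : IsRate a) {m : ℕ} {G' : (ℕ → S) → E}
    (hG' : IsLocalFun P ε m G')
    (hle : nrm P (fun ω => G (past ε 0 ω) - G' (past ε 0 ω)) ≤ a m)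
    {B : E →L[ℝ] E →L[ℝ] F} (hB : IsTensor B) (i k : ℤ) :
    ∫ ω, ‖B (G (past ε i ω)) (G (past ε k ω)) - B (G' (past ε i ω)) (G' (past ε k ω))‖ ∂P ≤
      2 * (nrm P (fun ω => G (past ε 0 ω)) + a 0) * a m := by
  set sd := nrm P (fun ω => G (past ε 0 ω)) with hsd
  have hsd0 : 0 ≤ sd := nrm_nonneg _
  have ha0 := (ha.pos 0).le
  have ham := (ha.pos m).le
  have hnrm : nrm P (fun ω => G' (past ε 0 ω)) ≤ sd + a 0 :=
    (nrm_le_add_sub hG.memLp (hG'.memLp hε 0 2)).trans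
      (by linarith [ha.anti (Nat.zero_le m)])
  have hGi := hG.memLp_past hε i
  have hGk := hG.memLp_past hε k
  have hGi' := hG'.memLp hε i 2
  have hGk' := hG'.memLp hε k 2
  have h1 := hB.integral_norm_le (hGi.sub hGi') hGk
  have h2 := hB.integral_norm_le hGi' (hGk.sub hGk')
  have h1i := (hB.integrable (hGi.sub hGi') hGk).norm
  have h2i := (hB.integrable hGi' (hGk.sub hGk')).norm
  have hn1 : nrm P ((fun ω => G (past ε i ω)) - fun ω => G' (past ε i ω)) ≤ a m :=
    (nrm_past_sub hε hG.sm hG'.sm i).le.trans hle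
  have hn2 : nrm P ((fun ω => G (past ε k ω)) - fun ω => G' (past ε k ω)) ≤ a m :=
    (nrm_past_sub hε hG.sm hG'.sm k).le.trans hle
  rw [hε.nrm_past hG.sm] at h1
  rw [hε.nrm_past hG'.sm] at h2
  calc _ ≤ ∫ ω, (‖B (((fun ω => G (past ε i ω)) - fun ω => G' (past ε i ω)) ω) (G (past ε k ω))‖ +
        ‖B (G' (past ε i ω)) (((fun ω => G (past ε k ω)) - fun ω => G' (past ε k ω)) ω)‖) ∂P := by
        refine integral_mono_of_nonneg (Eventually.of_forall fun _ => norm_nonneg _)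
          (h1i.add h2i) (Eventually.of_forall fun ω => ?_)
        refine le_trans (le_of_eq (congrArg norm ?_)) (norm_add_le _ _)
        simp only [Pi.sub_apply, map_sub, _root_.sub_apply]
        abel
    _ = _ := integral_add h1i h2i
    _ ≤ a m * sd + (sd + a 0) * a m := by
        refine add_le_add (h1.trans ?_) (h2.trans ?_)
        · exact mul_le_mul_of_nonneg_right hn1 hsd0
        · exact mul_le_mul hnrm hn2 (nrm_nonneg _) (by positivity)
    _ ≤ _ := by nlinarith [mul_nonneg ha0 ham]

/-- Lag products of functions of few innovations have small averages. -/
theorem IsApprox.integral_norm_sum_local_sq_le [CompleteSpace E] {a : ℕ → ℝ} {G : (ℕ → S) → E}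
    (hG : IsApprox P ε G a) (hε : IsInnovation P ε) (ha : IsRate a) {m : ℕ} {G' : (ℕ → S) → E}
    (hG' : IsLocalFun P ε m G')
    (hle : nrm P (fun ω => G (past ε 0 ω) - G' (past ε 0 ω)) ≤ a m)
    {B : E →L[ℝ] E →L[ℝ] F} (hB : IsTensor B) {ℓ : ℕ} (hℓ : 2 * m ≤ ℓ) (n : ℕ) :
    ∫ ω, ‖∑ j ∈ Finset.range n, B (G' (past ε ((j : ℤ) + 1) ω))
        (G' (past ε ((j : ℤ) + 1 + ℓ) ω))‖ ^ 2 ∂P ≤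
      n * (2 * ∑' k, corrBound (nrm P (fun ω => G (past ε 0 ω)) + a 0) a k ^ 2) := by
  obtain ⟨M, hM⟩ := hG'.bdd
  have hM0 : 0 ≤ M := (norm_nonneg _).trans (hM (past ε 0 (Classical.choice
    (nonempty_of_isProbabilityMeasure P))))
  have hsd : 0 ≤ nrm P (fun ω => G (past ε 0 ω)) + a 0 := add_nonneg (nrm_nonneg _) (ha.pos 0).le
  have hc0 := corrBound_nonneg hsd ha
  have hsum : Summable fun k => corrBound (nrm P (fun ω => G (past ε 0 ω)) + a 0) a k ^ 2 := by
    have hs := summable_corrBound (sd := nrm P (fun ω => G (past ε 0 ω)) + a 0) ha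
    refine Summable.of_nonneg_of_le (fun k => sq_nonneg _) (fun k => ?_)
      (hs.mul_left (∑' k, corrBound (nrm P (fun ω => G (past ε 0 ω)) + a 0) a k))
    rw [sq]
    exact mul_le_mul_of_nonneg_right (hs.le_tsum k fun j _ => hc0 j) (hc0 k)
  have hsm : ∀ i k : ℤ, StronglyMeasurable
      (fun ω => B (G' (past ε i ω)) (G' (past ε k ω))) := fun i k =>
    stronglyMeasurable_bilin B (hε.stronglyMeasurable_past hG'.sm i)
      (hε.stronglyMeasurable_past hG'.sm k)
  refine CrossCov.integral_norm_sum_sq_le (fun j => MemLp.of_bound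
    (hsm _ _).aestronglyMeasurable (M * M) (Eventually.of_forall fun ω => ?_))
    (fun k => sq_nonneg _) hsum (fun j k => ?_) n
  · rw [hB.norm_eq]
    exact mul_le_mul (hM _) (hM _) (norm_nonneg _) hM0
  set i : ℤ := (j : ℤ) + 1 with hi
  have hjk : ((j + k : ℕ) : ℤ) + 1 = i + k := by rw [hi]; push_cast; ring
  rw [hjk]
  simp_rw [hB _ _ _ _]
  have hik : i + (k : ℤ) + ℓ = (i + ℓ) + k := by ring
  have hx : ∀ (A : Set ℤ) (u v : ℤ), Set.Ioc (u - m) u ⊆ A → Set.Ioc (v - m) v ⊆ A →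
      StronglyMeasurable[innovAlg ε A]
        (fun ω => (inner ℝ (G' (past ε u ω)) (G' (past ε v ω)) : ℝ)) := fun A u v hu hv =>
    ((hG'.loc u).mono (innovAlg_mono hu)).inner ((hG'.loc v).mono (innovAlg_mono hv))
  -- The covariance of two lag products is the mean of a product of two inner products, at times
  -- `(i, i+k)` and `(i+ℓ, i+ℓ+k)`. If `k < m`, then `2m ≤ ℓ` makes them independent, and the mean
  -- is a product of two correlations at lag `k`. If `k ≥ m`, the element at `i+ℓ+k` is centered and
  -- independent of the other three, so the mean is 0.
  rcases lt_or_ge k m with hkm | hkm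
  · have hdisj : Disjoint (Set.Ioc (i - m) (i + k)) (Set.Ioc (i + ℓ - m) (i + ℓ + k)) := by
      rw [Set.disjoint_left]; rintro x ⟨_, hx1⟩ ⟨hx2, _⟩; omega
    have h := hε.integral_bilin (P := P) hdisj
      (hx (Set.Ioc (i - m) (i + k)) i (i + k)
        (fun x hx => ⟨hx.1, by have := hx.2; omega⟩) (fun x hx => ⟨by have := hx.1; omega, hx.2⟩))
      (hx (Set.Ioc (i + ℓ - m) (i + ℓ + k)) (i + ℓ) (i + ℓ + k)
        (fun x hx => ⟨hx.1, by have := hx.2; omega⟩) (fun x hx => ⟨by have := hx.1; omega, hx.2⟩))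
      (integrable_inner_memLp (hG'.memLp hε _ 2) (hG'.memLp hε _ 2))
      (integrable_inner_memLp (hG'.memLp hε _ 2) (hG'.memLp hε _ 2)) (ContinuousLinearMap.mul ℝ ℝ)
    simp only [ContinuousLinearMap.mul_apply'] at h
    rw [hik, h, sq]
    have h1 := hG.abs_corr_local_le hε ha hG' hle i hkm
    have h2 := hG.abs_corr_local_le hε ha hG' hle (i + ℓ) hkm
    refine (le_abs_self _).trans ?_
    rw [abs_mul]
    exact mul_le_mul h1 h2 (abs_nonneg _) (hc0 k)
  · have hdisj : Disjoint (Set.Iic (i + ℓ + k - m)) (Set.Ioc (i + ℓ + k - m) (i + ℓ + k)) := by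
      rw [Set.disjoint_left]; intro x hx hx'
      exact absurd hx'.1 (not_lt.2 hx)
    have hU : StronglyMeasurable[innovAlg ε (Set.Iic (i + ℓ + k - m))] (fun ω =>
        (inner ℝ (G' (past ε i ω)) (G' (past ε (i + k) ω)) : ℝ) • G' (past ε (i + ℓ) ω)) :=
      (hx _ i (i + k) (fun x hx => by have := hx.2; simp only [Set.mem_Iic]; omega)
        (fun x hx => by have := hx.2; simp only [Set.mem_Iic]; omega)).smul
      ((hG'.loc (i + ℓ)).mono (innovAlg_mono
        (fun x hx => by have := hx.2; simp only [Set.mem_Iic]; omega)))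
    have hUi : Integrable (fun ω => (inner ℝ (G' (past ε i ω)) (G' (past ε (i + k) ω)) : ℝ) •
        G' (past ε (i + ℓ) ω)) P := by
      refine Integrable.of_bound (hU.mono (hε.innovAlg_le _)).aestronglyMeasurable (M * M * M)
        (Eventually.of_forall fun ω => ?_)
      rw [norm_smul]
      refine mul_le_mul ((norm_inner_le_norm _ _).trans ?_) (hM _) (norm_nonneg _) (by positivity)
      exact mul_le_mul (hM _) (hM _) (norm_nonneg _) hM0
    have h := hε.integral_inner_eq_zero hdisj hU (hG'.loc (i + ℓ + k)) hUi
      ((hG'.memLp hε _ 2).integrable (by norm_num)) (by rw [hε.integral_past hG'.sm, hG'.mean])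
    simp_rw [inner_smul_left, RCLike.conj_to_real] at h
    rw [hik, h]
    exact sq_nonneg _

end LagProducts

/-! ### Moment bounds and the law of large numbers at a fixed lag. -/

section LagAverages

variable {Ω S E F : Type*} [MeasurableSpace Ω] [MeasurableSpace S] {P : Measure Ω}
  [IsProbabilityMeasure P] {ε : ℤ → Ω → S} [NormedAddCommGroup E] [InnerProductSpace ℝ E]
  [NormedAddCommGroup F] [InnerProductSpace ℝ F]

/-- The sum of the first `n` lag `ℓ` products. -/
noncomputable def lagSum (ε : ℤ → Ω → S) (G : (ℕ → S) → E) (B : E →L[ℝ] E →L[ℝ] F) (ℓ n : ℕ)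
    (ω : Ω) : F :=
  ∑ j ∈ Finset.range n, B (G (past ε ((j : ℤ) + 1) ω)) (G (past ε ((j : ℤ) + 1 + ℓ) ω))

/-- The lag `ℓ` autocovariance. -/
noncomputable def lagMean (P : Measure Ω) (ε : ℤ → Ω → S) (G : (ℕ → S) → E)
    (B : E →L[ℝ] E →L[ℝ] F) (ℓ : ℕ) : F :=
  ∫ ω, B (G (past ε 0 ω)) (G (past ε ℓ ω)) ∂P

theorem past_shift (i : ℤ) (ℓ : ℕ) (ω : Ω) :
    (fun k => past ε (i + ℓ) ω (k + ℓ)) = past ε i ω := by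
  funext k
  simp only [past]
  congr 1
  push_cast; ring

/-- The pair of elements at `i` and `i + ℓ` is a function of the single past at `i + ℓ`, whose tail
after `ℓ` coordinates is the past at `i`; stationarity of that one past suffices. -/
theorem lagMean_eq (hε : IsInnovation P ε) {G : (ℕ → S) → E} (hG : StronglyMeasurable G)
    (B : E →L[ℝ] E →L[ℝ] F) (ℓ : ℕ) (i : ℤ) :
    ∫ ω, B (G (past ε i ω)) (G (past ε (i + ℓ) ω)) ∂P = lagMean P ε G B ℓ := by
  have hsh : Measurable (fun (s : ℕ → S) k => s (k + ℓ)) :=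
    measurable_pi_iff.2 fun k => measurable_pi_apply _
  have hQ : StronglyMeasurable (fun s : ℕ → S => B (G (fun k => s (k + ℓ))) (G s)) :=
    stronglyMeasurable_bilin B (hG.comp_measurable hsh) hG
  have h1 := hε.integral_past hQ (i + ℓ)
  have h2 := hε.integral_past hQ (0 + ℓ)
  simp_rw [past_shift] at h1 h2
  rw [h1, ← h2, lagMean]
  simp

theorem IsApprox.integrable_lagSum {a : ℕ → ℝ} {G : (ℕ → S) → E} (hG : IsApprox P ε G a)
    (hε : IsInnovation P ε) {B : E →L[ℝ] E →L[ℝ] F} (hB : IsTensor B) (ℓ n : ℕ) :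
    Integrable (lagSum ε G B ℓ n) P :=
  integrable_finsetSum _ fun _ _ => hB.integrable (hG.memLp_past hε _) (hG.memLp_past hε _)

theorem IsApprox.integral_norm_lagSum_sub_le {a : ℕ → ℝ} {G : (ℕ → S) → E}
    (hG : IsApprox P ε G a) (hε : IsInnovation P ε) (ha : IsRate a) {m : ℕ} {G' : (ℕ → S) → E}
    (hG' : IsLocalFun P ε m G')
    (hle : nrm P (fun ω => G (past ε 0 ω) - G' (past ε 0 ω)) ≤ a m)
    {B : E →L[ℝ] E →L[ℝ] F} (hB : IsTensor B) (ℓ n : ℕ) :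
    ∫ ω, ‖lagSum ε G B ℓ n ω - lagSum ε G' B ℓ n ω‖ ∂P ≤
      n * (2 * (nrm P (fun ω => G (past ε 0 ω)) + a 0) * a m) := by
  simp_rw [lagSum, ← Finset.sum_sub_distrib]
  refine (integral_norm_sum_le _ fun j _ => (hB.integrable (hG.memLp_past hε _)
    (hG.memLp_past hε _)).sub (hB.integrable (hG'.memLp hε _ 2) (hG'.memLp hε _ 2))).trans ?_
  refine (Finset.sum_le_sum fun j _ => hG.integral_norm_bilin_sub_le hε ha hG' hle hB _ _).trans ?_
  simp

/-- A summable bound for the lag averages. -/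
noncomputable def lagBound (sd : ℝ) (a : ℕ → ℝ) (ℓ : ℕ) : ℝ :=
  2 * (sd + a 0) * a (ℓ / 2) + if ℓ < 2 then sd ^ 2 else 0

theorem lagBound_nonneg {sd : ℝ} {a : ℕ → ℝ} (hsd : 0 ≤ sd) (ha : IsRate a) (n : ℕ) :
    0 ≤ lagBound sd a n := by
  have := (ha.pos (n / 2)).le
  have := (ha.pos 0).le
  unfold lagBound; positivity

theorem summable_lagBound {sd : ℝ} {a : ℕ → ℝ} (ha : IsRate a) : Summable (lagBound sd a) :=
  (ha.summable_half.mul_left _).add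
    (summable_of_ne_finset_zero (s := Finset.range 2) fun n hn => if_neg (by simpa using hn))

/-- The constant in the bound of the lag averages. -/
noncomputable def lagConst (sd : ℝ) (a : ℕ → ℝ) : ℝ :=
  √(2 * ∑' k, corrBound (sd + a 0) a k ^ 2)

/-- Localize with `m = ℓ / 2`. The replacement error is linear in `n` but summable in `ℓ`; the local
products are centered and contribute `√n` with a constant free of `ℓ`. The lags 0 and 1, where `ℓ /
2 = 0`, are bounded trivially. -/
theorem IsApprox.integral_norm_lagSum_le [CompleteSpace E] {a : ℕ → ℝ} {G : (ℕ → S) → E}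
    (hG : IsApprox P ε G a) (hε : IsInnovation P ε) (ha : IsRate a)
    {B : E →L[ℝ] E →L[ℝ] F} (hB : IsTensor B) (ℓ n : ℕ) :
    ∫ ω, ‖lagSum ε G B ℓ n ω‖ ∂P ≤ n * lagBound (nrm P (fun ω => G (past ε 0 ω))) a ℓ +
      √n * lagConst (nrm P (fun ω => G (past ε 0 ω))) a := by
  set sd := nrm P (fun ω => G (past ε 0 ω)) with hsd
  have hsd0 : 0 ≤ sd := nrm_nonneg _
  have ha0 := (ha.pos 0).le
  rcases lt_or_ge ℓ 2 with hℓ | hℓ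
  · have h1 : ∫ ω, ‖lagSum ε G B ℓ n ω‖ ∂P ≤ n * sd ^ 2 := by
      refine (integral_norm_sum_le _ fun j _ =>
        hB.integrable (hG.memLp_past hε _) (hG.memLp_past hε _)).trans ?_
      refine (Finset.sum_le_sum fun j _ => hB.integral_norm_le (hG.memLp_past hε _)
        (hG.memLp_past hε _)).trans ?_
      refine le_of_eq ?_
      rw [Finset.sum_congr rfl fun j _ => by
        rw [hε.nrm_past hG.sm ((j : ℤ) + 1), hε.nrm_past hG.sm ((j : ℤ) + 1 + ℓ), ← hsd]]
      simp [sq]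
    have h2 : sd ^ 2 ≤ lagBound sd a ℓ := by
      have := (ha.pos (ℓ / 2)).le
      simp only [lagBound, hℓ, if_true]
      have : 0 ≤ 2 * (sd + a 0) * a (ℓ / 2) := by positivity
      linarith
    have h3 : 0 ≤ √(n : ℝ) * lagConst sd a := mul_nonneg (Real.sqrt_nonneg _) (Real.sqrt_nonneg _)
    have h4 := mul_le_mul_of_nonneg_left h2 (Nat.cast_nonneg (α := ℝ) n)
    linarith
  · obtain ⟨G', hG', hle⟩ := hG.approx (ℓ / 2) (by omega)
    have h1 := hG.integral_norm_lagSum_sub_le hε ha hG' hle hB ℓ n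
    have h2 := hG.integral_norm_sum_local_sq_le hε ha hG' hle hB (ℓ := ℓ) (by omega) n
    have hmem : MemLp (lagSum ε G' B ℓ n) 2 P := by
      obtain ⟨M, hM⟩ := hG'.bdd
      have hM0 : 0 ≤ M := (norm_nonneg _).trans (hM (past ε 0 (Classical.choice
        (nonempty_of_isProbabilityMeasure P))))
      refine memLp_finsetSum _ fun j _ => MemLp.of_bound (stronglyMeasurable_bilin B
        (hε.stronglyMeasurable_past hG'.sm _)
        (hε.stronglyMeasurable_past hG'.sm _)).aestronglyMeasurable (M * M)
        (Eventually.of_forall fun ω => ?_)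
      rw [hB.norm_eq]
      exact mul_le_mul (hM _) (hM _) (norm_nonneg _) hM0
    have h3 : ∫ ω, ‖lagSum ε G' B ℓ n ω‖ ∂P ≤ √n * lagConst sd a := by
      refine (integral_norm_le_nrm hmem).trans ?_
      rw [nrm_eq_sqrt hmem, lagConst, ← Real.sqrt_mul (Nat.cast_nonneg _)]
      exact Real.sqrt_le_sqrt h2
    have h4 : ∫ ω, ‖lagSum ε G B ℓ n ω‖ ∂P ≤
        ∫ ω, ‖lagSum ε G B ℓ n ω - lagSum ε G' B ℓ n ω‖ ∂P +
          ∫ ω, ‖lagSum ε G' B ℓ n ω‖ ∂P := by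
      have hi1 := ((hG.integrable_lagSum hε hB ℓ n).sub
        (hmem.integrable (by norm_num))).norm
      have hi2 := (hmem.integrable (q := 2) (by norm_num)).norm
      refine (integral_mono_of_nonneg (Eventually.of_forall fun _ => norm_nonneg _)
        (hi1.add hi2) (Eventually.of_forall fun ω => ?_)).trans_eq (integral_add hi1 hi2)
      simpa using norm_add_le (lagSum ε G B ℓ n ω - lagSum ε G' B ℓ n ω) (lagSum ε G' B ℓ n ω)
    have h5 : 2 * (sd + a 0) * a (ℓ / 2) = lagBound sd a ℓ := by
      simp [lagBound, not_lt.2 hℓ]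
    rw [h5] at h1
    linarith

/-- The weak law of large numbers for the lag products of local functions. -/
theorem IsLocalFun.exists_integral_norm_lagSum_sub_le [CompleteSpace F] (hε : IsInnovation P ε)
    {m : ℕ} {G : (ℕ → S) → E} (hG : IsLocalFun P ε m G) {B : E →L[ℝ] E →L[ℝ] F}
    (hB : IsTensor B) (ℓ : ℕ) :
    ∃ C : ℝ, ∀ n : ℕ,
      ∫ ω, ‖lagSum ε G B ℓ n ω - (n : ℝ) • lagMean P ε G B ℓ‖ ∂P ≤ √n * C := by
  obtain ⟨M, hM⟩ := hG.bdd
  have hM0 : 0 ≤ M := (norm_nonneg _).trans (hM (past ε 0 (Classical.choice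
    (nonempty_of_isProbabilityMeasure P))))
  set γ := lagMean P ε G B ℓ with hγ
  set U : ℕ → Ω → F := fun j ω =>
    B (G (past ε ((j : ℤ) + 1) ω)) (G (past ε ((j : ℤ) + 1 + ℓ) ω)) - γ with hU
  have hbd : ∀ i k : ℤ, ∀ ω, ‖B (G (past ε i ω)) (G (past ε k ω))‖ ≤ M * M := fun i k ω => by
    rw [hB.norm_eq]
    exact mul_le_mul (hM _) (hM _) (norm_nonneg _) hM0
  set K : ℝ := M * M + ‖γ‖ with hK
  have hK0 : 0 ≤ K := by positivity
  have hUb : ∀ j ω, ‖U j ω‖ ≤ K := fun j ω =>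
    (norm_sub_le _ _).trans (add_le_add (hbd _ _ ω) le_rfl)
  have hUloc : ∀ j : ℕ, StronglyMeasurable[innovAlg ε (Set.Ioc ((j : ℤ) + 1 - m) ((j : ℤ) + 1 + ℓ))]
      (U j) := fun j =>
    (stronglyMeasurable_bilin B
      ((hG.loc _).mono (innovAlg_mono (Set.Ioc_subset_Ioc (le_refl _) (by omega))))
      ((hG.loc _).mono (innovAlg_mono (Set.Ioc_subset_Ioc (by omega) (le_refl _))))).sub
      stronglyMeasurable_const
  have hUm : ∀ j, StronglyMeasurable (U j) := fun j => (hUloc j).mono (hε.innovAlg_le _)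
  have hU2 : ∀ j, MemLp (U j) 2 P := fun j =>
    MemLp.of_bound (hUm j).aestronglyMeasurable K (Eventually.of_forall (hUb j))
  have hUi : ∀ j, Integrable (U j) P := fun j => (hU2 j).integrable (by norm_num)
  have hU0 : ∀ j, ∫ ω, U j ω ∂P = 0 := fun j => by
    rw [hU]
    simp only
    rw [integral_sub (hB.integrable (hG.memLp hε _ 2) (hG.memLp hε _ 2)) (integrable_const _),
      lagMean_eq hε hG.sm, integral_const]
    simp [hγ]
  -- `U j` uses the innovations with index in `(j+1-m, j+1+ℓ]`, so the sequence is
  -- `(m+ℓ)`-dependent.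
  set ρ : ℕ → ℝ := fun k => if k < m + ℓ then K ^ 2 else 0 with hρ
  have hρs : Summable ρ := summable_of_ne_finset_zero (s := Finset.range (m + ℓ)) fun n hn =>
    if_neg (by simpa using hn)
  have hcov : ∀ j k, ∫ ω, (inner ℝ (U j ω) (U (j + k) ω) : ℝ) ∂P ≤ ρ k := by
    intro j k
    by_cases hk : k < m + ℓ
    · simp only [hρ, hk, if_true]
      refine (le_abs_self _).trans ((abs_integral_inner_le (hU2 _) (hU2 _)).trans ?_)
      have hn : ∀ j, nrm P (U j) ≤ K := fun j => by
        rw [nrm_eq_sqrt (hU2 j), ← Real.sqrt_sq hK0]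
        refine Real.sqrt_le_sqrt ?_
        have := integral_mono_of_nonneg (μ := P) (Eventually.of_forall fun ω => sq_nonneg ‖U j ω‖)
          (integrable_const (K ^ 2))
          (Eventually.of_forall fun ω => pow_le_pow_left₀ (norm_nonneg _) (hUb j ω) 2)
        simpa using this
      rw [sq]
      exact mul_le_mul (hn _) (hn _) (nrm_nonneg _) hK0
    · simp only [hρ, hk, if_false]
      refine (hε.integral_inner_eq_zero ?_ (hUloc j) (hUloc (j + k)) (hUi _) (hUi _) (hU0 _)).le
      rw [Set.disjoint_left]; rintro x ⟨_, hx1⟩ ⟨hx2, _⟩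
      push_cast at hx2
      omega
  refine ⟨√(2 * ∑' k, ρ k), fun n => ?_⟩
  have h1 := CrossCov.integral_norm_sum_sq_le hU2 (fun k => by simp only [hρ]; positivity) hρs
    hcov n
  have hsum : ∀ ω, lagSum ε G B ℓ n ω - (n : ℝ) • γ = ∑ j ∈ Finset.range n, U j ω := fun ω => by
    simp [hU, lagSum, Finset.sum_sub_distrib, Nat.cast_smul_eq_nsmul]
  simp_rw [hsum]
  have hmem : MemLp (fun ω => ∑ j ∈ Finset.range n, U j ω) 2 P :=
    memLp_finsetSum _ fun j _ => hU2 j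
  refine (integral_norm_le_nrm hmem).trans ?_
  rw [nrm_eq_sqrt hmem, ← Real.sqrt_mul (Nat.cast_nonneg _)]
  exact Real.sqrt_le_sqrt h1

/-- The weak law of large numbers for lag products. -/
theorem IsApprox.tendsto_integral_norm_lagSum_sub [CompleteSpace F] {a : ℕ → ℝ}
    {G : (ℕ → S) → E} (hG : IsApprox P ε G a) (hε : IsInnovation P ε) (ha : IsRate a)
    {B : E →L[ℝ] E →L[ℝ] F} (hB : IsTensor B) (ℓ : ℕ) :
    Tendsto (fun n : ℕ => (∫ ω, ‖lagSum ε G B ℓ n ω - (n : ℝ) • lagMean P ε G B ℓ‖ ∂P) / n)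
      atTop (𝓝 0) := by
  set sd := nrm P (fun ω => G (past ε 0 ω)) with hsd
  have hsd0 : 0 ≤ sd := nrm_nonneg _
  have ha0 := (ha.pos 0).le
  rw [Metric.tendsto_atTop]
  intro η hη
  have hlim : Tendsto (fun m => 2 * (2 * (sd + a 0) * a m)) atTop (𝓝 0) := by
    have := ((ha.summable.tendsto_atTop_zero).const_mul (2 * (sd + a 0))).const_mul 2
    simpa using this
  -- The outer factor 2 covers two replacements of `G` by `G'`, one in the sum and one in its mean.
  -- The other `η / 2` is for the fluctuations of the local products.
  obtain ⟨m, hm1, hm⟩ : ∃ m, 1 ≤ m ∧ 2 * (2 * (sd + a 0) * a m) < η / 2 :=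
    ((eventually_ge_atTop 1).and (hlim.eventually_lt_const (by positivity))).exists
  obtain ⟨G', hG', hle⟩ := hG.approx m hm1
  obtain ⟨C, hC⟩ := hG'.exists_integral_norm_lagSum_sub_le hε hB ℓ
  have hlim2 : Tendsto (fun n : ℕ => C * (√(n : ℝ))⁻¹) atTop (𝓝 0) := by
    have := (tendsto_inv_atTop_zero.comp (Real.tendsto_sqrt_atTop.comp
      (tendsto_natCast_atTop_atTop (R := ℝ)))).const_mul C
    simpa using this
  obtain ⟨N, hN⟩ := eventually_atTop.1
    (hlim2.eventually_lt_const (show (0 : ℝ) < η / 2 by positivity))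
  refine ⟨max N 1, fun n hn => ?_⟩
  have hn0 : (0 : ℝ) < n := by
    have : 1 ≤ n := (le_max_right N 1).trans hn
    exact_mod_cast this
  have hint0 : 0 ≤ ∫ ω, ‖lagSum ε G B ℓ n ω - (n : ℝ) • lagMean P ε G B ℓ‖ ∂P :=
    integral_nonneg fun _ => norm_nonneg _
  rw [Real.dist_eq, sub_zero, abs_of_nonneg (div_nonneg hint0 hn0.le), div_lt_iff₀ hn0]
  have h1 := hG.integral_norm_lagSum_sub_le hε ha hG' hle hB ℓ n
  have h2 := hC n
  have h3 : ‖lagMean P ε G B ℓ - lagMean P ε G' B ℓ‖ ≤ 2 * (sd + a 0) * a m := by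
    rw [lagMean, lagMean, ← integral_sub (hB.integrable (hG.memLp_past hε _) (hG.memLp_past hε _))
      (hB.integrable (hG'.memLp hε _ 2) (hG'.memLp hε _ 2))]
    exact (norm_integral_le_integral_norm _).trans
      (hG.integral_norm_bilin_sub_le hε ha hG' hle hB _ _)
  have hiG := hG.integrable_lagSum hε hB ℓ n
  have hiG' : Integrable (lagSum ε G' B ℓ n) P :=
    integrable_finsetSum _ fun _ _ => hB.integrable (hG'.memLp hε _ 2) (hG'.memLp hε _ 2)
  have hi1 := (hiG.sub hiG').norm
  have hi2 := (hiG'.sub (integrable_const ((n : ℝ) • lagMean P ε G' B ℓ))).norm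
  have hi3 : Integrable (fun _ : Ω => n * ‖lagMean P ε G B ℓ - lagMean P ε G' B ℓ‖) P :=
    integrable_const _
  have h4 : ∫ ω, ‖lagSum ε G B ℓ n ω - (n : ℝ) • lagMean P ε G B ℓ‖ ∂P ≤
      ∫ ω, ‖lagSum ε G B ℓ n ω - lagSum ε G' B ℓ n ω‖ ∂P +
      ∫ ω, ‖lagSum ε G' B ℓ n ω - (n : ℝ) • lagMean P ε G' B ℓ‖ ∂P +
      n * ‖lagMean P ε G B ℓ - lagMean P ε G' B ℓ‖ := by
    have h5 : ∫ _ : Ω, n * ‖lagMean P ε G B ℓ - lagMean P ε G' B ℓ‖ ∂P =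
      n * ‖lagMean P ε G B ℓ - lagMean P ε G' B ℓ‖ := by simp
    have h12 : Integrable (fun ω => ‖lagSum ε G B ℓ n ω - lagSum ε G' B ℓ n ω‖ +
      ‖lagSum ε G' B ℓ n ω - (n : ℝ) • lagMean P ε G' B ℓ‖) P := hi1.add hi2
    have h6 : ∫ ω, (‖lagSum ε G B ℓ n ω - lagSum ε G' B ℓ n ω‖ +
        ‖lagSum ε G' B ℓ n ω - (n : ℝ) • lagMean P ε G' B ℓ‖) ∂P = _ := integral_add hi1 hi2
    have h7 := integral_add h12 hi3
    rw [h6, h5] at h7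
    refine le_trans ?_ h7.le
    refine integral_mono_of_nonneg (Eventually.of_forall fun _ => norm_nonneg _)
      (h12.add hi3) (Eventually.of_forall fun ω => ?_)
    have h8 : lagSum ε G B ℓ n ω - (n : ℝ) • lagMean P ε G B ℓ =
        (lagSum ε G B ℓ n ω - lagSum ε G' B ℓ n ω) +
        (lagSum ε G' B ℓ n ω - (n : ℝ) • lagMean P ε G' B ℓ) +
        -((n : ℝ) • (lagMean P ε G B ℓ - lagMean P ε G' B ℓ)) := by
      rw [smul_sub]; abel
    change ‖lagSum ε G B ℓ n ω - (n : ℝ) • lagMean P ε G B ℓ‖ ≤ _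
    rw [h8]
    refine (norm_add₃_le).trans (add_le_add le_rfl (le_of_eq ?_))
    rw [norm_neg, norm_smul, Real.norm_of_nonneg hn0.le]
  have h9 : √(n : ℝ) * C < η / 2 * n := by
    have := hN n ((le_max_left N 1).trans hn)
    have hs : 0 < √(n : ℝ) := Real.sqrt_pos.2 hn0
    calc √(n : ℝ) * C = (C * (√(n : ℝ))⁻¹) * (√(n : ℝ) * √(n : ℝ)) := by
          field_simp
      _ = (C * (√(n : ℝ))⁻¹) * n := by rw [Real.mul_self_sqrt hn0.le]
      _ < η / 2 * n := mul_lt_mul_of_pos_right this hn0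
  have h10 := mul_le_mul_of_nonneg_left h3 hn0.le
  have h11 := mul_lt_mul_of_pos_right hm hn0
  nlinarith

end LagAverages

/-! ### Weighted sums of lag averages with a growing number of lags. -/

section WeightedLags

variable {Ω S E F : Type*} [MeasurableSpace Ω] [MeasurableSpace S] {P : Measure Ω}
  [IsProbabilityMeasure P] {ε : ℤ → Ω → S} [NormedAddCommGroup E] [InnerProductSpace ℝ E]
  [NormedAddCommGroup F] [InnerProductSpace ℝ F]

/-- The lag averages converge to `lagMean` in mean, and their mean norms are at most `lagBound` plus
a term of order `1/√n`; let `n → ∞`. -/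
theorem IsApprox.norm_lagMean_le [CompleteSpace E] [CompleteSpace F] {a : ℕ → ℝ}
    {G : (ℕ → S) → E} (hG : IsApprox P ε G a) (hε : IsInnovation P ε) (ha : IsRate a)
    {B : E →L[ℝ] E →L[ℝ] F} (hB : IsTensor B) (ℓ : ℕ) :
    ‖lagMean P ε G B ℓ‖ ≤ lagBound (nrm P (fun ω => G (past ε 0 ω))) a ℓ := by
  set sd := nrm P (fun ω => G (past ε 0 ω)) with hsd
  have h1 := hG.tendsto_integral_norm_lagSum_sub hε ha hB ℓ
  have h2 : Tendsto (fun n : ℕ => lagBound sd a ℓ + lagConst sd a * (√(n : ℝ))⁻¹) atTop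
      (𝓝 (lagBound sd a ℓ + lagConst sd a * 0)) :=
    tendsto_const_nhds.add ((tendsto_inv_atTop_zero.comp (Real.tendsto_sqrt_atTop.comp
      (tendsto_natCast_atTop_atTop (R := ℝ)))).const_mul _)
  have h3 := h1.add h2
  rw [mul_zero, add_zero, zero_add] at h3
  refine ge_of_tendsto h3 ((eventually_gt_atTop 0).mono fun n hn => ?_)
  have hn0 : (0 : ℝ) < n := by exact_mod_cast hn
  have h4 := hG.integral_norm_lagSum_le hε ha hB ℓ n
  rw [← hsd] at h4
  have hi := hG.integrable_lagSum hε hB ℓ n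
  have hi1 := (hi.sub (integrable_const ((n : ℝ) • lagMean P ε G B ℓ))).norm
  have h5 : n * ‖lagMean P ε G B ℓ‖ ≤
      ∫ ω, ‖lagSum ε G B ℓ n ω - (n : ℝ) • lagMean P ε G B ℓ‖ ∂P +
        ∫ ω, ‖lagSum ε G B ℓ n ω‖ ∂P := by
    have h6 : ∫ ω, (‖lagSum ε G B ℓ n ω - (n : ℝ) • lagMean P ε G B ℓ‖ +
        ‖lagSum ε G B ℓ n ω‖) ∂P = _ := integral_add hi1 hi.norm
    rw [← h6]
    have h7 : ∫ _ : Ω, n * ‖lagMean P ε G B ℓ‖ ∂P = n * ‖lagMean P ε G B ℓ‖ := by simp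
    rw [← h7]
    refine integral_mono (integrable_const _) (hi1.add hi.norm) fun ω => ?_
    have h8 := norm_sub_le (lagSum ε G B ℓ n ω)
      (lagSum ε G B ℓ n ω - (n : ℝ) • lagMean P ε G B ℓ)
    rw [sub_sub_cancel, norm_smul, Real.norm_of_nonneg hn0.le] at h8
    linarith
  have hs : 0 < √(n : ℝ) := Real.sqrt_pos.2 hn0
  have h10 : √(n : ℝ) * lagConst sd a = n * (lagConst sd a * (√(n : ℝ))⁻¹) := by
    calc √(n : ℝ) * lagConst sd a = n / √(n : ℝ) * lagConst sd a := by rw [Real.div_sqrt]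
      _ = _ := by ring
  rw [h10] at h4
  refine le_of_mul_le_mul_left ?_ hn0
  rw [mul_add, mul_div_cancel₀ _ hn0.ne', mul_add]
  linarith

theorem IsApprox.summable_norm_lagMean [CompleteSpace E] [CompleteSpace F] {a : ℕ → ℝ}
    {G : (ℕ → S) → E} (hG : IsApprox P ε G a) (hε : IsInnovation P ε) (ha : IsRate a)
    {B : E →L[ℝ] E →L[ℝ] F} (hB : IsTensor B) :
    Summable fun ℓ => ‖lagMean P ε G B ℓ‖ :=
  Summable.of_nonneg_of_le (fun _ => norm_nonneg _) (hG.norm_lagMean_le hε ha hB)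
    (summable_lagBound ha)

/-- The lag `ℓ` average over a sample of size `T`. -/
noncomputable def lagAvg (ε : ℤ → Ω → S) (G : (ℕ → S) → E) (B : E →L[ℝ] E →L[ℝ] F) (T ℓ : ℕ)
    (ω : Ω) : F :=
  (T : ℝ)⁻¹ • lagSum ε G B ℓ (T - ℓ) ω

theorem IsApprox.integral_norm_lagAvg_le [CompleteSpace E] {a : ℕ → ℝ} {G : (ℕ → S) → E}
    (hG : IsApprox P ε G a) (hε : IsInnovation P ε) (ha : IsRate a)
    {B : E →L[ℝ] E →L[ℝ] F} (hB : IsTensor B) {T : ℕ} (hT : 0 < T) (ℓ : ℕ) :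
    ∫ ω, ‖lagAvg ε G B T ℓ ω‖ ∂P ≤ lagBound (nrm P (fun ω => G (past ε 0 ω))) a ℓ +
      lagConst (nrm P (fun ω => G (past ε 0 ω))) a / √T := by
  set sd := nrm P (fun ω => G (past ε 0 ω)) with hsd
  have hT0 : (0 : ℝ) < T := by exact_mod_cast hT
  have h4 := hG.integral_norm_lagSum_le hε ha hB ℓ (T - ℓ)
  rw [← hsd] at h4
  have hle : ((T - ℓ : ℕ) : ℝ) ≤ T := by exact_mod_cast Nat.sub_le T ℓ
  have hb := lagBound_nonneg (sd := sd) (nrm_nonneg _) ha ℓ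
  have hc : 0 ≤ lagConst sd a := Real.sqrt_nonneg _
  have hs : 0 < √(T : ℝ) := Real.sqrt_pos.2 hT0
  simp_rw [lagAvg, norm_smul]
  rw [integral_const_mul, norm_inv, Real.norm_of_nonneg hT0.le, inv_mul_le_iff₀ hT0]
  calc _ ≤ _ := h4
    _ ≤ T * lagBound sd a ℓ + √T * lagConst sd a :=
      add_le_add (mul_le_mul_of_nonneg_right hle hb)
        (mul_le_mul_of_nonneg_right (Real.sqrt_le_sqrt hle) hc)
    _ = _ := by rw [mul_add, mul_div_assoc', mul_comm (T : ℝ) (lagConst sd a), mul_div_assoc, Real.div_sqrt,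
        mul_comm (lagConst sd a)]

theorem IsApprox.integrable_lagAvg {a : ℕ → ℝ} {G : (ℕ → S) → E} (hG : IsApprox P ε G a)
    (hε : IsInnovation P ε) {B : E →L[ℝ] E →L[ℝ] F} (hB : IsTensor B) (T ℓ : ℕ) :
    Integrable (lagAvg ε G B T ℓ) P :=
  (hG.integrable_lagSum hε hB ℓ (T - ℓ)).smul _

theorem IsApprox.tendsto_integral_norm_lagAvg_sub [CompleteSpace E] [CompleteSpace F]
    {a : ℕ → ℝ} {G : (ℕ → S) → E} (hG : IsApprox P ε G a) (hε : IsInnovation P ε)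
    (ha : IsRate a) {B : E →L[ℝ] E →L[ℝ] F} (hB : IsTensor B) (ℓ : ℕ) :
    Tendsto (fun T : ℕ => ∫ ω, ‖lagAvg ε G B T ℓ ω - lagMean P ε G B ℓ‖ ∂P) atTop (𝓝 0) := by
  set γ := lagMean P ε G B ℓ with hγ
  have h1 := (hG.tendsto_integral_norm_lagSum_sub hε ha hB ℓ).comp (tendsto_sub_atTop_nat ℓ)
  have h2 : Tendsto (fun T : ℕ => ℓ * ‖γ‖ * (T : ℝ)⁻¹) atTop (𝓝 (ℓ * ‖γ‖ * 0)) :=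
    (tendsto_inv_atTop_zero.comp (tendsto_natCast_atTop_atTop (R := ℝ))).const_mul _
  have h3 := h1.add h2
  rw [mul_zero, zero_add] at h3
  refine tendsto_of_tendsto_of_tendsto_of_le_of_le' tendsto_const_nhds h3
    (Eventually.of_forall fun T => integral_nonneg fun _ => norm_nonneg _)
    ((eventually_gt_atTop ℓ).mono fun T hT => ?_)
  have hT0 : (0 : ℝ) < T := by
    have : 0 < T := by omega
    exact_mod_cast this
  have hn0 : (0 : ℝ) < ((T - ℓ : ℕ) : ℝ) := by
    have : 0 < T - ℓ := by omega
    exact_mod_cast this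
  have hsub : ((T - ℓ : ℕ) : ℝ) = T - ℓ := by rw [Nat.cast_sub hT.le]
  have hi : Integrable (fun ω => ‖lagSum ε G B ℓ (T - ℓ) ω - ((T - ℓ : ℕ) : ℝ) • γ‖) P :=
    ((hG.integrable_lagSum hε hB ℓ (T - ℓ)).sub (integrable_const (((T - ℓ : ℕ) : ℝ) • γ))).norm
  simp only [Function.comp_apply]
  set J := ∫ ω, ‖lagSum ε G B ℓ (T - ℓ) ω - ((T - ℓ : ℕ) : ℝ) • γ‖ ∂P with hJ
  have hJ0 : 0 ≤ J := integral_nonneg fun _ => norm_nonneg _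
  have h4 : ∫ ω, ‖lagAvg ε G B T ℓ ω - γ‖ ∂P ≤ (T : ℝ)⁻¹ * J + (ℓ * ‖γ‖) * (T : ℝ)⁻¹ := by
    have h5 : ∫ ω, ((T : ℝ)⁻¹ * ‖lagSum ε G B ℓ (T - ℓ) ω - ((T - ℓ : ℕ) : ℝ) • γ‖ +
        (ℓ * ‖γ‖) * (T : ℝ)⁻¹) ∂P = (T : ℝ)⁻¹ * J + (ℓ * ‖γ‖) * (T : ℝ)⁻¹ := by
      rw [integral_add (hi.const_mul _) (integrable_const _), integral_const_mul]
      simp [hJ]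
    rw [← h5]
    refine integral_mono_of_nonneg (Eventually.of_forall fun _ => norm_nonneg _)
      ((hi.const_mul _).add (integrable_const _)) (Eventually.of_forall fun ω => ?_)
    -- There are `T - ℓ` summands but the divisor is `T`; the deficit `ℓ/T` produces the last term.
    have h6 : lagAvg ε G B T ℓ ω - γ =
        (T : ℝ)⁻¹ • (lagSum ε G B ℓ (T - ℓ) ω - ((T - ℓ : ℕ) : ℝ) • γ) -
          ((ℓ : ℝ) * (T : ℝ)⁻¹) • γ := by
      rw [lagAvg, smul_sub, smul_smul, hsub, sub_sub, ← add_smul]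
      have : (T : ℝ)⁻¹ * (T - ℓ) + ℓ * (T : ℝ)⁻¹ = 1 := by field_simp; ring
      rw [this, one_smul]
    change ‖lagAvg ε G B T ℓ ω - γ‖ ≤ _
    rw [h6]
    refine (norm_sub_le _ _).trans (le_of_eq ?_)
    rw [norm_smul, norm_smul, norm_mul, norm_inv, Real.norm_of_nonneg hT0.le, Real.norm_natCast]
    ring
  refine h4.trans (add_le_add ?_ le_rfl)
  rw [div_eq_inv_mul]
  exact mul_le_mul_of_nonneg_right
    (inv_anti₀ hn0 (by exact_mod_cast Nat.sub_le T ℓ)) hJ0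

set_option maxHeartbeats 800000 in
/-- Consistency of weighted sums of lag averages. -/
theorem IsApprox.tendsto_integral_norm_weighted [CompleteSpace E] [CompleteSpace F]
    {a : ℕ → ℝ} {G : (ℕ → S) → E} (hG : IsApprox P ε G a) (hε : IsInnovation P ε)
    (ha : IsRate a) {B : E →L[ℝ] E →L[ℝ] F} (hB : IsTensor B)
    {w : ℕ → ℕ → ℝ} {c : ℕ → ℝ} {M : ℝ} {N : ℕ → ℝ} (hw : ∀ T ℓ, |w T ℓ| ≤ M)
    (hc : ∀ ℓ, Tendsto (fun T => w T ℓ) atTop (𝓝 (c ℓ)))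
    (hN : ∀ T ℓ : ℕ, N T < (ℓ : ℝ) → w T ℓ = 0)
    (hN' : Tendsto (fun T : ℕ => N T / √(T : ℝ)) atTop (𝓝 0)) :
    Tendsto (fun T : ℕ => ∫ ω, ‖∑ ℓ ∈ Finset.range T, w T ℓ • lagAvg ε G B T ℓ ω -
      ∑' ℓ, c ℓ • lagMean P ε G B ℓ‖ ∂P) atTop (𝓝 0) := by
  set sd := nrm P (fun ω => G (past ε 0 ω)) with hsd
  set γ := lagMean P ε G B with hγ
  set b := lagBound sd a with hb
  have hb0 : ∀ ℓ, 0 ≤ b ℓ := lagBound_nonneg (nrm_nonneg _) ha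
  have hbs : Summable b := summable_lagBound ha
  have hγb : ∀ ℓ, ‖γ ℓ‖ ≤ b ℓ := hG.norm_lagMean_le hε ha hB
  have hM0 : 0 ≤ M := (abs_nonneg _).trans (hw 0 0)
  have hcM : ∀ ℓ, |c ℓ| ≤ M := fun ℓ =>
    le_of_tendsto (hc ℓ).abs (Eventually.of_forall fun T => hw T ℓ)
  have hcγ : ∀ ℓ, ‖c ℓ • γ ℓ‖ ≤ M * b ℓ := fun ℓ => by
    rw [norm_smul]; exact mul_le_mul (hcM ℓ) (hγb ℓ) (norm_nonneg _) hM0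
  have hcs : Summable fun ℓ => ‖c ℓ • γ ℓ‖ :=
    Summable.of_nonneg_of_le (fun _ => norm_nonneg _) hcγ (hbs.mul_left M)
  set C := lagConst sd a with hC
  have hC0 : 0 ≤ C := Real.sqrt_nonneg _
  set D : ℕ → ℕ → ℝ := fun T ℓ => ∫ ω, ‖w T ℓ • lagAvg ε G B T ℓ ω - c ℓ • γ ℓ‖ ∂P with hD
  have hD0 : ∀ T ℓ, 0 ≤ D T ℓ := fun T ℓ => integral_nonneg fun _ => norm_nonneg _
  have hYi : ∀ T ℓ, Integrable (lagAvg ε G B T ℓ) P := hG.integrable_lagAvg hε hB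
  have hDlim : ∀ ℓ, Tendsto (fun T => D T ℓ) atTop (𝓝 0) := by
    intro ℓ
    have h1 := (hG.tendsto_integral_norm_lagAvg_sub hε ha hB ℓ).const_mul M
    have h2 : Tendsto (fun T => |w T ℓ - c ℓ| * ‖γ ℓ‖) atTop (𝓝 (|c ℓ - c ℓ| * ‖γ ℓ‖)) :=
      (((hc ℓ).sub tendsto_const_nhds).abs).mul_const _
    have h3 := h1.add h2
    rw [sub_self, abs_zero, zero_mul, mul_zero, add_zero] at h3
    refine squeeze_zero (fun T => hD0 T ℓ) (fun T => ?_) h3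
    have hi := ((hYi T ℓ).sub (integrable_const (γ ℓ))).norm
    have h5 : ∫ ω, (M * ‖lagAvg ε G B T ℓ ω - γ ℓ‖ + |w T ℓ - c ℓ| * ‖γ ℓ‖) ∂P =
        M * ∫ ω, ‖lagAvg ε G B T ℓ ω - γ ℓ‖ ∂P + |w T ℓ - c ℓ| * ‖γ ℓ‖ := by
      have h6 : Integrable (fun ω => M * ‖lagAvg ε G B T ℓ ω - γ ℓ‖) P := hi.const_mul M
      rw [integral_add h6 (integrable_const _), integral_const_mul]
      simp
    rw [← h5]
    refine integral_mono_of_nonneg (Eventually.of_forall fun _ => norm_nonneg _)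
      ((hi.const_mul _).add (integrable_const _)) (Eventually.of_forall fun ω => ?_)
    have h6 : w T ℓ • lagAvg ε G B T ℓ ω - c ℓ • γ ℓ =
        w T ℓ • (lagAvg ε G B T ℓ ω - γ ℓ) + (w T ℓ - c ℓ) • γ ℓ := by
      rw [smul_sub, sub_smul]; abel
    change ‖w T ℓ • lagAvg ε G B T ℓ ω - c ℓ • γ ℓ‖ ≤ _
    rw [h6]
    refine (norm_add_le _ _).trans ?_
    rw [norm_smul, norm_smul]
    exact add_le_add (mul_le_mul_of_nonneg_right (hw T ℓ) (norm_nonneg _)) le_rfl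
  have hDle : ∀ T : ℕ, 0 < T → ∀ ℓ : ℕ, D T ℓ ≤ 2 * M * b ℓ +
      if (ℓ : ℝ) ≤ N T then M * C / √T else 0 := by
    intro T hT ℓ
    have h1 : D T ℓ ≤ |w T ℓ| * ∫ ω, ‖lagAvg ε G B T ℓ ω‖ ∂P + ‖c ℓ • γ ℓ‖ := by
      have hi := (hYi T ℓ).norm.const_mul |w T ℓ|
      have h5 : ∫ ω, (|w T ℓ| * ‖lagAvg ε G B T ℓ ω‖ + ‖c ℓ • γ ℓ‖) ∂P =
          |w T ℓ| * ∫ ω, ‖lagAvg ε G B T ℓ ω‖ ∂P + ‖c ℓ • γ ℓ‖ := by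
        rw [integral_add hi (integrable_const _), integral_const_mul]
        simp
      rw [← h5]
      refine integral_mono_of_nonneg (Eventually.of_forall fun _ => norm_nonneg _)
        (hi.add (integrable_const _)) (Eventually.of_forall fun ω => ?_)
      refine (norm_sub_le _ _).trans_eq ?_
      rw [norm_smul, Real.norm_eq_abs]
    have h2 := hcγ ℓ
    have hs : 0 ≤ √(T : ℝ) := Real.sqrt_nonneg _
    by_cases hℓ : (ℓ : ℝ) ≤ N T
    · rw [if_pos hℓ]
      have h3 := hG.integral_norm_lagAvg_le hε ha hB hT ℓ
      have h4 : |w T ℓ| * ∫ ω, ‖lagAvg ε G B T ℓ ω‖ ∂P ≤ M * (b ℓ + C / √T) :=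
        mul_le_mul (hw T ℓ) h3 (integral_nonneg fun _ => norm_nonneg _) hM0
      have h5 : M * (b ℓ + C / √T) = M * b ℓ + M * C / √T := by ring
      linarith
    · rw [if_neg hℓ]
      rw [hN T ℓ (not_le.1 hℓ), abs_zero, zero_mul, zero_add] at h1
      have : 0 ≤ M * b ℓ := mul_nonneg hM0 (hb0 ℓ)
      linarith
  -- Cutting `D` off at a summable sequence allows dominated convergence over the lags. What is cut
  -- off is at most `M C / √T` per lag, and only for the at most `|N T| + 1` active lags.
  set u : ℕ → ℕ → ℝ := fun T ℓ => min (D T ℓ) (2 * M * b ℓ) with hu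
  have hu0 : ∀ T ℓ, 0 ≤ u T ℓ := fun T ℓ =>
    le_min (hD0 T ℓ) (mul_nonneg (by positivity) (hb0 ℓ))
  have hus : ∀ T, Summable (u T) := fun T =>
    Summable.of_nonneg_of_le (hu0 T) (fun ℓ => min_le_right _ _) (hbs.mul_left (2 * M))
  have hulim : Tendsto (fun T => ∑' ℓ, u T ℓ) atTop (𝓝 (∑' _ : ℕ, (0 : ℝ))) := by
    refine tendsto_tsum_of_dominated_convergence (hbs.mul_left (2 * M)) (fun ℓ => ?_)
      (Eventually.of_forall fun T ℓ => ?_)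
    · exact squeeze_zero (fun T => hu0 T ℓ) (fun T => min_le_left _ _) (hDlim ℓ)
    · rw [Real.norm_of_nonneg (hu0 T ℓ)]; exact min_le_right _ _
  rw [tsum_zero] at hulim
  have htail : Tendsto (fun T => ∑' ℓ, ‖c (ℓ + T) • γ (ℓ + T)‖) atTop (𝓝 0) :=
    tendsto_sum_nat_add fun ℓ => ‖c ℓ • γ ℓ‖
  have hlast : Tendsto (fun T : ℕ => (|N T / √(T : ℝ)| + (√(T : ℝ))⁻¹) * (M * C)) atTop
      (𝓝 ((|0| + 0) * (M * C))) :=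
    ((hN'.abs).add (tendsto_inv_atTop_zero.comp (Real.tendsto_sqrt_atTop.comp
      (tendsto_natCast_atTop_atTop (R := ℝ))))).mul_const _
  have hall := (hulim.add hlast).add htail
  simp only [abs_zero, add_zero, zero_mul] at hall
  refine tendsto_of_tendsto_of_tendsto_of_le_of_le' tendsto_const_nhds hall
    (Eventually.of_forall fun T => integral_nonneg fun _ => norm_nonneg _)
    ((eventually_gt_atTop 0).mono fun T hT => ?_)
  have hT0 : (0 : ℝ) < T := by exact_mod_cast hT
  have hs : 0 < √(T : ℝ) := Real.sqrt_pos.2 hT0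
  have hsplit : ∑' ℓ, c ℓ • γ ℓ = ∑ ℓ ∈ Finset.range T, c ℓ • γ ℓ +
      ∑' ℓ, c (ℓ + T) • γ (ℓ + T) := (hcs.of_norm.sum_add_tsum_nat_add T).symm
  have htn : ‖∑' ℓ, c (ℓ + T) • γ (ℓ + T)‖ ≤ ∑' ℓ, ‖c (ℓ + T) • γ (ℓ + T)‖ :=
    norm_tsum_le_tsum_norm ((summable_nat_add_iff T).2 hcs)
  have hUi : ∀ ℓ, Integrable (fun ω => w T ℓ • lagAvg ε G B T ℓ ω - c ℓ • γ ℓ) P := fun ℓ =>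
    ((hYi T ℓ).smul _).sub (integrable_const _)
  have h1 : ∫ ω, ‖∑ ℓ ∈ Finset.range T, w T ℓ • lagAvg ε G B T ℓ ω - ∑' ℓ, c ℓ • γ ℓ‖ ∂P ≤
      ∑ ℓ ∈ Finset.range T, D T ℓ + ∑' ℓ, ‖c (ℓ + T) • γ (ℓ + T)‖ := by
    have hi := integrable_finsetSum (Finset.range T) fun ℓ _ => hUi ℓ
    refine le_trans ?_ (add_le_add (integral_norm_sum_le (Finset.range T) fun ℓ _ => hUi ℓ) le_rfl)
    have h5 : ∫ ω, (‖∑ ℓ ∈ Finset.range T, (w T ℓ • lagAvg ε G B T ℓ ω - c ℓ • γ ℓ)‖ +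
        ∑' ℓ, ‖c (ℓ + T) • γ (ℓ + T)‖) ∂P = _ := integral_add hi.norm (integrable_const _)
    rw [integral_const, probReal_univ, one_smul] at h5
    rw [← h5]
    refine integral_mono_of_nonneg (Eventually.of_forall fun _ => norm_nonneg _)
      (hi.norm.add (integrable_const _)) (Eventually.of_forall fun ω => ?_)
    change ‖∑ ℓ ∈ Finset.range T, w T ℓ • lagAvg ε G B T ℓ ω - ∑' ℓ, c ℓ • γ ℓ‖ ≤ _
    rw [hsplit, ← sub_sub, ← Finset.sum_sub_distrib]
    exact (norm_sub_le _ _).trans (add_le_add le_rfl htn)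
  have h2 : ∑ ℓ ∈ Finset.range T, D T ℓ ≤ ∑' ℓ, u T ℓ +
      (|N T / √(T : ℝ)| + (√(T : ℝ))⁻¹) * (M * C) := by
    have h3 : ∀ ℓ ∈ Finset.range T, D T ℓ ≤ u T ℓ +
        if (ℓ : ℝ) ≤ N T then M * C / √T else 0 := fun ℓ _ => by
      have h4 := hDle T hT ℓ
      have h5 : 0 ≤ if (ℓ : ℝ) ≤ N T then M * C / √T else 0 := by positivity
      simp only [hu]
      rcases min_cases (D T ℓ) (2 * M * b ℓ) with h | h <;> rw [h.1] <;> linarith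
    refine (Finset.sum_le_sum h3).trans ?_
    rw [Finset.sum_add_distrib]
    refine add_le_add ((hus T).sum_le_tsum _ fun ℓ _ => hu0 T ℓ) ?_
    rw [← Finset.sum_filter, Finset.sum_const, nsmul_eq_mul]
    have hcard : (((Finset.range T).filter fun ℓ : ℕ => (ℓ : ℝ) ≤ N T).card : ℝ) ≤ |N T| + 1 := by
      have hsub : (Finset.range T).filter (fun ℓ : ℕ => (ℓ : ℝ) ≤ N T) ⊆
          Finset.range (⌊|N T|⌋₊ + 1) := by
        intro ℓ hℓ
        rw [Finset.mem_range, Nat.lt_succ_iff]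
        exact Nat.le_floor ((Finset.mem_filter.1 hℓ).2.trans (le_abs_self _))
      have h6 := Finset.card_le_card hsub
      rw [Finset.card_range] at h6
      have h7 : (((Finset.range T).filter fun ℓ : ℕ => (ℓ : ℝ) ≤ N T).card : ℝ) ≤
        ((⌊|N T|⌋₊ + 1 : ℕ) : ℝ) := by exact_mod_cast h6
      push_cast at h7
      linarith [Nat.floor_le (abs_nonneg (N T))]
    refine (mul_le_mul_of_nonneg_right hcard (by positivity)).trans (le_of_eq ?_)
    rw [abs_div, abs_of_pos hs]
    ring
  linarith

end WeightedLags

/-! ### From the coupling condition to bounded centered local approximations. -/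

section Coupling

variable {Ω S E : Type*} [MeasurableSpace Ω] [MeasurableSpace S] {P : Measure Ω}
  [IsProbabilityMeasure P] {ε : ℤ → Ω → S} [NormedAddCommGroup E] [InnerProductSpace ℝ E]

/-- Keep the first `m` coordinates of a sequence and replace the others by those of `x`. -/
def spliceAt (x : ℕ → S) (m : ℕ) (s : ℕ → S) : ℕ → S := fun k => if k < m then s k else x k

theorem measurable_spliceAt (x : ℕ → S) (m : ℕ) : Measurable (spliceAt x m) := by
  refine measurable_pi_iff.2 fun k => ?_
  by_cases hk : k < m
  · simpa [spliceAt, hk] using measurable_pi_apply k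
  · simp [spliceAt, hk]

theorem measurable_spliceAt_past (x : ℕ → S) (m : ℕ) (i : ℤ) :
    Measurable[innovAlg ε (Set.Ioc (i - m) i)] (fun ω => spliceAt x m (past ε i ω)) := by
  refine @measurable_pi_iff _ _ _ (innovAlg ε (Set.Ioc (i - m) i)) _ _ |>.2 fun k => ?_
  by_cases hk : k < m
  · simp only [spliceAt, hk, if_true, past]
    exact measurable_innovAlg ⟨by omega, by omega⟩
  · simp only [spliceAt, hk, if_false]
    exact measurable_const

/-- A coupled approximation with random tail can be replaced by one with a fixed tail. -/
theorem exists_tail_eLpNorm_le (hε : IsInnovation P ε) {ε' : ℤ → Ω → S}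
    (hε' : ∀ i, Measurable (ε' i)) (hind : IndepFun (fun ω i => ε i ω) (fun ω i => ε' i ω) P)
    {G : (ℕ → S) → E} (hG : StronglyMeasurable G) (m : ℕ) :
    ∃ x : ℕ → S, eLpNorm (fun ω => G (past ε 0 ω) - G (spliceAt x m (past ε 0 ω))) 2 P ≤
      eLpNorm (fun ω => G (past ε 0 ω) - G (coupledPast ε ε' m 0 ω)) 2 P := by
  have hm1 : Measurable (fun ω i => ε i ω) := measurable_pi_iff.2 hε.measurable
  have hm2 : Measurable (fun ω i => ε' i ω) := measurable_pi_iff.2 hε'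
  set μ₁ := P.map (fun ω i => ε i ω) with hμ₁
  set μ₂ := P.map (fun ω i => ε' i ω) with hμ₂
  have : IsProbabilityMeasure μ₁ := Measure.isProbabilityMeasure_map hm1.aemeasurable
  have : IsProbabilityMeasure μ₂ := Measure.isProbabilityMeasure_map hm2.aemeasurable
  set q : (ℤ → S) → ℕ → S := fun e k => e (0 - k) with hq
  have hqm : Measurable q := measurable_pi_iff.2 fun k => measurable_pi_apply _
  set Φ : (ℤ → S) × (ℤ → S) → ENNReal :=
    fun z => ‖G (q z.1) - G (spliceAt (q z.2) m (q z.1))‖ₑ ^ (2 : ℝ) with hΦ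
  have hsm : Measurable (fun z : (ℤ → S) × (ℤ → S) => spliceAt (q z.2) m (q z.1)) := by
    refine measurable_pi_iff.2 fun k => ?_
    by_cases hk : k < m
    · simp only [spliceAt, hk, if_true]
      exact (measurable_pi_apply k).comp (hqm.comp measurable_fst)
    · simp only [spliceAt, hk, if_false]
      exact (measurable_pi_apply k).comp (hqm.comp measurable_snd)
  have hΦm : Measurable Φ :=
    (((hG.comp_measurable (hqm.comp measurable_fst)).sub
      (hG.comp_measurable hsm)).enorm).pow_const _
  have hmap : P.map (fun ω => ((fun i => ε i ω), fun i => ε' i ω)) = μ₁.prod μ₂ :=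
    (indepFun_iff_map_prod_eq_prod_map_map hm1.aemeasurable hm2.aemeasurable).1 hind
  have htot : ∫⁻ ω, Φ ((fun i => ε i ω), fun i => ε' i ω) ∂P =
      ∫⁻ y, ∫⁻ x, Φ (x, y) ∂μ₁ ∂μ₂ := by
    rw [← lintegral_prod_symm' _ hΦm, ← hmap, lintegral_map hΦm (hm1.prodMk hm2)]
  -- By independence the coupled error is an average, over independent tails `y`, of the errors with
  -- tail `y` fixed; some `y` does no worse than the average.
  obtain ⟨y, hy⟩ := exists_le_lintegral (μ := μ₂) (f := fun y => ∫⁻ x, Φ (x, y) ∂μ₁)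
    (hΦm.lintegral_prod_left').aemeasurable
  refine ⟨q y, ?_⟩
  rw [eLpNorm_eq_lintegral_rpow_enorm_toReal (by norm_num) (by norm_num),
    eLpNorm_eq_lintegral_rpow_enorm_toReal (by norm_num) (by norm_num)]
  simp only [ENNReal.toReal_ofNat]
  refine ENNReal.rpow_le_rpow ?_ (by norm_num)
  have hmy := lintegral_map (μ := P) (f := fun x => Φ (x, y))
    (hΦm.comp (measurable_id.prodMk measurable_const)) hm1
  rw [← htot, hμ₁, hmy] at hy
  exact hy

/-- The coupling condition yields centered bounded approximations by functions of finitely many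
innovations. -/
theorem isApprox_of_coupling (hε : IsInnovation P ε) {εs : ℕ → ℤ → Ω → S}
    (hεs : ∀ m, 1 ≤ m → ∀ i, Measurable (εs m i))
    (hind : ∀ m, 1 ≤ m → IndepFun (fun ω i => ε i ω) (fun ω i => εs m i ω) P)
    {G : (ℕ → S) → E} (hG : StronglyMeasurable G) (hG2 : MemLp (fun ω => G (past ε 0 ω)) 2 P)
    (hmean : ∫ ω, G (past ε 0 ω) ∂P = 0) {a : ℕ → ℝ} (ha : ∀ m, 0 < a m)
    (hrate : ∀ m, 1 ≤ m →
      eLpNorm (fun ω => G (past ε 0 ω) - G (coupledPast ε (εs m) m 0 ω)) 2 P ≤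
        ENNReal.ofReal (a m)) : IsApprox P ε G (fun m => 4 * a m) := by
  refine ⟨hG, hG2, hmean, fun m hm => ?_⟩
  obtain ⟨x, hx⟩ := exists_tail_eLpNorm_le hε (hεs m hm) (hind m hm) hG m
  replace hx := hx.trans (hrate m hm)
  set G₁ : (ℕ → S) → E := fun s => G (spliceAt x m s) with hG₁
  have hG₁m : StronglyMeasurable G₁ := hG.comp_measurable (measurable_spliceAt x m)
  have hd1 : MemLp (fun ω => G (past ε 0 ω) - G₁ (past ε 0 ω)) 2 P :=
    ⟨((hε.stronglyMeasurable_past hG 0).sub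
      (hε.stronglyMeasurable_past hG₁m 0)).aestronglyMeasurable,
      hx.trans_lt ENNReal.ofReal_lt_top⟩
  have hG₁2 : MemLp (fun ω => G₁ (past ε 0 ω)) 2 P := by
    have := hG2.sub hd1
    refine this.congr_norm (hε.stronglyMeasurable_past hG₁m 0).aestronglyMeasurable
      (Eventually.of_forall fun ω => ?_)
    simp
  -- The level `K` makes the truncation error at most `a m`. Fixing the tail costs another `a m`,
  -- and centering costs at most their sum again, hence `4 * a m`.
  obtain ⟨K, hK0, hK⟩ := hG₁2.eLpNorm_indicator_norm_ge_pos_le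
    (hε.stronglyMeasurable_past hG₁m 0) (ha m)
  set H : (ℕ → S) → E := {s | ‖G s‖ < K}.indicator G with hH
  have hHm : StronglyMeasurable H :=
    hG.indicator (measurableSet_lt hG.norm.measurable measurable_const)
  set G₂ : (ℕ → S) → E := fun s => H (spliceAt x m s) with hG₂
  have hG₂m : StronglyMeasurable G₂ := hHm.comp_measurable (measurable_spliceAt x m)
  have hHb : ∀ s, ‖H s‖ ≤ K := fun s => by
    by_cases hs : ‖G s‖ < K
    · simp [hH, hs, hs.le]
    · simp [hH, hs, hK0.le]
  have hG₂2 : MemLp (fun ω => G₂ (past ε 0 ω)) 2 P :=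
    MemLp.of_bound (hε.stronglyMeasurable_past hG₂m 0).aestronglyMeasurable K
      (Eventually.of_forall fun _ => hHb _)
  have hd2 : (fun ω => G₁ (past ε 0 ω) - G₂ (past ε 0 ω)) =
      {ω | K ≤ ‖G₁ (past ε 0 ω)‖₊}.indicator (fun ω => G₁ (past ε 0 ω)) := by
    funext ω
    by_cases hs : ‖G (spliceAt x m (past ε 0 ω))‖ < K
    · simp [hG₁, hG₂, hH, Set.indicator, hs, not_le.2 hs]
    · simp [hG₁, hG₂, hH, Set.indicator, hs, not_lt.1 hs]
  rw [← hd2] at hK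
  have hn1 : nrm P (fun ω => G (past ε 0 ω) - G₁ (past ε 0 ω)) ≤ a m :=
    ENNReal.toReal_le_of_le_ofReal (ha m).le hx
  have hn2 : nrm P (fun ω => G₁ (past ε 0 ω) - G₂ (past ε 0 ω)) ≤ a m :=
    ENNReal.toReal_le_of_le_ofReal (ha m).le hK
  have hn3 : nrm P (fun ω => G (past ε 0 ω) - G₂ (past ε 0 ω)) ≤ 2 * a m := by
    have h := nrm_add_le hd1 (hG₁2.sub hG₂2)
    have h2 : (fun ω => G (past ε 0 ω) - G₁ (past ε 0 ω) +
        ((fun ω => G₁ (past ε 0 ω)) - fun ω => G₂ (past ε 0 ω)) ω) =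
        fun ω => G (past ε 0 ω) - G₂ (past ε 0 ω) := by ext ω; simp
    rw [h2] at h
    have h3 : nrm P ((fun ω => G₁ (past ε 0 ω)) - fun ω => G₂ (past ε 0 ω)) ≤ a m := hn2
    linarith
  set e : E := ∫ ω, G₂ (past ε 0 ω) ∂P with he
  have hen : ‖e‖ ≤ 2 * a m := by
    have h := norm_integral_le_nrm (hG2.sub hG₂2)
    have h2 : ∫ ω, ((fun ω => G (past ε 0 ω)) - fun ω => G₂ (past ε 0 ω)) ω ∂P = -e := by
      have := integral_sub (hG2.integrable (by norm_num)) (hG₂2.integrable (by norm_num))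
      rw [hmean, zero_sub] at this
      exact this
    rw [h2, norm_neg] at h
    exact h.trans hn3
  refine ⟨fun s => G₂ s - e, ⟨hG₂m.sub stronglyMeasurable_const, fun i => ?_,
    ⟨K + ‖e‖, fun s => (norm_sub_le _ _).trans (add_le_add (hHb _) le_rfl)⟩, ?_⟩, ?_⟩
  · exact (hHm.comp_measurable (measurable_spliceAt_past x m i)).sub stronglyMeasurable_const
  -- Without completeness the Bochner integral is 0 by convention.
  · by_cases hE : CompleteSpace E
    · rw [integral_sub (hG₂2.integrable (by norm_num)) (integrable_const _)]
      simp [he]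
    · simp [integral, hE]
  · have h := nrm_add_le (hG2.sub hG₂2) (memLp_const (μ := P) (p := 2) e)
    rw [nrm_const] at h
    have h2 : (fun ω => ((fun ω => G (past ε 0 ω)) - fun ω => G₂ (past ε 0 ω)) ω + e) =
        fun ω => G (past ε 0 ω) - (G₂ (past ε 0 ω) - e) := by
      ext ω; simp only [Pi.sub_apply]; abel
    rw [h2] at h
    have h3 : nrm P ((fun ω => G (past ε 0 ω)) - fun ω => G₂ (past ε 0 ω)) ≤ 2 * a m := hn3
    linarith

end Coupling

/-! ### Symmetric finite rank kernels. -/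

section GoodKernels

variable {Z : Type*} [MeasureSpace Z] [IsFiniteMeasure (volume : Measure Z)]

/-- The kernels of compact symmetric integral operators form a subspace. -/
def goodSubmodule (Z : Type*) [MeasureSpace Z] [IsFiniteMeasure (volume : Measure Z)] :
    Submodule ℝ (L2 (Z × Z)) where
  carrier := goodKernels Z
  zero_mem' := by
    have h : opK (0 : L2 (Z × Z)) = 0 := by simpa using opK_smul 0 (0 : L2 (Z × Z))
    refine ⟨?_, fun f g => by simp⟩
    rw [h]; exact isCompactOperator_zero
  add_mem' := fun {k k'} hk hk' => by
    refine ⟨?_, fun f g => by rw [inner_add_left, inner_add_left, hk.2, hk'.2]⟩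
    rw [opK_add]; exact hk.1.add hk'.1
  smul_mem' := fun c k hk => by
    refine ⟨?_, fun f g => by rw [inner_smul_left, inner_smul_left, hk.2]⟩
    rw [opK_smul]; exact hk.1.smul c

theorem ten_self_mem (a : L2 Z) : ten a a ∈ goodSubmodule Z :=
  ⟨isCompactOperator_opK_ten a a, fun f g => by rw [inner_ten, inner_ten, mul_comm]⟩

theorem ten_add_flip_mem (a b : L2 Z) : ten a b + ten b a ∈ goodSubmodule Z := by
  refine ⟨?_, fun f g => ?_⟩
  · rw [opK_add]
    exact (isCompactOperator_opK_ten a b).add (isCompactOperator_opK_ten b a)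
  · rw [inner_add_left, inner_add_left, inner_ten, inner_ten, inner_ten, inner_ten]
    ring

end GoodKernels

/-! ### Pointwise representatives of elements of `L2`. -/

section Representatives

variable {Z : Type*} [MeasureSpace Z]

theorem ae_add {f f' : Z → ℝ} {k k' : L2 Z} (h : f =ᵐ[volume] k) (h' : f' =ᵐ[volume] k') :
    (fun z => f z + f' z) =ᵐ[volume] (k + k' : L2 Z) :=
  (h.add h').trans (Lp.coeFn_add k k').symm

theorem ae_sub {f f' : Z → ℝ} {k k' : L2 Z} (h : f =ᵐ[volume] k) (h' : f' =ᵐ[volume] k') :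
    (fun z => f z - f' z) =ᵐ[volume] (k - k' : L2 Z) :=
  (h.sub h').trans (Lp.coeFn_sub k k').symm

theorem ae_const_mul {f : Z → ℝ} {k : L2 Z} (c : ℝ) (h : f =ᵐ[volume] k) :
    (fun z => c * f z) =ᵐ[volume] (c • k : L2 Z) := by
  filter_upwards [h, Lp.coeFn_smul c k] with z h1 h2
  rw [h2, h1]; rfl

theorem ae_sum {ι : Type*} (s : Finset ι) {f : ι → Z → ℝ} {k : ι → L2 Z}
    (h : ∀ i ∈ s, f i =ᵐ[volume] k i) :
    (fun z => ∑ i ∈ s, f i z) =ᵐ[volume] (∑ i ∈ s, k i : L2 Z) := by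
  classical
  induction s using Finset.induction_on with
  | empty =>
    simp only [Finset.sum_empty]
    exact (Lp.coeFn_zero ℝ 2 volume).symm
  | insert i s hi ih =>
    simp only [Finset.sum_insert hi]
    exact ae_add (h i (Finset.mem_insert_self i s))
      (ih fun j hj => h j (Finset.mem_insert_of_mem hj))

theorem ae_tsum {ι : Type*} [Countable ι] {f : ι → Z → ℝ} {k : ι → L2 Z}
    (h : ∀ i, f i =ᵐ[volume] k i) (hk : Summable fun i => ‖k i‖) :
    (fun z => ∑' i, f i z) =ᵐ[volume] (∑' i, k i : L2 Z) := by
  have hk' : ∑' i, ‖k i‖ₑ ≠ ⊤ := by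
    simpa only [ofReal_norm] using hk.tsum_ofReal_ne_top
  filter_upwards [ae_all_iff.2 h, Lp.coeFn_tsum hk'] with z h1 h2
  rw [h2]
  exact tsum_congr h1

variable {Ω : Type*} [MeasurableSpace Ω] {P : Measure Ω} [IsProbabilityMeasure P]

/-- The pointwise mean of a jointly measurable process represents the mean of the process as a
random element of `L²`. -/
theorem integral_ae_eq [IsProbabilityMeasure (volume : Measure Z)] {F : Ω → Z → ℝ}
    (hF : Measurable (fun q : Ω × Z => F q.1 q.2)) {Φ : Ω → L2 Z} (hΦ : Integrable Φ P)
    (h : ∀ᵐ ω ∂P, F ω =ᵐ[volume] Φ ω) :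
    (fun z => ∫ ω, F ω z ∂P) =ᵐ[volume] (∫ ω, Φ ω ∂P : L2 Z) := by
  have hint : Integrable (fun q : Ω × Z => F q.1 q.2) (P.prod volume) := by
    rw [integrable_prod_iff hF.aestronglyMeasurable]
    refine ⟨?_, ?_⟩
    · filter_upwards [h] with ω hω
      exact (integrable_L2 (Φ ω)).congr hω.symm
    · refine hΦ.norm.mono' hF.norm.stronglyMeasurable.integral_prod_right'.aestronglyMeasurable ?_
      filter_upwards [h] with ω hω
      rw [Real.norm_of_nonneg (integral_nonneg fun _ => norm_nonneg _)]
      calc ∫ z, ‖F ω z‖ = ∫ z, ‖Φ ω z‖ := integral_congr_ae (hω.fun_comp norm)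
        _ ≤ nrm volume (Φ ω) := integral_norm_le_nrm (Lp.memLp (Φ ω))
        _ = ‖Φ ω‖ := (Lp.norm_def _).symm
  -- Integrals over a set are inner products with its indicator, which commute with the Bochner
  -- integral; Fubini treats the pointwise side.
  refine ae_eq_of_setIntegral_eq hint.integral_prod_right (integrable_L2 _) fun s hs => ?_
  rw [← inner_indicator_eq _ hs, real_inner_comm, ← integral_inner hΦ]
  have hres : Integrable (fun q : Ω × Z => F q.1 q.2) (P.prod (volume.restrict s)) := by
    have := hint.restrict (s := Set.univ ×ˢ s)
    rwa [← Measure.prod_restrict, Measure.restrict_univ] at this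
  rw [← integral_integral_swap hres]
  refine integral_congr_ae ?_
  filter_upwards [h] with ω hω
  rw [real_inner_comm, inner_indicator_eq _ hs]
  exact integral_congr_ae (ae_restrict_of_ae hω)

end Representatives

/-! ### Sums over integer lags and times. -/

section IntegerSums

/-- Splitting a sum over the integers into nonnegative and negative lags. -/
theorem tsum_int_eq {V : Type*} [NormedAddCommGroup V] [CompleteSpace V] {f : ℤ → V}
    (hf : Summable f) :
    ∑' ℓ : ℤ, f ℓ = ∑' n : ℕ, f n + ∑' n : ℕ, if n = 0 then 0 else f (-n) := by
  have h1 : Summable fun n : ℕ => f n := hf.comp_injective Nat.cast_injective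
  have h2 : Summable fun n : ℕ => f (-(n + 1 : ℤ)) := hf.comp_injective fun a b h => by
    have h' : -((a : ℤ) + 1) = -((b : ℤ) + 1) := h
    omega
  rw [tsum_of_nat_of_neg_add_one h1 h2]
  congr 1
  have h3 : Summable fun n : ℕ => if n = 0 then 0 else f (-n) := by
    refine (summable_nat_add_iff 1).1 ?_
    simpa using h2
  rw [h3.tsum_eq_zero_add]
  simp

theorem sum_Icc_int {V : Type*} [AddCommMonoid V] (f : ℤ → V) (m n : ℕ) :
    ∑ j ∈ Finset.Icc (1 + (m : ℤ)) n, f j = ∑ j ∈ Finset.range (n - m), f ((j : ℤ) + 1 + m) := by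
  refine Finset.sum_bij' (fun j _ => (j - 1 - m).toNat) (fun j _ => (j : ℤ) + 1 + m) ?_ ?_ ?_ ?_ ?_
  · intro j hj
    rw [Finset.mem_Icc] at hj
    rw [Finset.mem_range]; omega
  · intro j hj
    rw [Finset.mem_range] at hj
    rw [Finset.mem_Icc]; omega
  · intro j hj
    rw [Finset.mem_Icc] at hj
    omega
  · intro j _
    omega
  · intro j hj
    rw [Finset.mem_Icc] at hj
    congr 1; omega

theorem sum_Icc_one {V : Type*} [AddCommMonoid V] (f : ℤ → V) (n : ℕ) :
    ∑ j ∈ Finset.Icc (1 : ℤ) n, f j = ∑ j ∈ Finset.range n, f ((j : ℤ) + 1) := by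
  have h := sum_Icc_int f 0 n
  simpa using h

end IntegerSums

/-! ### Polynomial rates. -/

/-- A polynomial rate. -/
noncomputable def polyRate (C κ : ℝ) (n : ℕ) : ℝ := C * ((n : ℝ) + 1) ^ (-κ)

theorem polyRate_pos {C κ : ℝ} (hC : 0 < C) (n : ℕ) : 0 < polyRate C κ n := by
  unfold polyRate; positivity

theorem polyRate_le {C κ : ℝ} (hC : 0 < C) (hκ : 0 < κ) (n : ℕ) : polyRate C κ n ≤ C := by
  have h : ((n : ℝ) + 1) ^ (-κ) ≤ 1 :=
    Real.rpow_le_one_of_one_le_of_nonpos (by linarith [n.cast_nonneg (α := ℝ)]) (by linarith)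
  unfold polyRate; nlinarith

theorem summable_polyRate {κ : ℝ} (C : ℝ) (hκ : 1 < κ) : Summable (polyRate C κ) := by
  refine Summable.mul_left C ?_
  have h := (summable_nat_add_iff (f := fun n : ℕ => (n : ℝ) ^ (-κ)) 1).2
    (Real.summable_nat_rpow.2 (by linarith))
  simpa using h

/-- The shift by one in `polyRate` keeps it positive and decreasing from `n = 0` on. Halving the
index costs a factor `2 ^ κ`, because `n + 1 ≤ 2 (n / 2 + 1)` also with rounding down. -/
theorem isRate_polyRate {C κ : ℝ} (hC : 0 < C) (hκ : 1 < κ) : IsRate (polyRate C κ) where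
  pos := polyRate_pos hC
  anti := fun m n h => by
    have h' : (m : ℝ) ≤ n := by exact_mod_cast h
    exact mul_le_mul_of_nonneg_left (Real.rpow_le_rpow_of_nonpos (by positivity) (by linarith)
      (by linarith)) hC.le
  summable := summable_polyRate C hκ
  summable_half := by
    refine Summable.of_nonneg_of_le (fun n => (polyRate_pos hC _).le) (fun n => ?_)
      ((summable_polyRate C hκ).mul_left (2 ^ κ))
    have h1 : ((n : ℝ) + 1) / 2 ≤ ((n / 2 : ℕ) : ℝ) + 1 := by
      have : n + 1 ≤ 2 * (n / 2 + 1) := by omega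
      have : (n : ℝ) + 1 ≤ 2 * (((n / 2 : ℕ) : ℝ) + 1) := by exact_mod_cast this
      linarith
    have h2 := Real.rpow_le_rpow_of_nonpos (z := -κ) (by positivity) h1 (by linarith)
    rw [Real.div_rpow (by positivity) (by norm_num), Real.rpow_neg (by norm_num : (0 : ℝ) ≤ 2),
      div_inv_eq_mul] at h2
    calc C * (((n / 2 : ℕ) : ℝ) + 1) ^ (-κ) ≤ C * (((n : ℝ) + 1) ^ (-κ) * 2 ^ κ) :=
          mul_le_mul_of_nonneg_left h2 hC.le
      _ = 2 ^ κ * polyRate C κ n := by unfold polyRate; ring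

/-! ### Functions of the past with polynomial coupling rates. -/

section Coupling

variable {Ω S E F : Type*} [MeasurableSpace Ω] [MeasurableSpace S] {P : Measure Ω}
  [IsProbabilityMeasure P] {ε : ℤ → Ω → S} {εs : ℕ → ℤ → Ω → S} [NormedAddCommGroup E]

/-- A function of the past with a finite moment of order `q` whose coupled versions converge at a
polynomial rate. -/
structure IsCoupled (P : Measure Ω) (ε : ℤ → Ω → S) (εs : ℕ → ℤ → Ω → S) (q : ENNReal)
    (G : (ℕ → S) → E) (C κ : ℝ) : Prop where
  sm : StronglyMeasurable G
  memLp : MemLp (fun ω => G (past ε 0 ω)) q P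
  pos : 0 < C
  rate : ∀ m : ℕ, 1 ≤ m →
    eLpNorm (fun ω => G (past ε 0 ω) - G (coupledPast ε (εs m) m 0 ω)) q P ≤
      ENNReal.ofReal (polyRate C κ m)

theorem measurable_coupledPast {ε ε' : ℤ → Ω → S} (hε : ∀ i, Measurable (ε i))
    (hε' : ∀ i, Measurable (ε' i)) (m : ℕ) (i : ℤ) : Measurable (coupledPast ε ε' m i) := by
  refine measurable_pi_iff.2 fun k => ?_
  by_cases hk : k < m
  · simpa [coupledPast, hk] using hε _
  · simpa [coupledPast, hk] using hε' _

theorem exists_isCoupled (hε : ∀ i, Measurable (ε i)) (hεs : ∀ m, 1 ≤ m → ∀ i, Measurable (εs m i))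
    {q q' : ENNReal} (hq : q ≤ q') {G : (ℕ → S) → E} (hG : StronglyMeasurable G)
    (hG2 : MemLp (fun ω => G (past ε 0 ω)) q' P) {C κ α : ℝ} (hκ : 0 < κ) (hα : κ ≤ α)
    (hrate : ∀ m : ℕ, 1 ≤ m →
      eLpNorm (fun ω => G (past ε 0 ω) - G (coupledPast ε (εs m) m 0 ω)) q' P ≤
        ENNReal.ofReal (C * (m : ℝ) ^ (-α))) :
    ∃ C' : ℝ, IsCoupled P ε εs q G C' κ := by
  -- The factor `2 ^ κ` pays for passing from `m` to `m + 1`, as `(m + 1) / 2 ≤ m`; `|C| + 1` makes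
  -- the constant positive.
  refine ⟨2 ^ κ * (|C| + 1), hG, hG2.mono_exponent hq, by positivity, fun m hm => ?_⟩
  have h1 : Measurable (past ε 0) := measurable_pi_iff.2 fun k => hε (0 - k)
  refine (eLpNorm_le_eLpNorm_of_exponent_le hq
    (((hG.comp_measurable h1).sub (hG.comp_measurable
      (measurable_coupledPast hε (hεs m hm) m 0))).aestronglyMeasurable)).trans
    ((hrate m hm).trans (ENNReal.ofReal_le_ofReal ?_))
  have hm1 : (1 : ℝ) ≤ m := by exact_mod_cast hm
  have h2 : (m : ℝ) ^ (-α) ≤ (m : ℝ) ^ (-κ) :=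
    Real.rpow_le_rpow_of_exponent_le hm1 (by linarith)
  have h3 := Real.rpow_le_rpow_of_nonpos (x := ((m : ℝ) + 1) / 2) (y := m) (z := -κ) (by positivity)
    (by linarith) (by linarith)
  rw [Real.div_rpow (by positivity) (by norm_num), Real.rpow_neg (by norm_num : (0 : ℝ) ≤ 2),
    div_inv_eq_mul] at h3
  calc C * (m : ℝ) ^ (-α) ≤ (|C| + 1) * (((m : ℝ) + 1) ^ (-κ) * 2 ^ κ) :=
        mul_le_mul (by linarith [le_abs_self C]) (h2.trans h3) (by positivity) (by positivity)
    _ = polyRate (2 ^ κ * (|C| + 1)) κ m := by unfold polyRate; ring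

theorem IsCoupled.sub_const {q : ENNReal} {G : (ℕ → S) → E} {C κ : ℝ}
    (h : IsCoupled P ε εs q G C κ) (c : E) : IsCoupled P ε εs q (fun s => G s - c) C κ :=
  ⟨h.sm.sub stronglyMeasurable_const, h.memLp.sub (memLp_const c), h.pos, by
    simpa only [sub_sub_sub_cancel_right] using h.rate⟩

theorem IsCoupled.isApprox [InnerProductSpace ℝ E] [CompleteSpace E] (hε : IsInnovation P ε)
    (hεs : ∀ m, 1 ≤ m → ∀ i, Measurable (εs m i))
    (hind : ∀ m, 1 ≤ m → IndepFun (fun ω i => ε i ω) (fun ω i => εs m i ω) P) {q : ENNReal}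
    (hq : 2 ≤ q) {G : (ℕ → S) → E} {C κ : ℝ} (h : IsCoupled P ε εs q G C κ)
    (hmean : ∫ ω, G (past ε 0 ω) ∂P = 0) : IsApprox P ε G (polyRate (4 * C) κ) := by
  have h4 : polyRate (4 * C) κ = fun m => 4 * polyRate C κ m := by
    funext m; simp only [polyRate]; ring
  rw [h4]
  refine isApprox_of_coupling hε hεs hind h.sm (h.memLp.mono_exponent hq) hmean
    (polyRate_pos h.pos) fun m hm => (eLpNorm_le_eLpNorm_of_exponent_le hq ?_).trans (h.rate m hm)
  exact ((h.sm.comp_measurable (hε.measurable_past 0)).sub (h.sm.comp_measurable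
    (measurable_coupledPast hε.measurable (hεs m hm) m 0))).aestronglyMeasurable

instance holderTriple_four : ENNReal.HolderTriple 4 4 2 where
  inv_add_inv_eq_inv := by
    rw [← two_mul, show (4 : ENNReal) = 2 * 2 by norm_num,
      ENNReal.mul_inv (by simp) (by simp), ← mul_assoc,
      ENNReal.mul_inv_cancel (by simp) (by simp), one_mul]

end Coupling

/-! ### Coupling rates of tensor products. -/

section Tensor

variable {Ω S E F : Type*} [MeasurableSpace Ω] [MeasurableSpace S] {P : Measure Ω}
  [IsProbabilityMeasure P] {ε : ℤ → Ω → S} {εs : ℕ → ℤ → Ω → S} [NormedAddCommGroup E]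
  [InnerProductSpace ℝ E] [NormedAddCommGroup F] [InnerProductSpace ℝ F]

theorem IsTensor.eLpNorm_le {B : E →L[ℝ] E →L[ℝ] F} (hB : IsTensor B) {U V : Ω → E}
    (hU : AEStronglyMeasurable U P) (hV : AEStronglyMeasurable V P) :
    eLpNorm (fun ω => B (U ω) (V ω)) 2 P ≤ eLpNorm U 4 P * eLpNorm V 4 P := by
  have h := eLpNorm_le_eLpNorm_mul_eLpNorm'_of_norm (r := 2) (p := 4) (q := 4) hU hV
    (fun x y => B x y) 1 (Eventually.of_forall fun ω => by simp [hB.norm_eq])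
  simpa using h

/-- Product rule with Hölder's inequality `1/4 + 1/4 = 1/2`: two factors coupled in `L⁴` give a
product coupled in `L²` at the same rate. In the constant, `a + C` bounds the `L⁴` norm of the
coupled version of `G`. -/
theorem IsCoupled.tensor (hε : ∀ i, Measurable (ε i))
    (hεs : ∀ m, 1 ≤ m → ∀ i, Measurable (εs m i)) {G H : (ℕ → S) → E} {C C' κ : ℝ} (hκ : 0 < κ)
    (hG : IsCoupled P ε εs 4 G C κ) (hH : IsCoupled P ε εs 4 H C' κ) {B : E →L[ℝ] E →L[ℝ] F}
    (hB : IsTensor B) : ∃ C'' : ℝ, IsCoupled P ε εs 2 (fun s => B (G s) (H s)) C'' κ := by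
  have hp : Measurable (past ε 0) := measurable_pi_iff.2 fun k => hε (0 - k)
  have hGp := (hG.sm.comp_measurable hp).aestronglyMeasurable (μ := P)
  have hHp := (hH.sm.comp_measurable hp).aestronglyMeasurable (μ := P)
  have hsm : StronglyMeasurable fun s => B (G s) (H s) := stronglyMeasurable_bilin B hG.sm hH.sm
  set a := (eLpNorm (fun ω => G (past ε 0 ω)) 4 P).toReal with ha
  set b := (eLpNorm (fun ω => H (past ε 0 ω)) 4 P).toReal with hb
  have ha' : eLpNorm (fun ω => G (past ε 0 ω)) 4 P = ENNReal.ofReal a :=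
    (ENNReal.ofReal_toReal hG.memLp.2.ne).symm
  have hb' : eLpNorm (fun ω => H (past ε 0 ω)) 4 P = ENNReal.ofReal b :=
    (ENNReal.ofReal_toReal hH.memLp.2.ne).symm
  have ha0 : 0 ≤ a := ENNReal.toReal_nonneg
  have hb0 : 0 ≤ b := ENNReal.toReal_nonneg
  have hC := hG.pos
  have hC' := hH.pos
  refine ⟨C * b + (a + C) * C', hsm, ⟨(hsm.comp_measurable hp).aestronglyMeasurable, ?_⟩,
    by positivity, fun m hm => ?_⟩
  · refine (hB.eLpNorm_le hGp hHp).trans_lt ?_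
    exact ENNReal.mul_lt_top hG.memLp.2 hH.memLp.2
  · have hc := measurable_coupledPast hε (hεs m hm) m 0
    have hGc := (hG.sm.comp_measurable hc).aestronglyMeasurable (μ := P)
    have hHc := (hH.sm.comp_measurable hc).aestronglyMeasurable (μ := P)
    have hρ := polyRate_pos (κ := κ) hG.pos m
    have hρ' := polyRate_pos (κ := κ) hH.pos m
    have hGc' : eLpNorm (fun ω => G (coupledPast ε (εs m) m 0 ω)) 4 P ≤ ENNReal.ofReal (a + C) := by
      have h1 := eLpNorm_sub_le (p := 4) hGp (hGp.sub hGc) (by norm_num)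
      have h2 : ((G ∘ past ε 0) - ((G ∘ past ε 0) - (G ∘ coupledPast ε (εs m) m 0))) =
        fun ω => G (coupledPast ε (εs m) m 0 ω) := by funext ω; simp
      have h1' : eLpNorm (fun ω => G (coupledPast ε (εs m) m 0 ω)) 4 P ≤ _ := h2 ▸ h1
      refine h1'.trans ?_
      rw [ENNReal.ofReal_add ha0 hC.le]
      exact add_le_add ha'.le ((hG.rate m hm).trans
        (ENNReal.ofReal_le_ofReal (polyRate_le hG.pos hκ m)))
    have hsplit : (fun ω => B (G (past ε 0 ω)) (H (past ε 0 ω)) -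
        B (G (coupledPast ε (εs m) m 0 ω)) (H (coupledPast ε (εs m) m 0 ω))) =
        (fun ω => B (G (past ε 0 ω) - G (coupledPast ε (εs m) m 0 ω)) (H (past ε 0 ω))) +
        (fun ω => B (G (coupledPast ε (εs m) m 0 ω))
          (H (past ε 0 ω) - H (coupledPast ε (εs m) m 0 ω))) := by
      funext ω
      simp only [Pi.add_apply, map_sub, sub_apply]
      abel
    have m1 : AEStronglyMeasurable (fun ω => B (G (past ε 0 ω) - G (coupledPast ε (εs m) m 0 ω))
        (H (past ε 0 ω))) P :=
      (stronglyMeasurable_bilin B ((hG.sm.comp_measurable hp).sub (hG.sm.comp_measurable hc))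
        (hH.sm.comp_measurable hp)).aestronglyMeasurable
    have m2 : AEStronglyMeasurable (fun ω => B (G (coupledPast ε (εs m) m 0 ω))
        (H (past ε 0 ω) - H (coupledPast ε (εs m) m 0 ω))) P :=
      (stronglyMeasurable_bilin B (hG.sm.comp_measurable hc) ((hH.sm.comp_measurable hp).sub
        (hH.sm.comp_measurable hc))).aestronglyMeasurable
    rw [hsplit]
    refine (eLpNorm_add_le m1 m2 (by norm_num)).trans ((add_le_add
      ((hB.eLpNorm_le (hGp.sub hGc) hHp).trans (mul_le_mul' (hG.rate m hm) hb'.le))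
      ((hB.eLpNorm_le hGc (hHp.sub hHc)).trans (mul_le_mul' hGc' (hH.rate m hm)))).trans_eq ?_)
    rw [← ENNReal.ofReal_mul hρ.le, ← ENNReal.ofReal_mul (by positivity),
      ← ENNReal.ofReal_add (by positivity) (by positivity)]
    congr 1
    simp only [polyRate]; ring

end Tensor

/-! ### The estimator as an algebraic function of a sequence, and its stability. -/

section Estimator

variable {E F : Type*} [NormedAddCommGroup E] [InnerProductSpace ℝ E] [NormedAddCommGroup F]
  [InnerProductSpace ℝ F]

/-- The lag `ℓ` sample autocovariance of a sequence. -/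
noncomputable def lagKer (B : E →L[ℝ] E →L[ℝ] F) (z : ℕ → E) (T ℓ : ℕ) : F :=
  (T : ℝ)⁻¹ • ∑ j ∈ Finset.range (T - ℓ), B (z j) (z (j + ℓ))

/-- The weighted sum of the sample autocovariances of a sequence over nonnegative lags. -/
noncomputable def estKer (B : E →L[ℝ] E →L[ℝ] F) (w : ℕ → ℝ) (z : ℕ → E) (T : ℕ) : F :=
  ∑ ℓ ∈ Finset.range T, w ℓ • lagKer B z T ℓ

/-- The weights of the negative lags. -/
noncomputable def posPart (w : ℕ → ℝ) (ℓ : ℕ) : ℝ := if ℓ = 0 then 0 else w ℓ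

/-- The weighted sum of the sample autocovariances of a sequence over all lags. -/
noncomputable def estTot (B : E →L[ℝ] E →L[ℝ] F) (w : ℕ → ℝ) (z : ℕ → E) (T : ℕ) : F :=
  estKer B w z T + estKer B.flip (posPart w) z T

theorem IsTensor.flip {B : E →L[ℝ] E →L[ℝ] F} (hB : IsTensor B) : IsTensor B.flip :=
  fun f g f' g' => by
    simp only [ContinuousLinearMap.flip_apply]
    rw [hB, mul_comm]

theorem abs_posPart_le {w : ℕ → ℝ} {M : ℝ} (hw : ∀ ℓ, |w ℓ| ≤ M) (ℓ : ℕ) : |posPart w ℓ| ≤ M := by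
  unfold posPart
  split_ifs
  · rw [abs_zero]; exact (abs_nonneg _).trans (hw 0)
  · exact hw ℓ

theorem posPart_eq_zero {w : ℕ → ℝ} {ℓ : ℕ} (h : w ℓ = 0) : posPart w ℓ = 0 := by
  simp [posPart, h]

theorem sum_range_shift_le {s : ℕ → ℝ} (hs : ∀ j, 0 ≤ s j) (T ℓ : ℕ) :
    ∑ j ∈ Finset.range (T - ℓ), s (j + ℓ) ≤ ∑ j ∈ Finset.range T, s j := by
  rcases le_total ℓ T with h | h
  · obtain ⟨n, rfl⟩ := Nat.exists_eq_add_of_le h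
    rw [Nat.add_sub_cancel_left, Finset.sum_range_add]
    simp_rw [add_comm ℓ]
    linarith [Finset.sum_nonneg fun j (_ : j ∈ Finset.range ℓ) => hs j]
  · rw [Nat.sub_eq_zero_of_le h, Finset.sum_range_zero]
    exact Finset.sum_nonneg fun j _ => hs j

/-- The perturbation is kept linear in `e`: one factor of the quadratic term is absorbed by `e ≤ 1`.
Splitting into squares prepares for averaging over time. -/
theorem IsTensor.norm_sub_le {B : E →L[ℝ] E →L[ℝ] F} (hB : IsTensor B) {x y x' y' : E}
    {e v u : ℝ} (he0 : 0 ≤ e) (he : e ≤ 1) (hv : 0 ≤ v) (hu : 0 ≤ u) (hx : ‖x' - x‖ ≤ e * v)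
    (hy : ‖y' - y‖ ≤ e * u) :
    ‖B x' y' - B x y‖ ≤ e * ((2 * v ^ 2 + ‖x‖ ^ 2) / 2 + (2 * u ^ 2 + ‖y‖ ^ 2) / 2) := by
  have h1 : B x' y' - B x y = B (x' - x) y + B x (y' - y) + B (x' - x) (y' - y) := by
    simp only [map_sub, sub_apply]; abel
  have h2 : ‖B x' y' - B x y‖ ≤ ‖x' - x‖ * ‖y‖ + ‖x‖ * ‖y' - y‖ + ‖x' - x‖ * ‖y' - y‖ := by
    rw [h1, ← hB.norm_eq, ← hB.norm_eq, ← hB.norm_eq]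
    exact norm_add₃_le
  have h3 : ‖x' - x‖ * ‖y‖ ≤ e * v * ‖y‖ := by gcongr
  have h4 : ‖x‖ * ‖y' - y‖ ≤ ‖x‖ * (e * u) := by gcongr
  have h5 : ‖x' - x‖ * ‖y' - y‖ ≤ (e * v) * (1 * u) :=
    mul_le_mul hx (hy.trans (by gcongr)) (norm_nonneg _) (by positivity)
  have h6 : v * ‖y‖ + ‖x‖ * u + v * u ≤
      (2 * v ^ 2 + ‖x‖ ^ 2) / 2 + (2 * u ^ 2 + ‖y‖ ^ 2) / 2 := by
    nlinarith [sq_nonneg (v - ‖y‖), sq_nonneg (‖x‖ - u), sq_nonneg (v - u)]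
  calc _ ≤ e * (v * ‖y‖ + ‖x‖ * u + v * u) := by linarith
    _ ≤ _ := mul_le_mul_of_nonneg_left h6 he0

/-- The mean energy of a sequence and of the relative size of its perturbation. -/
noncomputable def meanEnergy (v : ℕ → ℝ) (z : ℕ → E) (T : ℕ) : ℝ :=
  (T : ℝ)⁻¹ * ∑ j ∈ Finset.range T, (2 * v j ^ 2 + ‖z j‖ ^ 2)

theorem meanEnergy_nonneg (v : ℕ → ℝ) (z : ℕ → E) (T : ℕ) : 0 ≤ meanEnergy v z T :=
  mul_nonneg (by positivity) (Finset.sum_nonneg fun _ _ => by positivity)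

/-- The energies at `j` and at `j + ℓ` both average to at most `meanEnergy`, so the bound does not
depend on the lag. -/
theorem norm_lagKer_sub_le {B : E →L[ℝ] E →L[ℝ] F} (hB : IsTensor B) {z z' : ℕ → E} {v : ℕ → ℝ}
    {e : ℝ} (he0 : 0 ≤ e) (he : e ≤ 1) (hv : ∀ j, 0 ≤ v j) (h : ∀ j, ‖z' j - z j‖ ≤ e * v j)
    (T ℓ : ℕ) : ‖lagKer B z' T ℓ - lagKer B z T ℓ‖ ≤ e * meanEnergy v z T := by
  set s : ℕ → ℝ := fun j => 2 * v j ^ 2 + ‖z j‖ ^ 2 with hs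
  have hs0 : ∀ j, 0 ≤ s j := fun j => by positivity
  have h1 : ∑ j ∈ Finset.range (T - ℓ), s j ≤ ∑ j ∈ Finset.range T, s j :=
    Finset.sum_le_sum_of_subset_of_nonneg (Finset.range_subset_range.2 (Nat.sub_le _ _))
      fun _ _ _ => hs0 _
  have h2 := sum_range_shift_le hs0 T ℓ
  have hT : (0 : ℝ) ≤ (T : ℝ)⁻¹ := by positivity
  rw [lagKer, lagKer, ← smul_sub, ← Finset.sum_sub_distrib, norm_smul, Real.norm_of_nonneg hT]
  calc (T : ℝ)⁻¹ * _ ≤ (T : ℝ)⁻¹ * ∑ j ∈ Finset.range (T - ℓ), e * (s j / 2 + s (j + ℓ) / 2) :=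
        mul_le_mul_of_nonneg_left ((norm_sum_le _ _).trans (Finset.sum_le_sum fun j _ =>
          hB.norm_sub_le he0 he (hv _) (hv _) (h _) (h _))) hT
    _ ≤ (T : ℝ)⁻¹ * (e * ∑ j ∈ Finset.range T, s j) := by
        refine mul_le_mul_of_nonneg_left ?_ hT
        rw [← Finset.mul_sum, Finset.sum_add_distrib, ← Finset.sum_div, ← Finset.sum_div]
        exact mul_le_mul_of_nonneg_left (by linarith) he0
    _ = e * meanEnergy v z T := by rw [meanEnergy]; ring

/-- At most `|N| + 1` lags have nonzero weight. This is the factor that an `e` of order `1/√T` must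
beat. -/
theorem norm_estKer_sub_le {B : E →L[ℝ] E →L[ℝ] F} (hB : IsTensor B) {w : ℕ → ℝ} {M N : ℝ}
    (hw : ∀ ℓ, |w ℓ| ≤ M) (hN : ∀ ℓ : ℕ, N < ℓ → w ℓ = 0) {z z' : ℕ → E} {v : ℕ → ℝ}
    {e : ℝ} (he0 : 0 ≤ e) (he : e ≤ 1) (hv : ∀ j, 0 ≤ v j) (h : ∀ j, ‖z' j - z j‖ ≤ e * v j)
    (T : ℕ) :
    ‖estKer B w z' T - estKer B w z T‖ ≤ (|N| + 1) * (M * (e * meanEnergy v z T)) := by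
  have hM : 0 ≤ M := (abs_nonneg _).trans (hw 0)
  have hq := meanEnergy_nonneg v z T
  rw [estKer, estKer, ← Finset.sum_sub_distrib]
  refine (norm_sum_le _ _).trans ?_
  rw [← Finset.sum_filter_of_ne (p := fun ℓ => ℓ ≤ ⌊N⌋₊)]
  · calc _ ≤ ∑ ℓ ∈ Finset.range T with ℓ ≤ ⌊N⌋₊, M * (e * meanEnergy v z T) := by
          refine Finset.sum_le_sum fun ℓ _ => ?_
          rw [← smul_sub, norm_smul]
          exact mul_le_mul (hw ℓ) (norm_lagKer_sub_le hB he0 he hv h T ℓ) (norm_nonneg _) hM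
      _ ≤ _ := by
          rw [Finset.sum_const, nsmul_eq_mul]
          refine mul_le_mul_of_nonneg_right ?_ (by positivity)
          have h1 : (Finset.filter (fun ℓ => ℓ ≤ ⌊N⌋₊) (Finset.range T)).card ≤ ⌊N⌋₊ + 1 := by
            rw [← Finset.card_range (⌊N⌋₊ + 1)]
            refine Finset.card_le_card fun ℓ hℓ => ?_
            rw [Finset.mem_filter] at hℓ
            rw [Finset.mem_range]; omega
          have h2 : ((⌊N⌋₊ : ℕ) : ℝ) ≤ |N| := by
            rcases le_total 0 N with h0 | h0
            · exact (Nat.floor_le h0).trans (le_abs_self N)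
            · rw [Nat.floor_of_nonpos h0]; simp
          have h3 : ((Finset.filter (fun ℓ => ℓ ≤ ⌊N⌋₊) (Finset.range T)).card : ℝ) ≤
            ((⌊N⌋₊ + 1 : ℕ) : ℝ) := by exact_mod_cast h1
          push_cast at h3
          linarith
  · intro ℓ _ hne
    by_contra hlt
    refine hne ?_
    rw [hN ℓ (Nat.lt_of_floor_lt (not_le.1 hlt)), zero_smul, zero_smul, sub_zero, norm_zero]

theorem norm_estTot_sub_le {B : E →L[ℝ] E →L[ℝ] F} (hB : IsTensor B) {w : ℕ → ℝ} {M N : ℝ}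
    (hw : ∀ ℓ, |w ℓ| ≤ M) (hN : ∀ ℓ : ℕ, N < ℓ → w ℓ = 0) {z z' : ℕ → E} {v : ℕ → ℝ}
    {e : ℝ} (he0 : 0 ≤ e) (he : e ≤ 1) (hv : ∀ j, 0 ≤ v j) (h : ∀ j, ‖z' j - z j‖ ≤ e * v j)
    (T : ℕ) :
    ‖estTot B w z' T - estTot B w z T‖ ≤ 2 * (|N| + 1) * M * e * meanEnergy v z T := by
  have h1 := norm_estKer_sub_le hB hw hN he0 he hv h T
  have h2 := norm_estKer_sub_le hB.flip (abs_posPart_le hw)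
    (fun ℓ hℓ => posPart_eq_zero (hN ℓ hℓ)) he0 he hv h T
  rw [estTot, estTot, add_sub_add_comm]
  refine (norm_add_le _ _).trans ?_
  linarith

/-- The average of a sequence. -/
noncomputable def avg (z : ℕ → E) (T : ℕ) : E := (T : ℝ)⁻¹ • ∑ j ∈ Finset.range T, z j

/-- The empirically centered tensor products. -/
noncomputable def sampleTensor (B : E →L[ℝ] E →L[ℝ] F) (A A' : ℕ → E) (T j : ℕ) : F :=
  B (A j - avg A T) (A' j - avg A' T)

theorem avg_sub_const (A : ℕ → E) {T : ℕ} (hT : T ≠ 0) (c : E) :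
    avg (fun j => A j - c) T = avg A T - c := by
  have hT' : (T : ℝ) ≠ 0 := by exact_mod_cast hT
  rw [avg, avg, Finset.sum_sub_distrib, smul_sub, Finset.sum_const, Finset.card_range,
    ← Nat.cast_smul_eq_nsmul ℝ, smul_smul, inv_mul_cancel₀ hT', one_smul]

theorem sampleTensor_sub_const (B : E →L[ℝ] E →L[ℝ] F) (A A' : ℕ → E) {T : ℕ} (hT : T ≠ 0)
    (c c' : E) (j : ℕ) :
    sampleTensor B (fun j => A j - c) (fun j => A' j - c') T j = sampleTensor B A A' T j := by
  rw [sampleTensor, sampleTensor, avg_sub_const A hT, avg_sub_const A' hT, sub_sub_sub_cancel_right,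
    sub_sub_sub_cancel_right]

theorem avg_sampleTensor (B : E →L[ℝ] E →L[ℝ] F) (A A' : ℕ → E) {T : ℕ} (hT : T ≠ 0) :
    avg (sampleTensor B A A' T) T = avg (fun j => B (A j) (A' j)) T - B (avg A T) (avg A' T) := by
  have hT' : (T : ℝ) ≠ 0 := by exact_mod_cast hT
  have h1 : ∑ j ∈ Finset.range T, A j = (T : ℝ) • avg A T := by
    rw [avg, smul_smul, mul_inv_cancel₀ hT', one_smul]
  have h2 : ∑ j ∈ Finset.range T, A' j = (T : ℝ) • avg A' T := by
    rw [avg, smul_smul, mul_inv_cancel₀ hT', one_smul]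
  have h3 : ∑ j ∈ Finset.range T, sampleTensor B A A' T j =
      ∑ j ∈ Finset.range T, B (A j) (A' j) - (T : ℝ) • B (avg A T) (avg A' T) := by
    simp only [sampleTensor, map_sub, sub_apply, Finset.sum_sub_distrib]
    rw [← map_sum, h2, ← sum_apply, ← map_sum, h1, Finset.sum_const,
      Finset.card_range, ← Nat.cast_smul_eq_nsmul ℝ]
    simp only [map_smul, smul_apply]
    abel
  rw [avg, h3, smul_sub, smul_smul, inv_mul_cancel₀ hT', one_smul]
  rfl

/-- Replacing means by sample means perturbs the centered products by little. -/
theorem norm_sampleTensor_sub_le {B : E →L[ℝ] E →L[ℝ] F} (hB : IsTensor B) (A A' : ℕ → E)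
    {T : ℕ} (hT : T ≠ 0) (c : F) {e : ℝ}
    (he : e = ‖avg A T‖ + ‖avg A' T‖ + ‖avg (fun j => B (A j) (A' j) - c) T‖) (he1 : e ≤ 1) (j : ℕ) :
    ‖sampleTensor B A A' T j - avg (sampleTensor B A A' T) T - (B (A j) (A' j) - c)‖ ≤
      e * (3 + ‖A j‖ + ‖A' j‖) := by
  -- Every surviving term contains one of the three averages whose norms make up `e`.
  have hs : sampleTensor B A A' T j - avg (sampleTensor B A A' T) T - (B (A j) (A' j) - c) =
      (2 : ℝ) • B (avg A T) (avg A' T) - B (A j) (avg A' T) - B (avg A T) (A' j) -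
        avg (fun j => B (A j) (A' j) - c) T := by
    rw [avg_sampleTensor B A A' hT, avg_sub_const _ hT, sampleTensor]
    simp only [map_sub, sub_apply, two_smul]
    abel
  rw [hs]
  set a := ‖avg A T‖ with ha
  set b := ‖avg A' T‖ with hb
  set d := ‖avg (fun j => B (A j) (A' j) - c) T‖ with hd
  have h1 : ‖(2 : ℝ) • B (avg A T) (avg A' T) - B (A j) (avg A' T) - B (avg A T) (A' j) -
        avg (fun j => B (A j) (A' j) - c) T‖ ≤ 2 * (a * b) + ‖A j‖ * b + a * ‖A' j‖ + d := by
    refine (norm_sub_le _ _).trans (add_le_add_left ?_ _)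
    refine (norm_sub_le _ _).trans (add_le_add ?_ (hB.norm_eq _ _).le)
    refine (norm_sub_le _ _).trans (add_le_add ?_ (hB.norm_eq _ _).le)
    rw [norm_smul, hB.norm_eq, Real.norm_two]
  have a0 : 0 ≤ a := norm_nonneg _
  have b0 : 0 ≤ b := norm_nonneg _
  have d0 : 0 ≤ d := norm_nonneg _
  have hA := norm_nonneg (A j)
  have hA' := norm_nonneg (A' j)
  have hb1 : b ≤ 1 := by linarith
  rw [he]
  refine h1.trans ?_
  nlinarith [mul_nonneg a0 hA, mul_nonneg d0 hA, mul_nonneg b0 hA', mul_nonneg d0 hA',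
    mul_nonneg a0 (sub_nonneg.2 hb1)]

end Estimator

/-! ### Convergence in probability from convergence in mean. -/

section Probability

variable {Ω : Type*} [MeasurableSpace Ω] {P : Measure Ω} [IsProbabilityMeasure P]

theorem tendsto_measure_of_integral {s : ℕ → Ω → ℝ} (hs0 : ∀ T ω, 0 ≤ s T ω)
    (hs : ∀ T, Integrable (s T) P) (hlim : Tendsto (fun T => ∫ ω, s T ω ∂P) atTop (𝓝 0)) {η : ℝ}
    (hη : 0 < η) : Tendsto (fun T => P.real {ω | η ≤ s T ω}) atTop (𝓝 0) := by
  have h := hlim.div_const η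
  rw [zero_div] at h
  refine squeeze_zero (fun _ => measureReal_nonneg) (fun T => ?_) h
  rw [le_div_iff₀ hη, mul_comm]
  exact mul_meas_ge_le_integral_of_nonneg (Eventually.of_forall (hs0 T)) (hs T) η

/-- A random quantity that is dominated by the product of a vanishing and of a bounded quantity
plus a vanishing quantity converges to zero in probability. -/
theorem tendsto_measure_of_le_mul_add {u q s t : ℕ → Ω → ℝ} {Q : ℝ} (hu0 : ∀ T ω, 0 ≤ u T ω)
    (hq0 : ∀ T ω, 0 ≤ q T ω) (hs0 : ∀ T ω, 0 ≤ s T ω) (hu : ∀ T, Integrable (u T) P)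
    (hq : ∀ T, Integrable (q T) P) (hs : ∀ T, Integrable (s T) P)
    (hulim : Tendsto (fun T => ∫ ω, u T ω ∂P) atTop (𝓝 0)) (hqQ : ∀ T, ∫ ω, q T ω ∂P ≤ Q)
    (hslim : Tendsto (fun T => ∫ ω, s T ω ∂P) atTop (𝓝 0))
    (h : ∀ᶠ T in atTop, ∀ ω, u T ω ≤ 1 → t T ω ≤ u T ω * q T ω + s T ω) {η : ℝ} (hη : 0 < η) :
    Tendsto (fun T => P.real {ω | η ≤ t T ω}) atTop (𝓝 0) := by
  rw [Metric.tendsto_atTop']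
  intro τ hτ
  -- By Markov's inequality `q` exceeds `K` with probability at most `τ / 2`; off that event `u < δ`
  -- forces `u q ≤ η / 2`.
  set K := 2 * (|Q| + 1) / τ with hK
  have hK0 : 0 < K := by positivity
  set δ := min 1 (η / (2 * K)) with hδ
  have hδ0 : 0 < δ := lt_min one_pos (by positivity)
  have h1 := tendsto_measure_of_integral hu0 hu hulim hδ0
  have h2 := tendsto_measure_of_integral hs0 hs hslim (half_pos hη)
  have h3 := (h1.add h2).eventually_lt_const (show (0 : ℝ) + 0 < τ / 2 by linarith)
  obtain ⟨n, hn⟩ := eventually_atTop.1 (h3.and h)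
  refine ⟨n, fun T hT => ?_⟩
  obtain ⟨h4, h5⟩ := hn T hT.le
  rw [Real.dist_0_eq_abs, abs_of_nonneg measureReal_nonneg]
  have h6 : P.real {ω | K ≤ q T ω} ≤ τ / 2 := by
    have h7 := mul_meas_ge_le_integral_of_nonneg (Eventually.of_forall (hq0 T)) (hq T) K
    have h8 : K * P.real {ω | K ≤ q T ω} ≤ |Q| + 1 :=
      h7.trans ((hqQ T).trans ((le_abs_self Q).trans (by linarith)))
    have h9 : K * (τ / 2) = |Q| + 1 := by rw [hK]; field_simp
    exact le_of_mul_le_mul_left (h9 ▸ h8) hK0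
  have hsub : {ω | η ≤ t T ω} ⊆ ({ω | δ ≤ u T ω} ∪ {ω | η / 2 ≤ s T ω}) ∪ {ω | K ≤ q T ω} := by
    intro ω hω
    by_contra hcon
    simp only [Set.mem_union, Set.mem_ofPred_eq, not_or, not_le] at hcon
    obtain ⟨⟨c1, c2⟩, c3⟩ := hcon
    have c4 := h5 ω (c1.le.trans (min_le_left _ _))
    have c5 : u T ω * q T ω ≤ η / (2 * K) * K :=
      mul_le_mul (c1.le.trans (min_le_right _ _)) c3.le (hq0 T ω) (by positivity)
    have c6 : η / (2 * K) * K = η / 2 := by field_simp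
    have c7 : η ≤ t T ω := hω
    linarith
  have hle := (measureReal_mono hsub (measure_ne_top P _)).trans ((measureReal_union_le _ _).trans
    (add_le_add_left (measureReal_union_le (μ := P) _ _) _))
  linarith

end Probability

/-! ### Consistency of the estimator for stationary sequences in Hilbert space. -/

variable {Ω S E F K : Type*} [MeasurableSpace Ω] [MeasurableSpace S] {P : Measure Ω}
  [IsProbabilityMeasure P] {ε : ℤ → Ω → S} [NormedAddCommGroup E] [InnerProductSpace ℝ E]
  [NormedAddCommGroup F] [InnerProductSpace ℝ F] [NormedAddCommGroup K] [InnerProductSpace ℝ K]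

/-- The observations `1, 2, …` of a stationary sequence. -/
def obs (ε : ℤ → Ω → S) (G : (ℕ → S) → E) (ω : Ω) (j : ℕ) : E := G (past ε ((j : ℤ) + 1) ω)

theorem lagAvg_eq (G : (ℕ → S) → E) (B : E →L[ℝ] E →L[ℝ] F) (T ℓ : ℕ) (ω : Ω) :
    lagAvg ε G B T ℓ ω = lagKer B (obs ε G ω) T ℓ := by
  rw [lagAvg, lagSum, lagKer]
  congr 1
  refine Finset.sum_congr rfl fun j _ => ?_
  rw [obs, obs]
  rw [show ((j + ℓ : ℕ) : ℤ) + 1 = (j : ℤ) + 1 + ℓ by push_cast; ring]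

theorem IsApprox.memLp_obs {a : ℕ → ℝ} {G : (ℕ → S) → E} (hG : IsApprox P ε G a)
    (hε : IsInnovation P ε) (j : ℕ) : MemLp (fun ω => obs ε G ω j) 2 P :=
  hG.memLp_past hε _

theorem IsApprox.integrable_norm_avg {a : ℕ → ℝ} {G : (ℕ → S) → E} (hG : IsApprox P ε G a)
    (hε : IsInnovation P ε) (T : ℕ) : Integrable (fun ω => ‖avg (obs ε G ω) T‖) P :=
  ((integrable_finsetSum (Finset.range T) fun j _ =>
    (hG.memLp_obs hε j).integrable (by norm_num)).smul ((T : ℝ)⁻¹)).norm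

/-- Averages of a stationary sequence are of the order of the inverse root of the sample size. -/
theorem IsApprox.exists_integral_norm_avg_le [CompleteSpace E] {a : ℕ → ℝ} {G : (ℕ → S) → E}
    (hG : IsApprox P ε G a) (hε : IsInnovation P ε) (ha : IsRate a) :
    ∃ C : ℝ, ∀ T : ℕ, ∫ ω, ‖avg (obs ε G ω) T‖ ∂P ≤ C * (1 / √(T : ℝ)) := by
  refine ⟨√(2 * ∑' k, corrBound (nrm P (fun ω => G (past ε 0 ω))) a k), fun T => ?_⟩
  have hm : MemLp (fun ω => ∑ j ∈ Finset.range T, G (past ε ((j : ℤ) + 1) ω)) 2 P :=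
    memLp_finsetSum _ fun j _ => hG.memLp_past hε _
  have h1 : ∫ ω, ‖∑ j ∈ Finset.range T, G (past ε ((j : ℤ) + 1) ω)‖ ∂P ≤
      √(T : ℝ) * √(2 * ∑' k, corrBound (nrm P (fun ω => G (past ε 0 ω))) a k) := by
    refine (integral_norm_le_nrm hm).trans ?_
    rw [nrm_eq_sqrt hm, ← Real.sqrt_mul (by positivity)]
    exact Real.sqrt_le_sqrt (hG.integral_norm_sum_sq_le hε ha T)
  have h2 : ∫ ω, ‖avg (obs ε G ω) T‖ ∂P =
      (T : ℝ)⁻¹ * ∫ ω, ‖∑ j ∈ Finset.range T, G (past ε ((j : ℤ) + 1) ω)‖ ∂P := by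
    rw [← integral_const_mul]
    refine integral_congr_ae (Eventually.of_forall fun ω => ?_)
    simp only [avg, norm_smul, obs]
    rw [Real.norm_of_nonneg (by positivity)]
  rw [h2, ← Real.sqrt_div_self', div_eq_mul_inv]
  calc _ ≤ (T : ℝ)⁻¹ * _ := mul_le_mul_of_nonneg_left h1 (by positivity)
    _ = _ := by ring

/-- The centered empirical products of two stationary sequences. -/
noncomputable def sampleSeq (B : E →L[ℝ] E →L[ℝ] F) (A A' : ℕ → E) (T j : ℕ) : F :=
  sampleTensor B A A' T j - avg (sampleTensor B A A' T) T

/-- The estimator of the long run covariance converges in probability. -/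
theorem tendsto_measure_estTot [CompleteSpace E] [CompleteSpace F] [CompleteSpace K]
    (hε : IsInnovation P ε) {B : E →L[ℝ] E →L[ℝ] F} (hB : IsTensor B)
    {L : F →L[ℝ] F →L[ℝ] K} (hL : IsTensor L) {G H : (ℕ → S) → E} {a a' a'' : ℕ → ℝ}
    (ha : IsRate a) (ha' : IsRate a') (ha'' : IsRate a'') (hG : IsApprox P ε G a)
    (hH : IsApprox P ε H a') {cm : F} (hZ : IsApprox P ε (fun s => B (G s) (H s) - cm) a'')
    {w : ℕ → ℕ → ℝ} {c : ℕ → ℝ} {M : ℝ} {N : ℕ → ℝ} (hw : ∀ T ℓ, |w T ℓ| ≤ M)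
    (hc : ∀ ℓ, Tendsto (fun T => w T ℓ) atTop (𝓝 (c ℓ)))
    (hN : ∀ T ℓ : ℕ, N T < (ℓ : ℝ) → w T ℓ = 0)
    (hN' : Tendsto (fun T : ℕ => N T / √(T : ℝ)) atTop (𝓝 0)) {η : ℝ} (hη : 0 < η) :
    Tendsto (fun T => P.real {ω | η ≤ ‖estTot L (w T)
        (sampleSeq B (obs ε G ω) (obs ε H ω) T) T -
      (∑' ℓ, c ℓ • lagMean P ε (fun s => B (G s) (H s) - cm) L ℓ +
        ∑' ℓ, posPart c ℓ • lagMean P ε (fun s => B (G s) (H s) - cm) L.flip ℓ)‖}) atTop (𝓝 0) := by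
  set GZ : (ℕ → S) → F := fun s => B (G s) (H s) - cm with hGZ
  have hM : 0 ≤ M := (abs_nonneg _).trans (hw 0 0)
  set e : ℕ → Ω → ℝ := fun T ω => ‖avg (obs ε G ω) T‖ + ‖avg (obs ε H ω) T‖ +
    ‖avg (obs ε GZ ω) T‖ with he
  have he0 : ∀ T ω, 0 ≤ e T ω := fun T ω => by positivity
  have hei : ∀ T, Integrable (e T) P := fun T => ((hG.integrable_norm_avg hε T).add
    (hH.integrable_norm_avg hε T)).add (hZ.integrable_norm_avg hε T)
  set v : Ω → ℕ → ℝ := fun ω j => 3 + ‖obs ε G ω j‖ + ‖obs ε H ω j‖ with hv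
  set s1 : ℕ → Ω → ℝ := fun T ω => ‖estKer L (w T) (obs ε GZ ω) T -
    ∑' ℓ, c ℓ • lagMean P ε GZ L ℓ‖ with hs1
  set s2 : ℕ → Ω → ℝ := fun T ω => ‖estKer L.flip (posPart (w T)) (obs ε GZ ω) T -
    ∑' ℓ, posPart c ℓ • lagMean P ε GZ L.flip ℓ‖ with hs2
  have hl1 := hZ.tendsto_integral_norm_weighted hε ha'' hL hw hc hN hN'
  have hl2 := hZ.tendsto_integral_norm_weighted hε ha'' hL.flip (w := fun T => posPart (w T))
    (c := posPart c) (fun T => abs_posPart_le (hw T)) (fun ℓ => by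
      unfold posPart
      split_ifs
      · exact tendsto_const_nhds
      · exact hc ℓ) (fun T ℓ h => posPart_eq_zero (hN T ℓ h)) hN'
  have hsi : ∀ (L' : F →L[ℝ] F →L[ℝ] K) (hL' : IsTensor L') (w' : ℕ → ℝ) (x : K) (T : ℕ),
      Integrable (fun ω => ‖estKer L' w' (obs ε GZ ω) T - x‖) P := by
    intro L' hL' w' x T
    simp only [estKer, ← lagAvg_eq]
    exact ((integrable_finsetSum _ fun ℓ _ => (hZ.integrable_lagAvg hε hL' T ℓ).smul _).sub
      (integrable_const _)).norm
  simp only [lagAvg_eq] at hl1 hl2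
  obtain ⟨C1, hC1⟩ := hG.exists_integral_norm_avg_le hε ha
  obtain ⟨C2, hC2⟩ := hH.exists_integral_norm_avg_le hε ha'
  obtain ⟨C3, hC3⟩ := hZ.exists_integral_norm_avg_le hε ha''
  have hEe : ∀ T, ∫ ω, e T ω ∂P ≤ (C1 + C2 + C3) * (1 / √(T : ℝ)) := by
    intro T
    have h := integral_add (μ := P) ((hG.integrable_norm_avg hε T).add
      (hH.integrable_norm_avg hε T)) (hZ.integrable_norm_avg hε T)
    simp only [Pi.add_apply] at h
    rw [he, h, integral_add (hG.integrable_norm_avg hε T) (hH.integrable_norm_avg hε T)]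
    linarith [hC1 T, hC2 T, hC3 T]
  -- The mean energy is an average of a stationary sequence, so its expectation is bounded uniformly
  -- in `T`.
  set k : (ℕ → S) → ℝ := fun s => 2 * (3 + ‖G s‖ + ‖H s‖) ^ 2 + ‖GZ s‖ ^ 2 with hk
  have hksm : StronglyMeasurable k :=
    ((((stronglyMeasurable_const.add hG.sm.norm).add hH.sm.norm).pow 2).const_mul 2).add
      (hZ.sm.norm.pow 2)
  have hki : ∀ i, Integrable (fun ω => k (past ε i ω)) P := fun i =>
    ((((memLp_const (3 : ℝ)).add (hG.memLp_past hε i).norm).add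
      (hH.memLp_past hε i).norm).integrable_sq.const_mul 2).add (hZ.memLp_past hε i).norm.integrable_sq
  have hk0 : ∀ s, 0 ≤ k s := fun s => by positivity
  have hq : ∀ T, (fun ω => meanEnergy (v ω) (obs ε GZ ω) T) =
      fun ω => (T : ℝ)⁻¹ * ∑ j ∈ Finset.range T, k (past ε ((j : ℤ) + 1) ω) := fun T => rfl
  -- Taking `M + 1` rather than `M` makes the coefficient of `e` at least 1, so `u ≤ 1` implies the
  -- bound `e ≤ 1` required for stability.
  refine tendsto_measure_of_le_mul_add (u := fun T ω => 2 * (|N T| + 1) * (M + 1) * e T ω)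
    (q := fun T ω => meanEnergy (v ω) (obs ε GZ ω) T) (s := fun T ω => s1 T ω + s2 T ω)
    (Q := ∫ ω, k (past ε 0 ω) ∂P) (fun T ω => mul_nonneg (by positivity) (he0 T ω))
    (fun T ω => meanEnergy_nonneg _ _ _) (fun T ω => by positivity) (fun T => (hei T).const_mul _)
    (fun T => ?_) (fun T => (hsi L hL _ _ T).add (hsi L.flip hL.flip _ _ T)) ?_ (fun T => ?_) ?_ ?_ hη
  · rw [hq]
    exact (integrable_finsetSum _ fun j _ => hki _).const_mul _
  · have h1 : Tendsto (fun T : ℕ => 2 * (M + 1) * (C1 + C2 + C3) *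
        (|N T / √(T : ℝ)| + 1 / √(T : ℝ))) atTop (𝓝 (2 * (M + 1) * (C1 + C2 + C3) * (|0| + 0))) := by
      refine (hN'.abs.add ?_).const_mul _
      simp_rw [one_div]
      exact tendsto_inv_atTop_zero.comp (Real.tendsto_sqrt_atTop.comp tendsto_natCast_atTop_atTop)
    rw [abs_zero, add_zero, mul_zero] at h1
    refine squeeze_zero (fun T => integral_nonneg fun ω => mul_nonneg (by positivity) (he0 T ω))
      (fun T => ?_) h1
    rw [integral_const_mul]
    refine (mul_le_mul_of_nonneg_left (hEe T) (by positivity)).trans_eq ?_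
    rw [abs_div, abs_of_nonneg (Real.sqrt_nonneg _)]
    ring
  · rw [hq, integral_const_mul, integral_finsetSum _ fun j _ => hki _]
    simp_rw [fun i => hε.integral_past hksm i]
    rw [Finset.sum_const, Finset.card_range, nsmul_eq_mul, ← mul_assoc]
    refine mul_le_of_le_one_left (integral_nonneg fun ω => hk0 _) ?_
    exact inv_mul_le_one
  · have h := hl1.add hl2
    rw [add_zero] at h
    refine h.congr fun T => ?_
    exact (integral_add (hsi L hL _ _ T) (hsi L.flip hL.flip _ _ T)).symm
  · filter_upwards [eventually_ne_atTop 0] with T hT ω hu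
    have hcoef : 1 ≤ 2 * (|N T| + 1) * (M + 1) := by
      nlinarith [abs_nonneg (N T), mul_nonneg (abs_nonneg (N T)) hM]
    have he1 : e T ω ≤ 1 := by nlinarith [he0 T ω]
    have h1 := norm_estTot_sub_le hL (hw T) (hN T) (z := obs ε GZ ω)
      (z' := sampleSeq B (obs ε G ω) (obs ε H ω) T) (v := v ω) (he0 T ω) he1
      (fun j => by positivity)
      (fun j => norm_sampleTensor_sub_le hB (obs ε G ω) (obs ε H ω) hT cm rfl he1 j) T
    have hq0 := meanEnergy_nonneg (v ω) (obs ε GZ ω) T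
    have h2 : 2 * (|N T| + 1) * M * e T ω * meanEnergy (v ω) (obs ε GZ ω) T ≤
        2 * (|N T| + 1) * (M + 1) * e T ω * meanEnergy (v ω) (obs ε GZ ω) T := by
      have := he0 T ω
      gcongr
      linarith
    have h3 : ∀ (x y y' Γ Γ' : K), ‖x - (Γ + Γ')‖ ≤ ‖x - (y + y')‖ + (‖y - Γ‖ + ‖y' - Γ'‖) := by
      intro x y y' Γ Γ'
      have : x - (Γ + Γ') = (x - (y + y')) + ((y - Γ) + (y' - Γ')) := by abel
      rw [this]
      exact (norm_add_le _ _).trans (add_le_add_right (norm_add_le _ _) _)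
    refine (h3 _ (estKer L (w T) (obs ε GZ ω) T)
      (estKer L.flip (posPart (w T)) (obs ε GZ ω) T) _ _).trans ?_
    refine add_le_add_left (h1.trans h2) _

/-! ### Weight functions. -/

section Weights

/-- Multiplying the finite limit of `(1 - W x) / |x| ^ b` by `|x| ^ b → 0` gives `W x → 1`;
continuity identifies the value. -/
theorem IsWeightFunction.apply_zero {W : ℝ → ℝ} {b : ℝ} (hW : IsWeightFunction W b) : W 0 = 1 := by
  obtain ⟨k, -, hk⟩ := hW.order
  have h1 : Tendsto (fun x : ℝ => |x| ^ b) (𝓝[≠] 0) (𝓝 0) := by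
    have h : Continuous fun x : ℝ => |x| ^ b :=
      continuous_abs.rpow_const fun _ => Or.inr hW.order_pos.le
    have h' := h.tendsto 0
    rw [abs_zero, Real.zero_rpow hW.order_pos.ne'] at h'
    exact h'.mono_left nhdsWithin_le_nhds
  have h2 := hk.mul h1
  rw [mul_zero] at h2
  have h3 : Tendsto (fun x => 1 - W x) (𝓝[≠] 0) (𝓝 0) := by
    refine h2.congr' ?_
    filter_upwards [self_mem_nhdsWithin] with x hx
    exact div_mul_cancel₀ _ (Real.rpow_pos_of_pos (abs_pos.2 hx) b).ne'
  have h4 : Tendsto (fun x => 1 - W x) (𝓝[≠] 0) (𝓝 (1 - W 0)) :=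
    (tendsto_const_nhds.sub (hW.continuous.tendsto 0)).mono_left nhdsWithin_le_nhds
  linarith [tendsto_nhds_unique h3 h4]

/-- The weights of the nonnegative lags for the bandwidth `h`. -/
noncomputable def lagWeight (W : ℝ → ℝ) (h : ℝ) (ℓ : ℕ) : ℝ := if h = 0 then 0 else W ((ℓ : ℝ) / h)

theorem IsWeightFunction.tendsto_lagWeight {W : ℝ → ℝ} {b : ℝ} (hW : IsWeightFunction W b)
    {h : ℕ → ℝ} (hh : Tendsto h atTop atTop) (ℓ : ℕ) :
    Tendsto (fun T => lagWeight W (h T) ℓ) atTop (𝓝 1) := by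
  have h1 := (hW.continuous.tendsto 0).comp (hh.const_div_atTop (ℓ : ℝ))
  rw [hW.apply_zero] at h1
  refine h1.congr' ?_
  filter_upwards [hh.eventually_gt_atTop 0] with T hT
  simp [lagWeight, hT.ne']

theorem IsWeightFunction.exists_abs_lagWeight_le {W : ℝ → ℝ} {b : ℝ} (hW : IsWeightFunction W b) :
    ∃ M : ℝ, ∀ h ℓ, |lagWeight W h ℓ| ≤ M := by
  obtain ⟨M, hM⟩ := hW.bounded_support.exists_bound_of_continuous hW.continuous
  refine ⟨M, fun h ℓ => ?_⟩
  unfold lagWeight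
  split_ifs
  · rw [abs_zero]; exact (norm_nonneg _).trans (hM 0)
  · exact hM _

/-- The support of `W` lies in a ball of radius `R`. The separate value of `lagWeight` at `h = 0`
makes this hold there too, where division by zero would give `W 0 = 1` at every lag. -/
theorem IsWeightFunction.exists_lagWeight_eq_zero {W : ℝ → ℝ} {b : ℝ}
    (hW : IsWeightFunction W b) :
    ∃ R : ℝ, ∀ (h : ℝ) (ℓ : ℕ), R * |h| < ℓ → lagWeight W h ℓ = 0 := by
  obtain ⟨R, hR⟩ := hW.bounded_support.isBounded.subset_closedBall 0
  refine ⟨R, fun h ℓ hlt => ?_⟩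
  unfold lagWeight
  split_ifs with h0
  · rfl
  · by_contra hne
    have h1 := hR (subset_tsupport W (Function.mem_support.2 hne))
    rw [mem_closedBall_zero_iff, Real.norm_eq_abs, abs_div, div_le_iff₀ (abs_pos.2 h0),
      Nat.abs_cast] at h1
    linarith

end Weights

/-! ### The pointwise estimator as an element of `L2`. -/

section Estimator

variable {Ω : Type*} {X Y : ℤ → Ω → I → ℝ}

/-- The empirically centered product, minus its sample mean. -/
noncomputable def sampleResidual (X Y : ℤ → Ω → I → ℝ) (T : ℕ) (ω : Ω) (j : ℕ) (z : I × I) : ℝ :=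
  sampleCenteredProd X Y T ((j : ℤ) + 1) ω z - sampleCrossCov X Y T ω z

theorem sampleAutocov_natCast (T n : ℕ) (ω : Ω) (z w : I × I) :
    sampleAutocov X Y T n ω z w = (T : ℝ)⁻¹ * ∑ j ∈ Finset.range (T - n),
      sampleResidual X Y T ω j z * sampleResidual X Y T ω (j + n) w := by
  rw [sampleAutocov, one_div, if_pos (Int.natCast_nonneg n)]
  congr 1
  rcases le_total n T with h | h
  · rw [← Nat.cast_sub h, sum_Icc_one]
    refine Finset.sum_congr rfl fun j _ => ?_
    simp only [sampleResidual]
    rw [show ((j + n : ℕ) : ℤ) + 1 = (j : ℤ) + 1 + n by push_cast; ring]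
  · rw [Nat.sub_eq_zero_of_le h, Finset.sum_range_zero, Finset.Icc_eq_empty (by omega),
      Finset.sum_empty]

theorem sampleAutocov_neg (T : ℕ) {n : ℕ} (hn : n ≠ 0) (ω : Ω) (z w : I × I) :
    sampleAutocov X Y T (-n) ω z w = (T : ℝ)⁻¹ * ∑ j ∈ Finset.range (T - n),
      sampleResidual X Y T ω (j + n) z * sampleResidual X Y T ω j w := by
  rw [sampleAutocov, one_div, if_neg (by omega), sub_neg_eq_add, sum_Icc_int]
  congr 1
  refine Finset.sum_congr rfl fun j _ => ?_
  simp only [sampleResidual]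
  rw [show ((j + n : ℕ) : ℤ) + 1 = (j : ℤ) + 1 + n by push_cast; ring, add_neg_cancel_right]

theorem longRunCovEst_eq {W : ℝ → ℝ} {b : ℝ} (hW : IsWeightFunction W b) {h : ℝ} (hh : h ≠ 0)
    (T : ℕ) (ω : Ω) (z w : I × I) :
    longRunCovEst X Y W h T ω z w =
      ∑ n ∈ Finset.range T, lagWeight W h n * sampleAutocov X Y T n ω z w +
      ∑ n ∈ Finset.range T, posPart (lagWeight W h) n * sampleAutocov X Y T (-n) ω z w := by
  have h1 : ∀ n : ℕ, T ≤ n → sampleAutocov X Y T n ω z w = 0 := fun n hn => by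
    rw [sampleAutocov_natCast, Nat.sub_eq_zero_of_le hn, Finset.sum_range_zero, mul_zero]
  have h2 : ∀ n : ℕ, n ≠ 0 → T ≤ n → sampleAutocov X Y T (-n) ω z w = 0 := fun n h0 hn => by
    rw [sampleAutocov_neg T h0, Nat.sub_eq_zero_of_le hn, Finset.sum_range_zero, mul_zero]
  rw [longRunCovEst, tsum_int_eq]
  · rw [tsum_eq_sum (s := Finset.range T), tsum_eq_sum (s := Finset.range T)]
    · congr 1
      · refine Finset.sum_congr rfl fun n _ => ?_
        rw [lagWeight, if_neg hh, Int.cast_natCast]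
      · refine Finset.sum_congr rfl fun n _ => ?_
        unfold posPart lagWeight
        split_ifs
        · rw [zero_mul]
        · rw [Int.cast_neg, Int.cast_natCast, neg_div, hW.even]
    · intro n hn
      rw [Finset.mem_range, not_lt] at hn
      split_ifs with h0
      · rfl
      · rw [h2 n h0 hn, mul_zero]
    · intro n hn
      rw [Finset.mem_range, not_lt] at hn
      rw [h1 n hn, mul_zero]
  · refine summable_of_ne_finset_zero (s := Finset.Icc (-(T : ℤ)) T) fun ℓ hℓ => ?_
    rw [Finset.mem_Icc, not_and_or] at hℓ
    obtain ⟨n, rfl | rfl⟩ := ℓ.eq_nat_or_neg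
    · rw [h1 n (by omega), mul_zero]
    · rw [h2 n (by omega) (by omega), mul_zero]

theorem ten_isTensor {Z : Type*} [MeasureSpace Z] [IsFiniteMeasure (volume : Measure Z)] :
    IsTensor (ten : L2 Z →L[ℝ] L2 Z →L[ℝ] L2 (Z × Z)) :=
  fun f g f' g' => inner_ten f f' g g'

/-- The estimator represents the weighted sum of the sample autocovariances in `L²`. -/
theorem longRunCovEst_ae_eq {W : ℝ → ℝ} {b : ℝ} (hW : IsWeightFunction W b) {h : ℝ} (hh : h ≠ 0)
    (T : ℕ) {ω : Ω} {A B : ℕ → L2 I} (hA : ∀ j : ℕ, X ((j : ℤ) + 1) ω =ᵐ[volume] A j)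
    (hB : ∀ j : ℕ, Y ((j : ℤ) + 1) ω =ᵐ[volume] B j) :
    (fun q : (I × I) × (I × I) => longRunCovEst X Y W h T ω q.1 q.2) =ᵐ[volume]
      (estTot ten (lagWeight W h) (sampleSeq ten A B T) T : L2 ((I × I) × (I × I))) := by
  have hmean : ∀ (X : ℤ → Ω → I → ℝ) (A : ℕ → L2 I),
      (∀ j : ℕ, X ((j : ℤ) + 1) ω =ᵐ[volume] A j) → sampleMean X T ω =ᵐ[volume] (avg A T : L2 I) := by
    intro X A hA
    have h1 := ae_const_mul ((T : ℝ)⁻¹) (ae_sum (Finset.range T) fun j _ => hA j)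
    have h2 : sampleMean X T ω =
        fun t => (T : ℝ)⁻¹ * ∑ j ∈ Finset.range T, X ((j : ℤ) + 1) ω t := by
      funext t
      rw [sampleMean, one_div, sum_Icc_one (fun i => X i ω t)]
    rw [h2]
    exact h1
  have hprod : ∀ j : ℕ, sampleCenteredProd X Y T ((j : ℤ) + 1) ω =ᵐ[volume]
      (sampleTensor ten A B T j : L2 (I × I)) := fun j =>
    ten_ae_of_ae (ae_sub (hA j) (hmean X A hA)) (ae_sub (hB j) (hmean Y B hB))
  have hcc : sampleCrossCov X Y T ω =ᵐ[volume]
      (avg (sampleTensor ten A B T) T : L2 (I × I)) := by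
    have h1 := ae_const_mul ((T : ℝ)⁻¹) (ae_sum (Finset.range T) fun j _ => hprod j)
    have h2 : sampleCrossCov X Y T ω = fun z =>
        (T : ℝ)⁻¹ * ∑ j ∈ Finset.range T, sampleCenteredProd X Y T ((j : ℤ) + 1) ω z := by
      funext z
      rw [sampleCrossCov, one_div, sum_Icc_one (fun i => sampleCenteredProd X Y T i ω z)]
    rw [h2]
    exact h1
  have hres : ∀ j, sampleResidual X Y T ω j =ᵐ[volume]
      (sampleSeq ten A B T j : L2 (I × I)) := fun j =>
    ae_sub (hprod j) hcc
  have hpos : ∀ n : ℕ, (fun q : (I × I) × (I × I) => sampleAutocov X Y T n ω q.1 q.2) =ᵐ[volume]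
      (lagKer ten (sampleSeq ten A B T) T n : L2 ((I × I) × (I × I))) := by
    intro n
    simp only [sampleAutocov_natCast]
    exact ae_const_mul _ (ae_sum _ fun j _ => ten_ae_of_ae (hres j) (hres (j + n)))
  have hneg : ∀ n : ℕ, n ≠ 0 → (fun q : (I × I) × (I × I) =>
      sampleAutocov X Y T (-n) ω q.1 q.2) =ᵐ[volume]
      (lagKer ten.flip (sampleSeq ten A B T) T n : L2 ((I × I) × (I × I))) := by
    intro n hn
    simp only [sampleAutocov_neg T hn]
    exact ae_const_mul _ (ae_sum _ fun j _ => ten_ae_of_ae (hres (j + n)) (hres j))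
  simp only [longRunCovEst_eq hW hh]
  refine ae_add (ae_sum _ fun n _ => ae_const_mul _ (hpos n)) (ae_sum _ fun n _ => ?_)
  by_cases hn : n = 0
  · simp only [posPart, hn, if_true, zero_mul, zero_smul]
    exact (Lp.coeFn_zero ℝ 2 volume).symm
  · exact ae_const_mul _ (hneg n hn)

/-- Lag 0 gives tensor squares. At other lags the terms for `ℓ` and `-ℓ` have the same weight and
combine to `ten a b + ten b a`. -/
theorem estTot_mem_goodSubmodule {Z : Type*} [MeasureSpace Z] [IsFiniteMeasure (volume : Measure Z)]
    (w : ℕ → ℝ) (z : ℕ → L2 Z) (T : ℕ) :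
    estTot (ten : L2 Z →L[ℝ] L2 Z →L[ℝ] L2 (Z × Z)) w z T ∈ goodSubmodule Z := by
  rw [estTot, estKer, estKer, ← Finset.sum_add_distrib]
  refine Submodule.sum_mem _ fun ℓ _ => ?_
  by_cases hℓ : ℓ = 0
  · subst hℓ
    simp only [posPart, if_true, zero_smul, add_zero, lagKer]
    exact Submodule.smul_mem _ _ (Submodule.smul_mem _ _
      (Submodule.sum_mem _ fun j _ => ten_self_mem _))
  · simp only [posPart, hℓ, if_false, lagKer]
    rw [← smul_add, ← smul_add, ← Finset.sum_add_distrib]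
    exact Submodule.smul_mem _ _ (Submodule.smul_mem _ _
      (Submodule.sum_mem _ fun j _ => ten_add_flip_mem _ _))

end Estimator

/-! ### The long run covariance as an element of `L2`. -/

section LongRun

variable {Ω S : Type*} [MeasurableSpace Ω] [MeasurableSpace S] {P : Measure Ω}
  [IsProbabilityMeasure P] {X Y : ℤ → Ω → I → ℝ} {g : (ℕ → S) → L2 I × L2 I} {ε : ℤ → Ω → S}
  {εs : ℕ → ℤ → Ω → S} {r α β : ℝ}

theorem IsApproximableShift.isInnovation (h : IsApproximableShift P X Y g ε εs r α β) :
    IsInnovation P ε := ⟨h.measurable_innov, h.indep_innov, h.ident_innov⟩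

/-- The centered first component of the shift. -/
noncomputable def shiftX (P : Measure Ω) (g : (ℕ → S) → L2 I × L2 I) (ε : ℤ → Ω → S)
    (s : ℕ → S) : L2 I := (g s).1 - ∫ ω, (g (past ε 0 ω)).1 ∂P

/-- The centered second component of the shift. -/
noncomputable def shiftY (P : Measure Ω) (g : (ℕ → S) → L2 I × L2 I) (ε : ℤ → Ω → S)
    (s : ℕ → S) : L2 I := (g s).2 - ∫ ω, (g (past ε 0 ω)).2 ∂P

/-- The tensor product of the centered components of the shift. -/
noncomputable def shiftProd (P : Measure Ω) (g : (ℕ → S) → L2 I × L2 I) (ε : ℤ → Ω → S)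
    (s : ℕ → S) : L2 (I × I) := ten (shiftX P g ε s) (shiftY P g ε s)

/-- The centered tensor product of the centered components of the shift. -/
noncomputable def shiftZ (P : Measure Ω) (g : (ℕ → S) → L2 I × L2 I) (ε : ℤ → Ω → S)
    (s : ℕ → S) : L2 (I × I) :=
  ten (shiftX P g ε s) (shiftY P g ε s) - ∫ ω, shiftProd P g ε (past ε 0 ω) ∂P

theorem integral_sub_integral {E : Type*} [NormedAddCommGroup E] [NormedSpace ℝ E]
    [CompleteSpace E] {U : Ω → E} (hU : Integrable U P) : ∫ ω, (U ω - ∫ ω', U ω' ∂P) ∂P = 0 := by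
  rw [integral_sub hU (integrable_const _), integral_const, probReal_univ, one_smul, sub_self]

/-- The slower exponent `min α β` serves both components. They are coupled in `L⁴`, their tensor
product in `L²`, and centering leaves coupling differences unchanged. -/
theorem IsApproximableShift.exists_isApprox (h : IsApproximableShift P X Y g ε εs r α β) :
    ∃ a a' a'' : ℕ → ℝ, IsRate a ∧ IsRate a' ∧ IsRate a'' ∧ IsApprox P ε (shiftX P g ε) a ∧
      IsApprox P ε (shiftY P g ε) a' ∧ IsApprox P ε (shiftZ P g ε) a'' := by
  have hε := h.isInnovation
  set κ := min α β with hκ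
  have hκ1 : 1 < κ := lt_min h.one_lt_α h.one_lt_β
  have hκ0 : 0 < κ := by linarith
  have h4 : (4 : ENNReal) ≤ ENNReal.ofReal r := by
    rw [show (4 : ENNReal) = ENNReal.ofReal 4 by norm_num]
    exact ENNReal.ofReal_le_ofReal h.four_lt.le
  have hg1 : StronglyMeasurable fun s => (g s).1 := continuous_fst.comp_stronglyMeasurable
    h.measurable_g
  have hg2 : StronglyMeasurable fun s => (g s).2 := continuous_snd.comp_stronglyMeasurable
    h.measurable_g
  obtain ⟨C, hC⟩ := h.rate_X 0
  obtain ⟨C', hC'⟩ := h.rate_Y 0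
  obtain ⟨D, hD⟩ := exists_isCoupled h.measurable_innov h.measurable_copy h4 hg1 h.moment_X hκ0
    (min_le_left α β) hC
  obtain ⟨D', hD'⟩ := exists_isCoupled h.measurable_innov h.measurable_copy h4 hg2 h.moment_Y hκ0
    (min_le_right α β) hC'
  have hX : IsCoupled P ε εs 4 (shiftX P g ε) D κ := hD.sub_const _
  have hY : IsCoupled P ε εs 4 (shiftY P g ε) D' κ := hD'.sub_const _
  obtain ⟨D'', hD''⟩ := hX.tensor h.measurable_innov h.measurable_copy hκ0 hY ten_isTensor
  have hZ : IsCoupled P ε εs 2 (shiftZ P g ε) D'' κ := hD''.sub_const _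
  have h1 : (1 : ENNReal) ≤ 4 := by norm_num
  exact ⟨_, _, _, isRate_polyRate (by linarith [hX.pos]) hκ1,
    isRate_polyRate (by linarith [hY.pos]) hκ1, isRate_polyRate (by linarith [hZ.pos]) hκ1,
    hX.isApprox hε h.measurable_copy h.indep_innov_copy (by norm_num)
      (integral_sub_integral (hD.memLp.integrable h1)),
    hY.isApprox hε h.measurable_copy h.indep_innov_copy (by norm_num)
      (integral_sub_integral (hD'.memLp.integrable h1)),
    hZ.isApprox hε h.measurable_copy h.indep_innov_copy le_rfl
      (integral_sub_integral (hD''.memLp.integrable (by norm_num)))⟩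

theorem measurable_centeredProd {X Y : ℤ → Ω → I → ℝ}
    (hX : ∀ i, Measurable fun q : Ω × I => X i q.1 q.2)
    (hY : ∀ i, Measurable fun q : Ω × I => Y i q.1 q.2) (i : ℤ) :
    Measurable fun q : Ω × (I × I) => centeredProd P X Y i q.1 q.2 := by
  have hmean : ∀ X : ℤ → Ω → I → ℝ, (∀ i, Measurable fun q : Ω × I => X i q.1 q.2) →
      Measurable fun t => ∫ ω, X 0 ω t ∂P := fun X hX =>
    ((hX 0).stronglyMeasurable.integral_prod_left' (μ := P)).measurable
  refine Measurable.mul (Measurable.sub ?_ ?_) (Measurable.sub ?_ ?_)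
  · exact (hX i).comp (measurable_fst.prodMk (measurable_fst.comp measurable_snd))
  · exact (hmean X hX).comp (measurable_fst.comp measurable_snd)
  · exact (hY i).comp (measurable_fst.prodMk (measurable_snd.comp measurable_snd))
  · exact (hmean Y hY).comp (measurable_snd.comp measurable_snd)

theorem IsApproximableShift.centeredProd_ae_eq (h : IsApproximableShift P X Y g ε εs r α β)
    (i : ℤ) : ∀ᵐ ω ∂P, centeredProd P X Y i ω =ᵐ[volume] shiftProd P g ε (past ε i ω) := by
  have h1 : (1 : ENNReal) ≤ ENNReal.ofReal r := by
    rw [← ENNReal.ofReal_one]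
    exact ENNReal.ofReal_le_ofReal (by linarith [h.four_lt])
  have hX := integral_ae_eq (h.measurable_X 0) (h.moment_X.integrable h1) (h.shift_X 0)
  have hY := integral_ae_eq (h.measurable_Y 0) (h.moment_Y.integrable h1) (h.shift_Y 0)
  filter_upwards [h.shift_X i, h.shift_Y i] with ω h2 h3
  exact ten_ae_of_ae (ae_sub h2 hX) (ae_sub h3 hY)

theorem IsApproximableShift.integrable_shiftProd (h : IsApproximableShift P X Y g ε εs r α β)
    (i : ℤ) : Integrable (fun ω => shiftProd P g ε (past ε i ω)) P := by
  obtain ⟨a, a', -, -, -, -, hX, hY, -⟩ := h.exists_isApprox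
  exact ten_isTensor.integrable (hX.memLp_past h.isInnovation i) (hY.memLp_past h.isInnovation i)

theorem IsApproximableShift.stronglyMeasurable_shiftProd
    (h : IsApproximableShift P X Y g ε εs r α β) : StronglyMeasurable (shiftProd P g ε) := by
  obtain ⟨a, a', -, -, -, -, hX, hY, -⟩ := h.exists_isApprox
  exact stronglyMeasurable_bilin ten hX.sm hY.sm

/-- The autocovariance function at an integer lag represents an element of `L²`. -/
theorem IsApproximableShift.covariance_ae_eq (h : IsApproximableShift P X Y g ε εs r α β) (ℓ : ℤ) :
    (fun q : (I × I) × (I × I) => covariance (fun ω => centeredProd P X Y 0 ω q.1)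
      (fun ω => centeredProd P X Y ℓ ω q.2) P) =ᵐ[volume]
    (∫ ω, ten (shiftZ P g ε (past ε 0 ω)) (shiftZ P g ε (past ε ℓ ω)) ∂P :
      L2 ((I × I) × (I × I))) := by
  have hε := h.isInnovation
  obtain ⟨-, -, a, -, -, -, -, -, hZ⟩ := h.exists_isApprox
  have hm := measurable_centeredProd (P := P) h.measurable_X h.measurable_Y
  have hmean : ∀ i, (fun z => ∫ ω, centeredProd P X Y i ω z ∂P) =ᵐ[volume]
      (∫ ω, shiftProd P g ε (past ε 0 ω) ∂P : L2 (I × I)) := fun i => by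
    have h1 := integral_ae_eq (hm i) (h.integrable_shiftProd i) (h.centeredProd_ae_eq i)
    rwa [hε.integral_past h.stronglyMeasurable_shiftProd] at h1
  have hmeas : ∀ i, Measurable fun z => ∫ ω, centeredProd P X Y i ω z ∂P := fun i =>
    ((hm i).stronglyMeasurable.integral_prod_left' (μ := P)).measurable
  refine integral_ae_eq (F := fun ω (q : (I × I) × (I × I)) =>
    (centeredProd P X Y 0 ω q.1 - ∫ ω', centeredProd P X Y 0 ω' q.1 ∂P) *
      (centeredProd P X Y ℓ ω q.2 - ∫ ω', centeredProd P X Y ℓ ω' q.2 ∂P)) ?_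
    (ten_isTensor.integrable (hZ.memLp_past hε 0) (hZ.memLp_past hε ℓ)) ?_
  · refine Measurable.mul (Measurable.sub ?_ ?_) (Measurable.sub ?_ ?_)
    · exact (hm 0).comp (measurable_fst.prodMk (measurable_fst.comp measurable_snd))
    · exact (hmeas 0).comp (measurable_fst.comp measurable_snd)
    · exact (hm ℓ).comp (measurable_fst.prodMk (measurable_snd.comp measurable_snd))
    · exact (hmeas ℓ).comp (measurable_snd.comp measurable_snd)
  · filter_upwards [h.centeredProd_ae_eq 0, h.centeredProd_ae_eq ℓ] with ω h1 h2
    exact ten_ae_of_ae (ae_sub h1 (hmean 0)) (ae_sub h2 (hmean ℓ))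

/-- The long run covariance as an element of `L²`. -/
noncomputable def longRunKer (P : Measure Ω) (g : (ℕ → S) → L2 I × L2 I) (ε : ℤ → Ω → S) :
    L2 ((I × I) × (I × I)) :=
  ∑' ℓ, (1 : ℝ) • lagMean P ε (shiftZ P g ε) ten ℓ +
    ∑' ℓ, posPart (fun _ => 1) ℓ • lagMean P ε (shiftZ P g ε) ten.flip ℓ

/-- By stationarity the covariance at lag `-n` is the lag `n` mean with swapped factors, whence
`ten.flip`. Summability of the norms turns the pointwise series into the series in `L2`. -/
theorem IsApproximableShift.longRunCov_ae_eq (h : IsApproximableShift P X Y g ε εs r α β) :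
    (fun q : (I × I) × (I × I) => longRunCov P X Y q.1 q.2) =ᵐ[volume] longRunKer P g ε := by
  have hε := h.isInnovation
  obtain ⟨-, -, a, -, -, ha, -, -, hZ⟩ := h.exists_isApprox
  set c : ℤ → L2 ((I × I) × (I × I)) := fun ℓ =>
    ∫ ω, ten (shiftZ P g ε (past ε 0 ω)) (shiftZ P g ε (past ε ℓ ω)) ∂P with hc
  have hpos : ∀ n : ℕ, c n = lagMean P ε (shiftZ P g ε) ten n := fun n => rfl
  have hneg : ∀ n : ℕ, c (-n) = lagMean P ε (shiftZ P g ε) ten.flip n := fun n => by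
    have h1 := lagMean_eq hε hZ.sm (ten : L2 (I × I) →L[ℝ] L2 (I × I) →L[ℝ] _).flip n (-n)
    rw [neg_add_cancel] at h1
    exact h1
  have hsum : Summable fun ℓ => ‖c ℓ‖ := by
    refine Summable.of_nat_of_neg ?_ ?_
    · simp only [hpos]
      exact hZ.summable_norm_lagMean hε ha ten_isTensor
    · simp only [hneg]
      exact hZ.summable_norm_lagMean hε ha ten_isTensor.flip
  have h2 := ae_tsum h.covariance_ae_eq hsum
  have h3 : ∑' ℓ, c ℓ = longRunKer P g ε := by
    rw [tsum_int_eq hsum.of_norm, longRunKer]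
    congr 1
    · exact tsum_congr fun n => by rw [one_smul, hpos]
    · refine tsum_congr fun n => ?_
      unfold posPart
      split_ifs
      · rw [zero_smul]
      · rw [one_smul, hneg]
  rw [← h3]
  exact h2

end LongRun

/-! ### Consistency of the kernel estimator. -/

section Consistency

variable {Ω S : Type*} [MeasurableSpace Ω] [MeasurableSpace S] {P : Measure Ω}
  [IsProbabilityMeasure P] {X Y : ℤ → Ω → I → ℝ} {g : (ℕ → S) → L2 I × L2 I} {ε : ℤ → Ω → S}
  {εs : ℕ → ℤ → Ω → S} {r α β : ℝ}

/-- Domination controls the outer measure of the exceptional set, so `f` need not be measurable.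
This permits an arbitrary choice of the estimated eigenfunctions. -/
theorem tendstoInMeasure_zero_of_le {t f : ℕ → Ω → ℝ}
    (ht : ∀ η, 0 < η → Tendsto (fun T => P.real {ω | η ≤ t T ω}) atTop (𝓝 0)) {C : ℝ} (hC : 0 < C)
    (hf0 : ∀ T ω, 0 ≤ f T ω) (hf : ∀ᶠ T in atTop, ∀ᵐ ω ∂P, f T ω ≤ C * t T ω) :
    TendstoInMeasure P f atTop (fun _ => 0) := by
  rw [tendstoInMeasure_iff_measureReal_norm]
  intro η hη
  refine squeeze_zero' (Eventually.of_forall fun _ => measureReal_nonneg) ?_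
    (ht (η / C) (by positivity))
  filter_upwards [hf] with T hT
  refine ENNReal.toReal_mono (measure_ne_top P _) (measure_mono_ae ?_)
  filter_upwards [hT] with ω hω hmem
  have h1 : η ≤ ‖f T ω - 0‖ := hmem
  rw [sub_zero, Real.norm_of_nonneg (hf0 T ω)] at h1
  exact (div_le_iff₀' hC).2 (h1.trans hω)

/-- The kernel estimator as a random element of `L²`. -/
noncomputable def kerHat (P : Measure Ω) (g : (ℕ → S) → L2 I × L2 I) (ε : ℤ → Ω → S)
    (W : ℝ → ℝ) (h : ℝ) (T : ℕ) (ω : Ω) : L2 ((I × I) × (I × I)) :=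
  estTot ten (lagWeight W h)
    (sampleSeq ten (obs ε (shiftX P g ε) ω) (obs ε (shiftY P g ε) ω) T) T

/-- Centering by sample means makes the estimator invariant under subtracting constants, so the
observations may be replaced by their centered versions. -/
theorem IsApproximableShift.longRunCovEst_ae_eq (hXY : IsApproximableShift P X Y g ε εs r α β)
    {W : ℝ → ℝ} {b : ℝ} (hW : IsWeightFunction W b) {h : ℝ} (hh : h ≠ 0) {T : ℕ} (hT : T ≠ 0) :
    ∀ᵐ ω ∂P, (fun q : (I × I) × (I × I) => longRunCovEst X Y W h T ω q.1 q.2) =ᵐ[volume]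
      kerHat P g ε W h T ω := by
  filter_upwards [ae_all_iff.2 hXY.shift_X, ae_all_iff.2 hXY.shift_Y] with ω h1 h2
  have h3 := CrossCov.longRunCovEst_ae_eq hW hh T (fun j : ℕ => h1 ((j : ℤ) + 1))
    (fun j : ℕ => h2 ((j : ℤ) + 1))
  have h4 : ∀ j, sampleTensor ten (obs ε (shiftX P g ε) ω) (obs ε (shiftY P g ε) ω) T j =
      sampleTensor ten (fun j : ℕ => (g (past ε ((j : ℤ) + 1) ω)).1)
        (fun j : ℕ => (g (past ε ((j : ℤ) + 1) ω)).2) T j :=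
    sampleTensor_sub_const ten _ _ hT _ _
  rw [kerHat, show sampleSeq ten (obs ε (shiftX P g ε) ω) (obs ε (shiftY P g ε) ω) T =
    sampleSeq ten (fun j : ℕ => (g (past ε ((j : ℤ) + 1) ω)).1)
      (fun j : ℕ => (g (past ε ((j : ℤ) + 1) ω)).2) T by
    unfold sampleSeq; rw [funext h4]]
  exact h3

theorem IsApproximableShift.tendsto_measure_kerHat
    (hXY : IsApproximableShift P X Y g ε εs r α β) {W : ℝ → ℝ} {b : ℝ} (hW : IsWeightFunction W b)
    {h : ℕ → ℝ} (h_atTop : Tendsto h atTop atTop)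
    (h_sqrt : Tendsto (fun T : ℕ => h T / √(T : ℝ)) atTop (𝓝 0)) {η : ℝ} (hη : 0 < η) :
    Tendsto (fun T => P.real {ω | η ≤ ‖kerHat P g ε W (h T) T ω - longRunKer P g ε‖}) atTop
      (𝓝 0) := by
  obtain ⟨a, a', a'', ha, ha', ha'', hX, hY, hZ⟩ := hXY.exists_isApprox
  obtain ⟨M, hM⟩ := hW.exists_abs_lagWeight_le
  obtain ⟨R, hR⟩ := hW.exists_lagWeight_eq_zero
  refine tendsto_measure_estTot hXY.isInnovation ten_isTensor ten_isTensor ha ha' ha'' hX hY hZ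
    (w := fun T => lagWeight W (h T)) (c := fun _ => 1) (N := fun T => R * |h T|)
    (fun T => hM (h T)) (hW.tendsto_lagWeight h_atTop) (fun T => hR (h T)) ?_ hη
  have h1 := h_sqrt.abs.const_mul R
  rw [abs_zero, mul_zero] at h1
  refine h1.congr fun T => ?_
  rw [abs_div, abs_of_nonneg (Real.sqrt_nonneg _), mul_div_assoc]

/-- Convergence in probability supplies, for each `δ`, some `T` and some outcome at which a finite
rank symmetric estimator is within `δ` of the limit; the good kernels are closed. -/
theorem IsApproximableShift.longRunKer_mem (hXY : IsApproximableShift P X Y g ε εs r α β)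
    {W : ℝ → ℝ} {b : ℝ} (hW : IsWeightFunction W b) {h : ℕ → ℝ} (h_atTop : Tendsto h atTop atTop)
    (h_sqrt : Tendsto (fun T : ℕ => h T / √(T : ℝ)) atTop (𝓝 0)) :
    longRunKer P g ε ∈ goodKernels (I × I) := by
  rw [← isClosed_goodKernels.closure_eq, Metric.mem_closure_iff]
  intro δ hδ
  obtain ⟨T, hT⟩ := ((hXY.tendsto_measure_kerHat hW h_atTop h_sqrt hδ).eventually_lt_const
    one_pos).exists
  have h1 : ∃ ω, ω ∉ {ω | δ ≤ ‖kerHat P g ε W (h T) T ω - longRunKer P g ε‖} := by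
    by_contra! hall
    rw [Set.eq_univ_of_forall hall, probReal_univ] at hT
    exact lt_irrefl _ hT
  obtain ⟨ω, hω⟩ := h1
  refine ⟨kerHat P g ε W (h T) T ω, estTot_mem_goodSubmodule _ _ _, ?_⟩
  rw [dist_comm, dist_eq_norm]
  exact not_le.1 hω

end Consistency

end CrossCov

/-! ### Consistency of the empirical eigenvalues and eigenfunctions. -/

theorem mainTheorem7 {Ω S : Type*} [MeasurableSpace Ω] [MeasurableSpace S]
    (P : Measure Ω) [IsProbabilityMeasure P]
    (X Y : ℤ → Ω → I → ℝ) (g : (ℕ → S) → CrossCov.L2 I × CrossCov.L2 I)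
    (ε : ℤ → Ω → S) (εs : ℕ → ℤ → Ω → S) (r α β : ℝ)
    (hXY : CrossCov.IsApproximableShift P X Y g ε εs r α β)
    (W : ℝ → ℝ) (b : ℝ) (hW : CrossCov.IsWeightFunction W b)
    (h : ℕ → ℝ) (h_atTop : Tendsto h atTop atTop)
    (h_sqrt : Tendsto (fun T : ℕ => h T / √(T : ℝ)) atTop (𝓝 0))
    (lam : ℕ → ℝ) (φ : ℕ → CrossCov.L2 (I × I))
    (h_eig : CrossCov.IsOrderedEigensystem (CrossCov.longRunCov P X Y) lam φ)
    (p : ℕ) (hp : 1 ≤ p) (h_distinct : ∀ i < p, lam (i + 1) < lam i)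
    (lamHat : ℕ → Ω → ℕ → ℝ) (φHat : ℕ → Ω → ℕ → CrossCov.L2 (I × I))
    (h_eigHat : ∀ T : ℕ, ∀ᵐ ω ∂P, CrossCov.IsOrderedEigensystem
      (CrossCov.longRunCovEst X Y W (h T) T ω) (lamHat T ω) (φHat T ω)) :
    TendstoInMeasure P
      (fun (T : ℕ) ω => ⨆ i : Fin p,
        ‖φHat T ω i - Real.sign (inner ℝ (φ i) (φHat T ω i)) • φ i‖) atTop (fun _ => 0) ∧
    TendstoInMeasure P
      (fun (T : ℕ) ω => ⨆ i : Fin p, |lamHat T ω i - lam i|) atTop (fun _ => 0) := by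
  have hne : Nonempty (Fin p) := ⟨⟨0, hp⟩⟩
  have hconv := fun (η : ℝ) (hη : 0 < η) =>
    hXY.tendsto_measure_kerHat hW h_atTop h_sqrt hη
  have hgood := hXY.longRunKer_mem hW h_atTop h_sqrt
  have hseq := h_eig.toSeq hXY.longRunCov_ae_eq
  have hseqHat : ∀ᶠ T in atTop, ∀ᵐ ω ∂P,
      CrossCov.IsOrderedEigenseq (CrossCov.opK (CrossCov.kerHat P g ε W (h T) T ω))
        (lamHat T ω) (φHat T ω) := by
    filter_upwards [eventually_ne_atTop 0, h_atTop.eventually_gt_atTop 0] with T hT hhT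
    filter_upwards [hXY.longRunCovEst_ae_eq hW hhT.ne' hT, h_eigHat T] with ω h1 h2
    exact h2.toSeq h1
  have hgoodHat : ∀ T ω, CrossCov.kerHat P g ε W (h T) T ω ∈
      CrossCov.goodKernels (I × I) := fun T ω =>
    CrossCov.estTot_mem_goodSubmodule _ _ _
  have hop : ∀ T ω, ‖CrossCov.opK (CrossCov.longRunKer P g ε) -
      CrossCov.opK (CrossCov.kerHat P g ε W (h T) T ω)‖ ≤
      ‖CrossCov.kerHat P g ε W (h T) T ω - CrossCov.longRunKer P g ε‖ := fun T ω => by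
    rw [← CrossCov.opK_sub, norm_sub_rev (CrossCov.kerHat P g ε W (h T) T ω)]
    exact CrossCov.norm_opK_le _
  -- Indices start at 0, so the `p` gaps `lam j - lam (j + 1)` with `j < p` are exactly those
  -- assumed positive. The smallest serves every `i < p`.
  obtain ⟨i₀, hi₀, hmin⟩ := (Finset.range p).exists_min_image (fun j => lam j - lam (j + 1))
    ⟨0, Finset.mem_range.2 hp⟩
  set δ := lam i₀ - lam (i₀ + 1) with hδ
  have hδ0 : 0 < δ := sub_pos.2 (h_distinct i₀ (Finset.mem_range.1 hi₀))
  constructor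
  · refine CrossCov.tendstoInMeasure_zero_of_le hconv (C := 4 * (p + 1) / δ) (by positivity)
      (fun T ω => Real.iSup_nonneg fun i => norm_nonneg _) ?_
    filter_upwards [hseqHat] with T hT
    filter_upwards [hT] with ω hω
    refine ciSup_le fun i => ?_
    refine (hseq.norm_eigenvector_sub_le hω hgood.1 (CrossCov.isSymmetric_of_mem_goodKernels hgood)
      (hgoodHat T ω).1 (CrossCov.isSymmetric_of_mem_goodKernels (hgoodHat T ω)) hδ0
      (fun j hj => hmin j (Finset.mem_range.2 (hj.trans_lt i.2)))).trans ?_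
    -- The Lipschitz constant `4 (i + 1) / δ` of each eigenvector is at most `4 (p + 1) / δ`, so one
    -- kernel bound controls the maximum.
    refine mul_le_mul ?_ (hop T ω) (norm_nonneg _) (by positivity)
    have hi : ((i : ℕ) : ℝ) ≤ p := by exact_mod_cast i.2.le
    gcongr
  · refine CrossCov.tendstoInMeasure_zero_of_le hconv one_pos
      (fun T ω => Real.iSup_nonneg fun i => abs_nonneg _) ?_
    filter_upwards [hseqHat] with T hT
    filter_upwards [hT] with ω hω
    refine ciSup_le fun i => ?_
    rw [one_mul]
    exact (hseq.abs_eigenvalue_sub_le hω hgood.1 (CrossCov.isSymmetric_of_mem_goodKernels hgood)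
      (hgoodHat T ω).1 (CrossCov.isSymmetric_of_mem_goodKernels (hgoodHat T ω)) i).trans (hop T ω)
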